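/- Let $\Bbbk$ be an algebraically closed field of characteristic $0$. **Arc rings.** For a commutative $\Bbbk$-algebra $R=\Bbbk[X_i]/\mathfrak a$ the arc ring $J^\infty(R)$ is $\Bbbk[X_i^{(j)}]_{j\ge0}$ modulo all $s$-coefficients of the series $f(X(s))$, $f\in\mathfrak a$, where $X_i(s)=\sum_jX_i^{(j)}s^j$; it does not depend on the presentation, and each $r\in R$ has coefficients $r^{(j)}\in J^\infty(R)$. Let $J^\infty_{\rm red}(R)$ be $J^\infty(R)$ modulo its nilradical. For a lattice polytope $P\subset\mathbb R^n$ (the convex hull of a nonempty finite set of integer points) with integer points $\alpha^1,\dots,\alpha^m$ (in a fixed enumeration) let $R(P)$ be the semigroup algebra of the integer points of the cone generated by $P\times\{1\}$, and let $Y_\alpha\in R(P)$ be the element of the semigroup point $(\alpha,1)$. Let $\mathbb J(P)=\Bbbk[X_\alpha^{(j)}]$, $\alpha\in P\cap\mathbb Z^n$, $j\ge0$, with the $\mathbb N^m$-grading in which $X^{(j)}_{\alpha^i}$ has degree $\epsilon_i$ and the grading $\operatorname{grad}X_\alpha^{(j)}=j$. Let $I(P)$ be the kernel of $\mathbb J(P)\to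 J^\infty_{\rm red}(R(P))$, $X_\alpha^{(j)}\mapsto Y_\alpha^{(j)}$. A monomial order $\prec$ is a total order on $\mathbb N^m$ such that $r\prec r'$ implies $r+t\prec r'+t$. The initial part $\mathrm{In}_\prec g$ of $g\ne0$ is its $\prec$-largest nonzero $\mathbb N^m$-homogeneous component, and $\mathrm{In}_\prec I$ is the linear span of the initial parts of the nonzero elements of $I$. Let $\mathrm{gr}_\prec J^\infty_{\rm red}(R(P))[r]$ be the image of $\bigoplus_{r'\preceq r}\mathbb J(P)[r']$ in $J^\infty_{\rm red}(R(P))$ modulo the image of $\bigoplus_{r'\prec r}\mathbb J(P)[r']$. **Cube generating data** $(P,\prec,\gamma,\{e_l\})$ consists of a lattice polytope $P$, a monomial order $\prec$, integers $\gamma(\alpha,\beta)=\gamma(\beta,\alpha)\ge0$ and integer vectors $e_1(\alpha,\beta),\dots,e_{\gamma(\alpha,\beta)+1}(\alpha,\beta)$ for all integer points $\alpha\ne\beta$ of $P$, such that * $\alpha+\sum_{l=1}^{\gamma(\alpha,\beta)+1}e_l(\alpha,\beta)=\beta$; * $\alpha+\sum_{l\in J}e_l(\alpha,\beta)\in P$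 for all $J\subset\{1,\dots,\gamma(\alpha,\beta)+1\}$; * $X_\alpha X_\beta\succ X_{\alpha+\sum_{l\in J}e_l(\alpha,\beta)}X_{\beta-\sum_{l\in J}e_l(\alpha,\beta)}$ for all nonempty proper $J\subset\{1,\dots,\gamma(\alpha,\beta)+1\}$; * $e_l(\beta,\alpha)=-e_l(\alpha,\beta)$. The data is *strict* if the coefficients of the series $X_\alpha(s)\,\partial_s^kX_\beta(s)$, $\alpha\ne\beta$, $0\le k<\gamma(\alpha,\beta)$, generate the ideal $\mathrm{In}_\prec I(P)$. The cube relations are the series $$W_{\alpha,\beta,k}=\sum_{I\subset\{2,\dots,\gamma(\alpha,\beta)+1\}}(-1)^{|I|}X_{\alpha+\sum_{l\in I\cup\{1\}}e_l(\alpha,\beta)}(s)\,\partial_s^kX_{\beta-\sum_{l\in I\cup\{1\}}e_l(\alpha,\beta)}(s).$$ **Lifting.** Let $\zeta:P\to\mathbb R_{\ge0}$ be a concave function with $\zeta_i=\zeta(\alpha^i)\in\mathbb Z$ for all $i$, and $\zeta_{\max}=\max_i\zeta_i$. Suppose that for all $i\ne j$ with $\zeta_i\le\zeta_j$ there are given integers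 $f_l(\alpha^i,\alpha^j)\ge0$, $1\le l\le\gamma(\alpha^i,\alpha^j)+1$, with $\zeta_i+\sum_lf_l(\alpha^i,\alpha^j)=\zeta_j$ and $\zeta_i+\sum_{l\in J}f_l(\alpha^i,\alpha^j)\le\zeta(\alpha^i+\sum_{l\in J}e_l(\alpha^i,\alpha^j))$ for all $J\subset\{1,\dots,\gamma(\alpha^i,\alpha^j)+1\}$. Let $P^\zeta\subset\mathbb R^{n+1}$ be the convex hull of $P\times\{\zeta_{\max}\}$ and all $(\alpha^i,g_i)$, $g_i=\zeta_{\max}-\zeta_i$; its integer points are the $(\alpha^i,a)$ with $g_i\le a\le\zeta_{\max}$. Put $(\alpha^i,a)<(\alpha^j,b)$ if $a<b$, or $a=b$ and $i<j$. For exponent vectors let $\mathrm{pr}(r)_i=\sum_ar_{(\alpha^i,a)}$, and put $r\prec^\zeta r'$ if $\mathrm{pr}(r)\prec\mathrm{pr}(r')$, or if $\mathrm{pr}(r)=\mathrm{pr}(r')$ and $r_x<r'_x$ at the $<$-smallest $x$ with $r_x\ne r'_x$. For $x=(\alpha^i,a)<y=(\alpha^j,b)$ put $\gamma(x,y)=\gamma(y,x)=\gamma(\alpha^i,\alpha^j)+\varkappa(x,y)$,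 where $\gamma(\alpha^i,\alpha^i)$ is read as $0$ and $$\varkappa(x,y)=\begin{cases}b-g_j,&g_j>a,\\ b-a,&g_j\le a,\ i<j,\\ b-a-1,&g_j\le a,\ i\ge j.\end{cases}$$ Put $e_l(y,x)=-e_l(x,y)$ and define $e_l(x,y)$, $1\le l\le\gamma(x,y)+1$, as follows; write $e_l=e_l(\alpha^i,\alpha^j)$ and $\gamma=\gamma(\alpha^i,\alpha^j)$ for $i\ne j$. * If $i=j$, all $e_l(x,y)$ are $(0,1)$. If $i\ne j$, then $e_l(x,y)=(0,1)$ for $l>\gamma+1$, and for $l\le\gamma+1$: * if $g_j>a$, then $e_l(x,y)=(e_l,v_l)$ with $v_l=\max(F_l-c,0)-\max(F_{l-1}-c,0)$, $c=a-g_i$, $F_l=\sum_{p\le l}f_p(\alpha^j,\alpha^i)$; * if $g_j\le a$ and $i<j$, then $e_l(x,y)=(e_l,0)$; * if $g_j\le a$ and $i>j$, then $e_l(x,y)=(e_l,0)$ for $l\le\gamma$ and $e_{\gamma+1}(x,y)=(e_{\gamma+1},1)$. **Theorem.** If $(P,\prec,\gamma,\{e_l\})$ is strict cube generating data, then $(P^\zeta,\prec^\zeta,\gamma,\{e_l\})$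 is strict cube generating data. Moreover, for integer points $x\ne y$ of $P^\zeta$ and $0\le k<\gamma(x,y)$, each coefficient of $W_{x,y,k}$ lies in $I(P^\zeta)$, and its initial part is the corresponding coefficient of $(-1)^{\gamma(x,y)}X_y(s)\,\partial_s^kX_x(s)$. Consequently, for every $r$ the map $\xi\mapsto(\xi\otimes1)\big(\prod_x\prod_{l=1}^{r_x}X_x(t_x^{(l)})\big)$ is an isomorphism of graded spaces from the graded dual (with respect to $\operatorname{grad}$) of $\mathrm{gr}_{\prec^\zeta}J^\infty_{\rm red}(R(P^\zeta))[r]$ onto the principal ideal $$\prod_{x<y}\ \prod_{\substack{1\le l\le r_x\\1\le l'\le r_y}}\big(t_x^{(l)}-t_y^{(l')}\big)^{\gamma(x,y)}\,\Lambda_r(\mathbf t),$$ where $\Lambda_r(\mathbf t)$ is the ring of polynomials in the $t_x^{(l)}$, $1\le l\le r_x$, that are symmetric in $t_x^{(1)},\dots,t_x^{(r_x)}$ for every $x$. -/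

import Mathlib

namespace ToricArc

/-! ### Arc rings -/

section ArcRings

variable {k : Type*} [Field k] {σ : Type*}

/-- The current `X_i(s) = ∑_j X_i^{(j)} s^j`; the variable `X_i^{(j)}` is `X (i, j)`. -/
noncomputable def current (k : Type*) [Field k] {σ : Type*} (i : σ) :
    PowerSeries (MvPolynomial (σ × ℕ) k) :=
  PowerSeries.mk fun j => MvPolynomial.X (i, j)

/-- The ideal generated by all `s`-coefficients of the series `f(X(s))`, for `f` in `𝔞`. -/
noncomputable def arcIdeal (𝔞 : Ideal (MvPolynomial σ k)) : Ideal (MvPolynomial (σ × ℕ) k) :=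
  Ideal.span {c | ∃ f ∈ 𝔞, ∃ d : ℕ,
    c = PowerSeries.coeff d (MvPolynomial.aeval (fun i => current k i) f)}

/-- The arc ring `J^∞(R)`, for the presentation of `R` with one generator for every element of `R`
and all relations among these generators (the arc ring does not depend on the presentation). -/
abbrev ArcRing (k : Type*) [Field k] (R : Type*) [CommRing R] [Algebra k R] : Type _ :=
  MvPolynomial (R × ℕ) k ⧸ arcIdeal (RingHom.ker (MvPolynomial.aeval (R := k) (fun r : R => r)))

/-- The reduced arc ring: the arc ring modulo its nilradical. -/
def ReducedArcRing (k : Type*) [Field k] (R : Type*) [CommRing R] [Algebra k R] : Type _ :=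
  ArcRing k R ⧸ nilradical (ArcRing k R)

noncomputable instance ReducedArcRing.instCommRing (k : Type*) [Field k] (R : Type*) [CommRing R]
    [Algebra k R] : CommRing (ReducedArcRing k R) :=
  inferInstanceAs (CommRing (ArcRing k R ⧸ nilradical (ArcRing k R)))

noncomputable instance ReducedArcRing.instAlgebra (k : Type*) [Field k] (R : Type*) [CommRing R]
    [Algebra k R] : Algebra k (ReducedArcRing k R) :=
  inferInstanceAs (Algebra k (ArcRing k R ⧸ nilradical (ArcRing k R)))

/-- The image of `r^{(j)}` in the reduced arc ring. -/
noncomputable def redArcCoeff (k : Type*) [Field k] {R : Type*} [CommRing R] [Algebra k R]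
    (r : R) (j : ℕ) : ReducedArcRing k R :=
  (Ideal.Quotient.mk (nilradical (ArcRing k R)) (Ideal.Quotient.mk _ (MvPolynomial.X (r, j))) :
    ArcRing k R ⧸ nilradical (ArcRing k R))

/-! ### Monomial orders, initial parts, associated graded spaces -/

/-- A total order (given by its strict part) on exponent vectors, compatible with addition. -/
structure IsMonomialOrder (prec : (σ →₀ ℕ) → (σ →₀ ℕ) → Prop) : Prop where
  irrefl : ∀ r, ¬ prec r r
  trans : ∀ r s t, prec r s → prec s t → prec r t
  total : ∀ r s, r ≠ s → prec r s ∨ prec s r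
  add_right : ∀ r s t, prec r s → prec (r + t) (s + t)

/-- The multidegree of the variable `X_i^{(j)}` is the `i`-th unit vector. -/
noncomputable def multiWeight (v : σ × ℕ) : σ →₀ ℕ := Finsupp.single v.1 1

/-- The degree `grad X_i^{(j)} = j`. -/
def gradWeight (v : σ × ℕ) : ℕ := v.2

/-- The homogeneous component of multidegree `r` of `k[X_i^{(j)}]`. -/
noncomputable def multiComponent (k : Type*) [Field k] {σ : Type*} (r : σ →₀ ℕ) :
    Submodule k (MvPolynomial (σ × ℕ) k) :=
  MvPolynomial.weightedHomogeneousSubmodule k multiWeight r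

/-- `h` is the initial part of `g`: the nonzero homogeneous component of `g` whose multidegree is
largest with respect to `prec`. -/
def IsInitialPart (prec : (σ →₀ ℕ) → (σ →₀ ℕ) → Prop) (g h : MvPolynomial (σ × ℕ) k) : Prop :=
  ∃ r, h = MvPolynomial.weightedHomogeneousComponent multiWeight r g ∧ h ≠ 0 ∧
    ∀ r', MvPolynomial.weightedHomogeneousComponent multiWeight r' g ≠ 0 → r' = r ∨ prec r' r

/-- The initial ideal: the linear span of the initial parts of the nonzero elements of `I`. -/
noncomputable def initialIdeal (prec : (σ →₀ ℕ) → (σ →₀ ℕ) → Prop) (I : Ideal (MvPolynomial (σ × ℕ) k)) :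
    Submodule k (MvPolynomial (σ × ℕ) k) :=
  Submodule.span k {h | ∃ g ∈ I, IsInitialPart prec g h}

/-- The `d`-th coefficient of the series `X_i(s) ∂^l X_j(s)`. -/
noncomputable def quadCoeff (k : Type*) [Field k] {σ : Type*} (i j : σ) (l d : ℕ) :
    MvPolynomial (σ × ℕ) k :=
  PowerSeries.coeff d (current k i *
    (⇑(PowerSeries.derivative (MvPolynomial (σ × ℕ) k)))^[l] (current k j))

variable {A : Type*} [CommRing A] [Algebra k A]

/-- The filtration component of `A` spanned by the images of multidegrees `⪯ r`. -/
noncomputable def filtLE (prec : (σ →₀ ℕ) → (σ →₀ ℕ) → Prop) (π : MvPolynomial (σ × ℕ) k →ₐ[k] A)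
    (r : σ →₀ ℕ) : Submodule k A :=
  ⨆ r' ∈ {r' | r' = r ∨ prec r' r}, (multiComponent k r').map π.toLinearMap

/-- The filtration component of `A` spanned by the images of multidegrees `≺ r`. -/
noncomputable def filtLT (prec : (σ →₀ ℕ) → (σ →₀ ℕ) → Prop) (π : MvPolynomial (σ × ℕ) k →ₐ[k] A)
    (r : σ →₀ ℕ) : Submodule k A :=
  ⨆ r' ∈ {r' | prec r' r}, (multiComponent k r').map π.toLinearMap

/-- The component of multidegree `r` of the associated graded algebra of `A`. -/
abbrev GrComponent (prec : (σ →₀ ℕ) → (σ →₀ ℕ) → Prop) (π : MvPolynomial (σ × ℕ) k →ₐ[k] A)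
    (r : σ →₀ ℕ) : Type _ :=
  filtLE prec π r ⧸ (filtLT prec π r).submoduleOf (filtLE prec π r)

theorem map_mem_filtLE (prec : (σ →₀ ℕ) → (σ →₀ ℕ) → Prop)
    (π : MvPolynomial (σ × ℕ) k →ₐ[k] A) (r : σ →₀ ℕ) (p : multiComponent k r) :
    (π.toLinearMap.comp (multiComponent k r).subtype) p ∈ filtLE prec π r :=
  Submodule.mem_iSup_of_mem r
    (Submodule.mem_iSup_of_mem (Or.inl rfl) (Submodule.mem_map_of_mem p.2))

/-- The class in the associated graded component of a polynomial of multidegree `r`. -/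
noncomputable def grClass (prec : (σ →₀ ℕ) → (σ →₀ ℕ) → Prop) (π : MvPolynomial (σ × ℕ) k →ₐ[k] A)
    (r : σ →₀ ℕ) : multiComponent k r →ₗ[k] GrComponent prec π r :=
  (Submodule.mkQ _).comp
    ((π.toLinearMap.comp (multiComponent k r).subtype).codRestrict (filtLE prec π r)
      (map_mem_filtLE prec π r))

/-- The graded dual, with respect to `grad`, of the associated graded component: the functionals
vanishing on all `grad`-homogeneous parts of sufficiently large degree. -/
noncomputable def gradedDual (prec : (σ →₀ ℕ) → (σ →₀ ℕ) → Prop) (π : MvPolynomial (σ × ℕ) k →ₐ[k] A)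
    (r : σ →₀ ℕ) : Submodule k (Module.Dual k (GrComponent prec π r)) where
  carrier := {ξ | ∃ D : ℕ, ∀ d, D ≤ d → ∀ p : multiComponent k r,
    MvPolynomial.IsWeightedHomogeneous gradWeight p.1 d → ξ (grClass prec π r p) = 0}
  zero_mem' := ⟨0, fun _ _ _ _ => rfl⟩
  add_mem' := by
    rintro ξ η ⟨D, hD⟩ ⟨E, hE⟩
    refine ⟨max D E, fun d hd p hp => ?_⟩
    rw [LinearMap.add_apply, hD d (le_trans (le_max_left _ _) hd) p hp,
      hE d (le_trans (le_max_right _ _) hd) p hp, add_zero]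
  smul_mem' := by
    rintro c ξ ⟨D, hD⟩
    refine ⟨D, fun d hd p hp => ?_⟩
    rw [LinearMap.smul_apply, hD d hd p hp, smul_zero]

/-- A functional is homogeneous of degree `d` if it vanishes on all parts of degree `≠ d`. -/
def IsHomogeneousFunctional (prec : (σ →₀ ℕ) → (σ →₀ ℕ) → Prop)
    (π : MvPolynomial (σ × ℕ) k →ₐ[k] A) (r : σ →₀ ℕ)
    (ξ : Module.Dual k (GrComponent prec π r)) (d : ℕ) : Prop :=
  ∀ d', d' ≠ d → ∀ p : multiComponent k r,
    MvPolynomial.IsWeightedHomogeneous gradWeight p.1 d' → ξ (grClass prec π r p) = 0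

/-! ### Partially symmetric polynomials -/

/-- Indices of the variables `t_i^{(l)}`, with `l` running over `r_i` values. -/
abbrev Slots (r : σ →₀ ℕ) : Type _ := Σ i : r.support, Fin (r i)

/-- The ring `Λ_r(t)` of polynomials in the `t_i^{(l)}` that are symmetric in the variables
`t_i^{(1)}, …, t_i^{(r_i)}` for every `i`. -/
noncomputable def Lam (k : Type*) [Field k] {σ : Type*} (r : σ →₀ ℕ) :
    Subalgebra k (MvPolynomial (Slots r) k) where
  carrier := {p | ∀ τ : (∀ i : r.support, Equiv.Perm (Fin (r i))),
    MvPolynomial.rename (Equiv.sigmaCongrRight τ) p = p}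
  mul_mem' := fun ha hb τ => by rw [map_mul, ha τ, hb τ]
  add_mem' := fun ha hb τ => by rw [map_add, ha τ, hb τ]
  algebraMap_mem' := fun c τ => by rw [AlgHom.commutes]

open Classical in
/-- The product of all `(t_i^{(l)} - t_j^{(l')})^{γ(i,j)}` with `i < j` for the order `lt`. -/
noncomputable def slotProduct (k : Type*) [Field k] {σ : Type*} (lt : σ → σ → Prop)
    (γ : σ → σ → ℕ) (r : σ →₀ ℕ) : MvPolynomial (Slots r) k :=
  ∏ u : Slots r, ∏ v : Slots r,
    if lt u.1 v.1 then (MvPolynomial.X u - MvPolynomial.X v) ^ γ u.1 v.1 else 1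

/-- The principal ideal of `Λ_r(t)` generated by `slotProduct`. -/
noncomputable def principalIdeal (k : Type*) [Field k] {σ : Type*} (lt : σ → σ → Prop)
    (γ : σ → σ → ℕ) (r : σ →₀ ℕ) : Submodule k (MvPolynomial (Slots r) k) :=
  (Subalgebra.toSubmodule (Lam k r)).map (LinearMap.mulLeft k (slotProduct k lt γ r))

/-- The monomial `∏ X_i^{(κ(i,l))}` over all slots `(i,l)`: this is the coefficient of
`∏ (t_i^{(l)})^{κ(i,l)}` in the product of the currents `X_i(t_i^{(l)})`. -/
noncomputable def slotMonomial (k : Type*) [Field k] {σ : Type*} (r : σ →₀ ℕ)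
    (κ : Slots r →₀ ℕ) : MvPolynomial (σ × ℕ) k :=
  ∏ u : Slots r, MvPolynomial.X ((u.1 : σ), κ u)

theorem slotMonomial_mem (r : σ →₀ ℕ) (κ : Slots r →₀ ℕ) :
    slotMonomial k r κ ∈ multiComponent k r := by
  have h : MvPolynomial.IsWeightedHomogeneous (R := k) multiWeight (slotMonomial k r κ)
      (∑ u : Slots r, Finsupp.single (u.1 : σ) 1) :=
    MvPolynomial.IsWeightedHomogeneous.prod _ _ _
      (fun u _ => MvPolynomial.isWeightedHomogeneous_X k multiWeight _)
  have hs : (∑ u : Slots r, Finsupp.single (u.1 : σ) 1) = r := by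
    rw [Fintype.sum_sigma]
    simp only [Finset.sum_const, Finset.card_univ, Fintype.card_fin, Finsupp.smul_single,
      smul_eq_mul, mul_one]
    rw [Finset.sum_coe_sort r.support (fun i => Finsupp.single i (r i))]
    exact Finsupp.sum_single r
  rw [hs] at h
  exact h

/-- The map `ξ ↦ (ξ ⊗ 1)(∏ X_i(t_i^{(l)}))` is an isomorphism of graded spaces from the graded dual
of the associated graded component of multidegree `r` onto the principal ideal of `Λ_r(t)`
generated by the product of all `(t_i^{(l)} - t_j^{(l')})^{γ(i,j)}` with `i < j`. -/
def DualIsPrincipalIdeal (prec : (σ →₀ ℕ) → (σ →₀ ℕ) → Prop)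
    (π : MvPolynomial (σ × ℕ) k →ₐ[k] A) (lt : σ → σ → Prop) (γ : σ → σ → ℕ)
    (r : σ →₀ ℕ) : Prop :=
  ∃ Φ : gradedDual prec π r ≃ₗ[k] principalIdeal k lt γ r, ∀ ξ : gradedDual prec π r,
    (∀ κ : Slots r →₀ ℕ, MvPolynomial.coeff κ (Φ ξ : MvPolynomial (Slots r) k) =
      (ξ : Module.Dual k (GrComponent prec π r))
        (grClass prec π r ⟨slotMonomial k r κ, slotMonomial_mem r κ⟩)) ∧
    ∀ d : ℕ, (Φ ξ : MvPolynomial (Slots r) k).IsHomogeneous d ↔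
      IsHomogeneousFunctional prec π r ξ d

end ArcRings

/-! ### Lattice polytopes and toric rings -/

section Polytopes

variable {n : ℕ}

/-- An integer vector as a real vector. -/
def toReal (x : Fin n → ℤ) : Fin n → ℝ := fun i => (x i : ℝ)

/-- The integer points of `P`. -/
def latticePoints (P : Set (Fin n → ℝ)) : Set (Fin n → ℤ) := {x | toReal x ∈ P}

/-- `P` is the convex hull of finitely many (and at least one) integer points. -/
def IsLatticePolytope (P : Set (Fin n → ℝ)) : Prop :=
  ∃ S : Finset (Fin n → ℤ), S.Nonempty ∧ P = convexHull ℝ (toReal '' (S : Set (Fin n → ℤ)))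

/-- The cone generated by the vectors `(a, 1)` with `a` in `P`. -/
def polytopeCone (P : Set (Fin n → ℝ)) : PointedCone ℝ ((Fin n → ℝ) × ℝ) :=
  PointedCone.hull ℝ ((fun a => (a, (1 : ℝ))) '' P)

/-- The semigroup of integer points of the cone over `P`. -/
def coneMonoid (P : Set (Fin n → ℝ)) : AddSubmonoid ((Fin n → ℤ) × ℤ) :=
  (polytopeCone P).toAddSubmonoid.comap
    (((Int.castAddHom ℝ).compLeft (Fin n)).prodMap (Int.castAddHom ℝ))

/-- The toric ring `R(P)`, the semigroup algebra of the integer points of the cone over `P`. -/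
abbrev ToricRing (k : Type*) [Field k] (P : Set (Fin n → ℝ)) : Type _ :=
  AddMonoidAlgebra k (coneMonoid P)

theorem generator_mem (P : Set (Fin n → ℝ)) (x : latticePoints P) :
    ((x : Fin n → ℤ), (1 : ℤ)) ∈ coneMonoid P := by
  have h : (toReal (x : Fin n → ℤ), (1 : ℝ)) ∈ polytopeCone P :=
    Submodule.subset_span ⟨_, x.2, rfl⟩
  have e : (((Int.castAddHom ℝ).compLeft (Fin n)).prodMap (Int.castAddHom ℝ))
      ((x : Fin n → ℤ), (1 : ℤ)) = (toReal (x : Fin n → ℤ), (1 : ℝ)) := by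
    ext <;> simp [toReal]
  change (((Int.castAddHom ℝ).compLeft (Fin n)).prodMap (Int.castAddHom ℝ))
      ((x : Fin n → ℤ), (1 : ℤ)) ∈ polytopeCone P
  rw [e]
  exact h

/-- The element `Y_x = z^x w` of the toric ring. -/
noncomputable def toricY (k : Type*) [Field k] (P : Set (Fin n → ℝ)) (x : latticePoints P) :
    ToricRing k P :=
  AddMonoidAlgebra.single ⟨((x : Fin n → ℤ), (1 : ℤ)), generator_mem P x⟩ 1

/-- The natural map from `k[X_x^{(j)}]`, `x` an integer point of `P`, to the reduced arc ring of
`R(P)`, sending `X_x^{(j)}` to `Y_x^{(j)}`. -/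
noncomputable def toricProj (k : Type*) [Field k] (P : Set (Fin n → ℝ)) :
    MvPolynomial (latticePoints P × ℕ) k →ₐ[k] ReducedArcRing k (ToricRing k P) :=
  MvPolynomial.aeval fun v => redArcCoeff k (toricY k P v.1) v.2

/-- The defining ideal of the reduced arc ring of `R(P)`. -/
noncomputable def definingIdeal (k : Type*) [Field k] (P : Set (Fin n → ℝ)) :
    Ideal (MvPolynomial (latticePoints P × ℕ) k) :=
  RingHom.ker (toricProj k P)

/-! ### Cube generating data -/

/-- `x + ∑_{l ∈ J} e_l(x, y)`. -/
def cubeVertex (e : (Fin n → ℤ) → (Fin n → ℤ) → ℕ → (Fin n → ℤ)) (x y : Fin n → ℤ)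
    (J : Finset ℕ) : Fin n → ℤ :=
  x + ∑ l ∈ J, e x y l

/-- Cube generating data. For distinct integer points `x, y` of `P` the vectors are `e x y l` with
`0 ≤ l ≤ γ x y`. The values of `γ` and `e` elsewhere play no role. The difference
`y - ∑_{l ∈ J} e_l(x, y)` is the vertex belonging to the complement of `J`. -/
structure IsCubeGeneratingData (P : Set (Fin n → ℝ))
    (prec : (latticePoints P →₀ ℕ) → (latticePoints P →₀ ℕ) → Prop)
    (γ : (Fin n → ℤ) → (Fin n → ℤ) → ℕ)
    (e : (Fin n → ℤ) → (Fin n → ℤ) → ℕ → (Fin n → ℤ)) : Prop where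
  polytope : IsLatticePolytope P
  order : IsMonomialOrder prec
  gamma_symm : ∀ x ∈ latticePoints P, ∀ y ∈ latticePoints P, x ≠ y → γ x y = γ y x
  sum_eq : ∀ x ∈ latticePoints P, ∀ y ∈ latticePoints P, x ≠ y →
    cubeVertex e x y (Finset.range (γ x y + 1)) = y
  vertex_mem : ∀ x ∈ latticePoints P, ∀ y ∈ latticePoints P, x ≠ y →
    ∀ J ⊆ Finset.range (γ x y + 1), cubeVertex e x y J ∈ latticePoints P
  initial : ∀ x y : latticePoints P, x ≠ y →
    ∀ J ⊂ Finset.range (γ x y + 1), J.Nonempty →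
    ∀ x' y' : latticePoints P, (x' : Fin n → ℤ) = cubeVertex e x y J →
      (y' : Fin n → ℤ) = y - ∑ l ∈ J, e x y l →
      prec (Finsupp.single x' 1 + Finsupp.single y' 1) (Finsupp.single x 1 + Finsupp.single y 1)
  antisymm : ∀ x ∈ latticePoints P, ∀ y ∈ latticePoints P, x ≠ y →
    ∀ l ≤ γ x y, e y x l = - e x y l

/-- The ideal generated by the coefficients of `X_x(s) ∂^l X_y(s)`, for distinct integer points
`x, y` of `P` and `0 ≤ l < γ(x, y)`. -/
noncomputable def quadIdeal (k : Type*) [Field k] (P : Set (Fin n → ℝ))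
    (γ : (Fin n → ℤ) → (Fin n → ℤ) → ℕ) : Ideal (MvPolynomial (latticePoints P × ℕ) k) :=
  Ideal.span {c | ∃ x y : latticePoints P, x ≠ y ∧ ∃ l < γ x y, ∃ d : ℕ, c = quadCoeff k x y l d}

/-- Strict cube generating data: the coefficients of the series `X_x(s) ∂^l X_y(s)` with
`0 ≤ l < γ(x, y)` generate the initial ideal of the defining ideal of the reduced arc ring. -/
structure IsStrictCubeGeneratingData (k : Type*) [Field k] (P : Set (Fin n → ℝ))
    (prec : (latticePoints P →₀ ℕ) → (latticePoints P →₀ ℕ) → Prop)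
    (γ : (Fin n → ℤ) → (Fin n → ℤ) → ℕ)
    (e : (Fin n → ℤ) → (Fin n → ℤ) → ℕ → (Fin n → ℤ)) : Prop where
  toData : IsCubeGeneratingData P prec γ e
  generate : (quadIdeal k P γ).restrictScalars k = initialIdeal prec (definingIdeal k P)

open Classical in
/-- The current `X_x(s)` for an integer vector `x`; it is zero if `x` is not in `P`. -/
noncomputable def pointCurrent (k : Type*) [Field k] (P : Set (Fin n → ℝ)) (x : Fin n → ℤ) :
    PowerSeries (MvPolynomial (latticePoints P × ℕ) k) :=
  if h : x ∈ latticePoints P then current k (⟨x, h⟩ : latticePoints P) else 0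

/-- The cube relation `W_{x,y,m}(X)`; the first of the vectors `e_l` is `e x y 0`. -/
noncomputable def cubeRelation (k : Type*) [Field k] (P : Set (Fin n → ℝ))
    (γ : (Fin n → ℤ) → (Fin n → ℤ) → ℕ)
    (e : (Fin n → ℤ) → (Fin n → ℤ) → ℕ → (Fin n → ℤ)) (x y : Fin n → ℤ) (m : ℕ) :
    PowerSeries (MvPolynomial (latticePoints P × ℕ) k) :=
  ∑ I ∈ (Finset.Icc 1 (γ x y)).powerset, (-1) ^ I.card *
    (pointCurrent k P (x + ∑ l ∈ insert 0 I, e x y l) *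
      (⇑(PowerSeries.derivative (MvPolynomial (latticePoints P × ℕ) k)))^[m]
        (pointCurrent k P (y - ∑ l ∈ insert 0 I, e x y l)))

/-! ### The lifted data -/

/-- The integer `ζ(x)` at an integer point where `ζ` takes an integer value. -/
noncomputable def zetaInt (ζ : (Fin n → ℝ) → ℝ) (x : Fin n → ℤ) : ℤ := ⌊ζ (toReal x)⌋

/-- The maximum of `ζ` over the integer points of `P`. -/
noncomputable def zetaMax (P : Set (Fin n → ℝ)) (ζ : (Fin n → ℝ) → ℝ) : ℤ :=
  sSup (zetaInt ζ '' latticePoints P)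

/-- `ζ_max - ζ(x)`, the smallest height over the integer point `x` in the lifted polytope. -/
noncomputable def floorHeight (P : Set (Fin n → ℝ)) (ζ : (Fin n → ℝ) → ℝ) (x : Fin n → ℤ) : ℤ :=
  zetaMax P ζ - zetaInt ζ x

/-- The polytope `P^ζ`: the convex hull of `P × ζ_max` and all `x × (ζ_max - ζ(x))`, where `x` runs
over the integer points of `P`. -/
def liftPolytope (P : Set (Fin n → ℝ)) (ζ : (Fin n → ℝ) → ℝ) : Set (Fin (n + 1) → ℝ) :=
  convexHull ℝ
    ((fun x : Fin n → ℝ => (Fin.snoc x (zetaMax P ζ : ℝ) : Fin (n + 1) → ℝ)) '' P ∪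
      (fun x : Fin n → ℤ => (Fin.snoc (toReal x) (floorHeight P ζ x : ℝ) : Fin (n + 1) → ℝ)) ''
        latticePoints P)

/-- The numbers `f_l(x, y)`, `0 ≤ l ≤ γ x y`, are suitable for lifting the data along `ζ`. -/
structure IsAdmissible (P : Set (Fin n → ℝ)) (γ : (Fin n → ℤ) → (Fin n → ℤ) → ℕ)
    (e : (Fin n → ℤ) → (Fin n → ℤ) → ℕ → (Fin n → ℤ)) (ζ : (Fin n → ℝ) → ℝ)
    (f : (Fin n → ℤ) → (Fin n → ℤ) → ℕ → ℕ) : Prop where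
  sum_eq : ∀ x ∈ latticePoints P, ∀ y ∈ latticePoints P, x ≠ y → ζ (toReal x) ≤ ζ (toReal y) →
    ζ (toReal x) + ∑ l ∈ Finset.range (γ x y + 1), (f x y l : ℝ) = ζ (toReal y)
  le : ∀ x ∈ latticePoints P, ∀ y ∈ latticePoints P, x ≠ y → ζ (toReal x) ≤ ζ (toReal y) →
    ∀ J ⊆ Finset.range (γ x y + 1),
      ζ (toReal x) + ∑ l ∈ J, (f x y l : ℝ) ≤ ζ (toReal (cubeVertex e x y J))

/-- The projection of an integer point forgetting the last coordinate. -/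
def base (x : Fin (n + 1) → ℤ) : Fin n → ℤ := fun i => x i.castSucc

/-- The last coordinate of an integer point. -/
def height (x : Fin (n + 1) → ℤ) : ℤ := x (Fin.last n)

/-- The order on the integer points of `P^ζ`: first by height, then by the enumeration of the
integer points of `P`. -/
def liftLT (idx : (Fin n → ℤ) → ℕ) (x y : Fin (n + 1) → ℤ) : Prop :=
  height x < height y ∨ (height x = height y ∧ idx (base x) < idx (base y))

/-- The vector `pr_{n+1}(r)`, whose entry at `x` is the sum of the entries of `r` over `x`. -/
noncomputable def prVec (P : Set (Fin n → ℝ)) (Q : Set (Fin (n + 1) → ℝ))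
    (r : latticePoints Q →₀ ℕ) : latticePoints P →₀ ℕ :=
  (r.mapDomain fun y : latticePoints Q => base y.1).subtypeDomain (· ∈ latticePoints P)

/-- The order `≺^ζ`: compare the projections with `≺`, then compare lexicographically. -/
def liftPrec (P : Set (Fin n → ℝ)) (idx : (Fin n → ℤ) → ℕ)
    (prec : (latticePoints P →₀ ℕ) → (latticePoints P →₀ ℕ) → Prop) (ζ : (Fin n → ℝ) → ℝ)
    (r r' : latticePoints (liftPolytope P ζ) →₀ ℕ) : Prop :=
  prec (prVec P _ r) (prVec P _ r') ∨
    (prVec P _ r = prVec P _ r' ∧ ∃ y, r y < r' y ∧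
      ∀ z : latticePoints (liftPolytope P ζ), liftLT idx z y → r z = r' z)

open Classical in
/-- The number `ϰ(x, y)` for `x < y`. -/
noncomputable def kappa (P : Set (Fin n → ℝ)) (idx : (Fin n → ℤ) → ℕ) (ζ : (Fin n → ℝ) → ℝ)
    (x y : Fin (n + 1) → ℤ) : ℤ :=
  if height x < floorHeight P ζ (base y) then height y - floorHeight P ζ (base y)
  else if idx (base x) < idx (base y) then height y - height x
  else height y - height x - 1

open Classical in
/-- The number `γ(x, y) = γ(base x, base y) + ϰ(x, y)` for `x < y`, where `γ(a, a)` is read as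
zero. -/
noncomputable def gammaLT (P : Set (Fin n → ℝ)) (idx : (Fin n → ℤ) → ℕ)
    (γ : (Fin n → ℤ) → (Fin n → ℤ) → ℕ) (ζ : (Fin n → ℝ) → ℝ) (x y : Fin (n + 1) → ℤ) : ℕ :=
  (if base x = base y then 0 else γ (base x) (base y)) + (kappa P idx ζ x y).toNat

open Classical in
/-- The symmetric collection of numbers `γ` on the integer points of `P^ζ`. -/
noncomputable def liftGamma (P : Set (Fin n → ℝ)) (idx : (Fin n → ℤ) → ℕ)
    (γ : (Fin n → ℤ) → (Fin n → ℤ) → ℕ) (ζ : (Fin n → ℝ) → ℝ) (x y : Fin (n + 1) → ℤ) : ℕ :=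
  if liftLT idx x y then gammaLT P idx γ ζ x y else gammaLT P idx γ ζ y x

/-- The vertical component of the vectors over the `e_l(x, y)`, when one has to climb from height
`c` above the lowest point over `x`: with `F_l` the sum of the first `l` of the numbers `f`, it is
zero as long as `F_{l+1} ≤ c`, it is `F_{l+1} - c` at the first `l` with `F_{l+1} > c`, and it is
`f_l` afterwards (truncated subtraction of natural numbers). -/
def climb (f : ℕ → ℕ) (c l : ℕ) : ℕ :=
  (∑ m ∈ Finset.range (l + 1), f m - c) - (∑ m ∈ Finset.range l, f m - c)

open Classical in
/-- The vectors `e_l(x, y)` of the lifted data, for `x < y`. -/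
noncomputable def eLT (P : Set (Fin n → ℝ)) (idx : (Fin n → ℤ) → ℕ)
    (γ : (Fin n → ℤ) → (Fin n → ℤ) → ℕ)
    (e : (Fin n → ℤ) → (Fin n → ℤ) → ℕ → (Fin n → ℤ)) (ζ : (Fin n → ℝ) → ℝ)
    (f : (Fin n → ℤ) → (Fin n → ℤ) → ℕ → ℕ) (x y : Fin (n + 1) → ℤ) (l : ℕ) : Fin (n + 1) → ℤ :=
  if base x = base y ∨ γ (base x) (base y) < l then Fin.snoc (0 : Fin n → ℤ) (1 : ℤ)
  else if height x < floorHeight P ζ (base y) then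
    Fin.snoc (e (base x) (base y) l)
      (climb (f (base y) (base x)) (height x - floorHeight P ζ (base x)).toNat l : ℤ)
  else if idx (base x) < idx (base y) ∨ l < γ (base x) (base y) then
    Fin.snoc (e (base x) (base y) l) (0 : ℤ)
  else Fin.snoc (e (base x) (base y) l) (1 : ℤ)

open Classical in
/-- The vectors `e_l(x, y)` of the lifted data, antisymmetric in `x` and `y`. -/
noncomputable def liftE (P : Set (Fin n → ℝ)) (idx : (Fin n → ℤ) → ℕ)
    (γ : (Fin n → ℤ) → (Fin n → ℤ) → ℕ)
    (e : (Fin n → ℤ) → (Fin n → ℤ) → ℕ → (Fin n → ℤ)) (ζ : (Fin n → ℝ) → ℝ)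
    (f : (Fin n → ℤ) → (Fin n → ℤ) → ℕ → ℕ) (x y : Fin (n + 1) → ℤ) (l : ℕ) : Fin (n + 1) → ℤ :=
  if liftLT idx x y then eLT P idx γ e ζ f x y l else - eLT P idx γ e ζ f y x l

end Polytopes

end ToricArc

/-!
Both strictness of the lifted data and the description of the graded duals are deduced from two
inclusions between the ideal `diagIdeal` generated by the coefficients of `X_x(s) ∂^l X_y(s)`,
`l < γ(x, y)`, and the initial ideal.

*The quadratic relations are initial parts of relations.* The reduced arc ring embeds into a product
of domains, so a cube relation may be verified for series over a domain. There, up to a common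
factor, the series attached to the vertices of a cube are products of quotients of series attached
to its edges, and the relation says that an iterated commutator of a differential operator of order
`m` with more than `m` functions is zero (`cubeSum_eq_zero`, `cube_relation`). By the axioms of cube
generating data the last summand of a cube relation is its initial part
(`IsCubeGeneratingData.isInitialPart_cubeRelation`). All this applies to the lifted data, which is
cube generating data by `IsLiftFunction.isCubeGeneratingData_lift`.

*Symbols.* A functional on the polynomials of multidegree `r` is described by its symbol, the
generating series of its values on monomials, in one variable ("slot") for every factor of a
monomial. A functional that annihilates the quadratic relations and has finite degree has as its
symbol a polynomial in the principal ideal: the relations `X_x(s) ∂^l X_y(s)` say that the symbol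
vanishes to order `γ(x, y)` on the diagonals (`IsSymbol.pow_dvd`). Hence the initial ideal cannot be
larger than `diagIdeal`, and the graded dual cannot be smaller than the principal ideal, once every
element of the principal ideal is known to be the symbol of a functional on the associated graded
space; the double annihilator argument is carried out in `diagIdeal_eq_initialIdeal` and
`dualIsPrincipalIdeal`.

*Functionals with given symbols.* Here strictness for `P` enters
(`exists_functional_of_mem_principalIdeal`). Substituting `X_(α,a)(s) ↦ X_α(s) z(s)^a`, with an
independent series `z(s)`, maps relations of `R(P^ζ)` to relations of `R(P)` with coefficients in the
polynomials in the coefficients of `z` (`IsLiftFunction.coeff_liftHom_mem_definingIdeal`), and their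
leading parts lie in the quadratic ideal of `P`. So every symmetric polynomial in the slots of the
`X_α`, vanishing on the diagonals to the orders given by the `γ(α, β)`, and in additional slots of
`z`, gives a functional on the associated graded space of `P^ζ`, as long as its specializations at
smaller multidegrees with the same projection vanish. The specialization at a multidegree sets `a`
slots of `z` equal to each slot of an `X_(α,a)`. A polynomial with the required specializations is
constructed in `exists_specialization`. For every slot `t_i`, let `∏ (y - u_q)`, with `u_q` running
through the slots of `z`, be divided with remainder by a product of powers of the `y - t_p`, and let
`y = t_i` in the quotient. The product of these values over all `i` is multiplied by a Vandermonde
product and the given symmetric polynomial, antisymmetrized over the slots with the same `α`, and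
divided by the Vandermonde product of these slots. Its specialization at the given multidegree is
the product of the `(t_x - t_y)^{ϰ(x, y)}` (`IsLiftFunction.columnExp_eq_kappa`) and the symmetric
polynomial, and `ϰ(x, y)` is exactly the excess of `γ(x, y)` over `γ(α, β)`.
-/

namespace ToricArc

/-! ### Divisibility by powers of differences of variables -/

section Divisibility

open MvPolynomial

variable {k : Type*} [Field k] {ι : Type*}

theorem X_sub_X_ne_zero {i j : ι} (h : i ≠ j) : (X i - X j : MvPolynomial ι k) ≠ 0 :=
  sub_ne_zero.2 fun e => h (X_injective e)

/-- Modulo a difference `u` of two variables, differentiating `u ^ m * G` exactly `m` times with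
respect to the second variable leaves `± m! G`. -/
theorem dvd_iterate_pderiv_sub {i j : ι} (h : i ≠ j) (m : ℕ) (G : MvPolynomial ι k) :
    (X i - X j) ∣ (pderiv j)^[m] ((X i - X j) ^ m * G) - C ((-1) ^ m * (m.factorial : k)) * G := by
  induction m generalizing G with
  | zero => simp
  | succ m ih =>
    have hu : pderiv j (X i - X j : MvPolynomial ι k) = -1 := by
      rw [map_sub, pderiv_X_self, pderiv_X_of_ne h, zero_sub]
    have e : pderiv j ((X i - X j) ^ (m + 1) * G) =
        (X i - X j) ^ m * (C (-(m + 1 : k)) * G) +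
          (X i - X j) ^ m * ((X i - X j) * pderiv j G) := by
      rw [pderiv_mul, pderiv_pow, hu]
      push_cast
      simp only [map_neg, map_add, map_natCast, map_one]
      ring
    have hadd : ∀ A B : MvPolynomial ι k,
        (pderiv j)^[m] (A + B) = (pderiv j)^[m] A + (pderiv j)^[m] B :=
      fun A B => iterate_map_add (pderiv (R := k) j) m A B
    rw [Function.iterate_succ_apply, e, hadd]
    have h₁ := ih (C (-(m + 1 : k)) * G)
    have h₂ := (ih ((X i - X j) * pderiv j G)).add
      (Dvd.intro (C ((-1) ^ m * (m.factorial : k)) * pderiv j G) rfl)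
    convert h₁.add h₂ using 1
    simp only [Nat.factorial_succ, map_mul, map_neg, map_add, map_natCast, map_one, map_pow]
    push_cast
    ring

theorem dvd_iterate_pderiv_of_pow_dvd {i j : ι} (h : i ≠ j) {m l : ℕ} (hl : l < m)
    {F : MvPolynomial ι k} (hF : (X i - X j) ^ m ∣ F) : (X i - X j) ∣ (pderiv j)^[l] F := by
  obtain ⟨G, rfl⟩ := hF
  obtain ⟨d, rfl⟩ := Nat.exists_eq_add_of_lt hl
  have := dvd_iterate_pderiv_sub h l ((X i - X j) ^ (d + 1) * G)
  rw [← mul_assoc, ← pow_add, ← add_assoc] at this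
  refine (dvd_iff_dvd_of_dvd_sub this).2 (dvd_mul_of_dvd_right ?_ _)
  exact dvd_mul_of_dvd_left (dvd_pow_self _ (Nat.succ_ne_zero d)) _

/-- In characteristic zero, the order of vanishing on a diagonal is detected by derivatives. -/
theorem pow_dvd_of_dvd_iterate_pderiv [CharZero k] {i j : ι} (h : i ≠ j) {m : ℕ}
    {F : MvPolynomial ι k} (hF : ∀ l < m, (X i - X j) ∣ (pderiv j)^[l] F) :
    (X i - X j) ^ m ∣ F := by
  induction m with
  | zero => simp
  | succ m ih =>
    obtain ⟨G, rfl⟩ := ih fun l hl => hF l (by omega)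
    have h₁ := (hF m (by omega)).sub (dvd_iterate_pderiv_sub h m G)
    rw [sub_sub_cancel] at h₁
    have hu : IsUnit (C ((-1) ^ m * (m.factorial : k)) : MvPolynomial ι k) :=
      (IsUnit.mk0 _ (mul_ne_zero (pow_ne_zero _ (neg_ne_zero.2 one_ne_zero))
        (Nat.cast_ne_zero.2 m.factorial_ne_zero))).map C
    rw [pow_succ]
    exact mul_dvd_mul_left _ (hu.dvd_mul_left.1 h₁)

variable [DecidableEq ι]

theorem rename_update_X_sub_X (i j : ι) :
    rename (Function.update id j i) (X i - X j : MvPolynomial ι k) = 0 := by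
  by_cases h : i = j <;> simp [h]

theorem X_sub_X_dvd_sub_rename (i j : ι) (F : MvPolynomial ι k) :
    (X i - X j) ∣ F - rename (Function.update id j i) F := by
  rw [← Ideal.mem_span_singleton, ← Ideal.Quotient.eq]
  have h : ((Ideal.Quotient.mkₐ k (Ideal.span {(X i - X j : MvPolynomial ι k)})).comp
      (rename (Function.update id j i))) = Ideal.Quotient.mkₐ k _ := by
    apply MvPolynomial.algHom_ext
    intro p
    rw [AlgHom.comp_apply, rename_X]
    by_cases hp : p = j
    · subst hp
      rw [Function.update_self, Ideal.Quotient.mkₐ_eq_mk, Ideal.Quotient.eq]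
      exact Ideal.mem_span_singleton_self _
    · rw [Function.update_of_ne hp, id]
  exact (DFunLike.congr_fun h F).symm

theorem X_sub_X_dvd_iff (i j : ι) (F : MvPolynomial ι k) :
    (X i - X j) ∣ F ↔ rename (Function.update id j i) F = 0 := by
  constructor
  · rintro ⟨G, rfl⟩
    rw [map_mul, rename_update_X_sub_X, zero_mul]
  · intro h
    have := X_sub_X_dvd_sub_rename i j F
    rwa [h, sub_zero] at this

theorem prime_X_sub_X {i j : ι} (h : i ≠ j) : Prime (X i - X j : MvPolynomial ι k) := by
  refine ⟨X_sub_X_ne_zero h, fun hu => ?_, fun a b hab => ?_⟩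
  · have := hu.map (rename (R := k) (Function.update id j i))
    rw [rename_update_X_sub_X] at this
    exact not_isUnit_zero this
  · rw [X_sub_X_dvd_iff, map_mul, mul_eq_zero] at hab
    simpa only [X_sub_X_dvd_iff] using hab

theorem isRelPrime_X_sub_X {i j p q : ι} (h : i ≠ j) (h₁ : ¬(p = i ∧ q = j))
    (h₂ : ¬(p = j ∧ q = i)) (hpq : p ≠ q) :
    IsRelPrime (X i - X j : MvPolynomial ι k) (X p - X q) := by
  refine (prime_X_sub_X h).irreducible.isRelPrime_iff_not_dvd.2 fun hd => ?_
  rw [X_sub_X_dvd_iff, map_sub, rename_X, rename_X, sub_eq_zero] at hd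
  have hd := X_injective hd
  simp only [Function.update_apply, id] at hd
  split_ifs at hd with ha hb hb <;> grind

/-- A polynomial divisible by powers of several differences of variables is divisible by their
product, as long as no two of the differences are proportional. -/
theorem prod_X_sub_X_pow_dvd [Fintype ι] (R : ι → ι → Prop) [DecidableRel R]
    (hR : ∀ i j, R i j → ¬R j i) (c : ι → ι → ℕ) (F : MvPolynomial ι k)
    (hF : ∀ i j, R i j → (X i - X j) ^ c i j ∣ F) :
    (∏ i, ∏ j, if R i j then (X i - X j) ^ c i j else 1) ∣ F := by
  rw [← Fintype.prod_prod_type' (fun i j => if R i j then (X i - X j : MvPolynomial ι k) ^ c i j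
    else 1)]
  refine Fintype.prod_dvd_of_isRelPrime ?_ ?_
  · rintro ⟨i, j⟩ ⟨p, q⟩ hne
    simp only [Function.onFun]
    split_ifs with h₁ h₂ h₂
    · refine IsRelPrime.pow (isRelPrime_X_sub_X ?_ ?_ ?_ ?_)
      · rintro rfl; exact hR _ _ h₁ h₁
      · rintro ⟨rfl, rfl⟩; exact hne rfl
      · rintro ⟨rfl, rfl⟩; exact hR _ _ h₁ h₂
      · rintro rfl; exact hR _ _ h₂ h₂
    · exact isRelPrime_one_right
    · exact isRelPrime_one_left
    · exact isRelPrime_one_left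
  · rintro ⟨i, j⟩
    dsimp only
    split_ifs with h
    · exact hF _ _ h
    · exact one_dvd _

end Divisibility

/-! ### Colored slots and functionals given by symmetric polynomials -/

section Slots

open MvPolynomial

variable {k : Type*} [Field k] {σ τ : Type*} {ι ι' : Type*} [Fintype ι] [Fintype ι']

/-- The number of slots of every color, for slots `ι` colored by `c`. -/
noncomputable def colorDeg (c : ι → σ) : σ →₀ ℕ := ∑ i, Finsupp.single (c i) 1

theorem colorDeg_apply [DecidableEq σ] (c : ι → σ) (x : σ) :
    colorDeg c x = (Finset.univ.filter fun i => c i = x).card := by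
  rw [colorDeg, Finsupp.finsetSum_apply, Finset.card_filter]
  exact Finset.sum_congr rfl fun i _ => Finsupp.single_apply

theorem colorDeg_mapDomain (c : ι → σ) (b : σ → τ) :
    (colorDeg c).mapDomain b = colorDeg (b ∘ c) := by
  simp [colorDeg, Finsupp.mapDomain_finsetSum, Finsupp.mapDomain_single]

theorem colorDeg_comp_equiv (c : ι → σ) (e : ι' ≃ ι) : colorDeg (c ∘ e) = colorDeg c :=
  Equiv.sum_comp e fun i => Finsupp.single (c i) 1

theorem exists_equiv_of_colorDeg_eq {c : ι → σ} {c' : ι' → σ} (h : colorDeg c = colorDeg c') :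
    ∃ e : ι ≃ ι', c' ∘ e = c := by
  classical
  have he : ∀ x, Nonempty ({i // c i = x} ≃ {i // c' i = x}) := fun x => by
    refine ⟨Fintype.equivOfCardEq ?_⟩
    have hx := DFunLike.congr_fun h x
    rw [colorDeg_apply, colorDeg_apply] at hx
    rw [Fintype.card_subtype, Fintype.card_subtype]
    convert hx
  exact ⟨Equiv.ofFiberEquiv fun x => (he x).some, funext fun i => Equiv.ofFiberEquiv_map _ i⟩

theorem exists_colorDeg_eq (m : σ →₀ ℕ) : ∃ (n : ℕ) (c : Fin n → σ), colorDeg c = m := by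
  induction m using Finsupp.induction_linear with
  | zero => exact ⟨0, Fin.elim0, by simp [colorDeg]⟩
  | add f g hf hg =>
    obtain ⟨n, c, rfl⟩ := hf
    obtain ⟨n', c', rfl⟩ := hg
    refine ⟨n + n', Fin.append c c', ?_⟩
    simp [colorDeg, Fin.sum_univ_add]
  | single a b => exact ⟨b, fun _ => a, by simp [colorDeg]⟩

/-- The exponent of the monomial `∏ X_{c(i)}^{(κ(i))}`. -/
noncomputable def slotExp (c : ι → σ) (κ : ι →₀ ℕ) : σ × ℕ →₀ ℕ := colorDeg fun i => (c i, κ i)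

/-- The monomial `∏ X_{c(i)}^{(κ(i))}`: the coefficient of `∏ t_i^{κ(i)}` in the product of the
currents `X_{c(i)}(t_i)`. -/
noncomputable def slotMon (k : Type*) [Field k] (c : ι → σ) (κ : ι →₀ ℕ) :
    MvPolynomial (σ × ℕ) k := ∏ i, X (c i, κ i)

theorem slotMon_eq_monomial (c : ι → σ) (κ : ι →₀ ℕ) :
    slotMon k c κ = monomial (slotExp c κ) 1 := by
  rw [slotExp, colorDeg, monomial_sum_one]
  rfl

theorem weight_colorDeg (v : ι → σ × ℕ) :
    Finsupp.weight multiWeight (colorDeg v) = colorDeg (Prod.fst ∘ v) := by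
  simp [colorDeg, map_sum, Finsupp.weight_single, multiWeight]

theorem weight_slotExp (c : ι → σ) (κ : ι →₀ ℕ) :
    Finsupp.weight multiWeight (slotExp c κ) = colorDeg c := weight_colorDeg _

theorem gradWeight_slotExp (c : ι → σ) (κ : ι →₀ ℕ) :
    Finsupp.weight gradWeight (slotExp c κ) = ∑ i, κ i := by
  simp [slotExp, colorDeg, map_sum, Finsupp.weight_single, gradWeight]

theorem exists_slotExp_of_mapDomain (b : σ → τ) (m : σ × ℕ →₀ ℕ) (c : ι → τ)
    (h : (Finsupp.weight multiWeight m).mapDomain b = colorDeg c) :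
    ∃ c' : ι → σ, b ∘ c' = c ∧ ∃ κ, m = slotExp c' κ := by
  obtain ⟨n, v, rfl⟩ := exists_colorDeg_eq m
  rw [weight_colorDeg, colorDeg_mapDomain] at h
  obtain ⟨e, he⟩ := exists_equiv_of_colorDeg_eq h.symm
  refine ⟨Prod.fst ∘ v ∘ e, he, Finsupp.equivFunOnFinite.symm fun i => (v (e i)).2, ?_⟩
  exact (colorDeg_comp_equiv v e).symm

theorem exists_slotExp (m : σ × ℕ →₀ ℕ) (c : ι → σ)
    (h : Finsupp.weight multiWeight m = colorDeg c) : ∃ κ, m = slotExp c κ := by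
  obtain ⟨c', h₁, h₂⟩ := exists_slotExp_of_mapDomain id m c (by rw [Finsupp.mapDomain_id, h])
  rw [Function.id_comp] at h₁
  exact h₁ ▸ h₂

/-- The polynomial `F` in the variables `t_i` is symmetric in the variables of every color. -/
def IsColorSymm (c : ι → σ) (F : MvPolynomial ι k) : Prop :=
  ∀ π : Equiv.Perm ι, c ∘ π = c → rename π F = F

theorem IsColorSymm.coeff_eq {c : ι → σ} {F : MvPolynomial ι k} (hF : IsColorSymm c F)
    {κ κ' : ι →₀ ℕ} (h : slotExp c κ = slotExp c κ') : coeff κ F = coeff κ' F := by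
  obtain ⟨π, hπ⟩ := exists_equiv_of_colorDeg_eq h
  have h₁ : c ∘ π = c := funext fun i => congrArg Prod.fst (congrFun hπ i)
  have h₂ : κ = Finsupp.mapDomain π.symm κ' := by
    ext i
    rw [← Finsupp.equivMapDomain_eq_mapDomain, Finsupp.equivMapDomain_apply, Equiv.symm_symm]
    exact (congrArg Prod.snd (congrFun hπ i)).symm
  have h₃ : c ∘ π.symm = c := by
    conv_lhs => rw [← h₁]
    rw [Function.comp_assoc, Equiv.self_comp_symm, Function.comp_id]
  rw [h₂, ← hF π.symm h₃, coeff_rename_mapDomain _ π.symm.injective, hF π.symm h₃]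

open Classical in
/-- The product of all `(t_i - t_j)^{γ(c(i), c(j))}` over the slots `i, j` whose colors are related
by `R`. -/
noncomputable def diffProd (k : Type*) [Field k] (c : ι → σ) (R : σ → σ → Prop) (γ : σ → σ → ℕ) :
    MvPolynomial ι k :=
  ∏ i, ∏ j, if R (c i) (c j) then (X i - X j) ^ γ (c i) (c j) else 1

theorem diffProd_ne_zero (c : ι → σ) {R : σ → σ → Prop} (hR : ∀ x, ¬R x x) (γ : σ → σ → ℕ) :
    diffProd k c R γ ≠ 0 :=
  Finset.prod_ne_zero_iff.2 fun i _ => Finset.prod_ne_zero_iff.2 fun j _ => by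
    split_ifs with h
    · exact pow_ne_zero _ (X_sub_X_ne_zero fun e => hR (c j) (e ▸ h))
    · exact one_ne_zero

theorem rename_diffProd {c : ι → σ} {c' : ι' → σ} (e : ι ≃ ι') (he : c' ∘ e = c)
    (R : σ → σ → Prop) (γ : σ → σ → ℕ) : rename e (diffProd k c R γ) = diffProd k c' R γ := by
  rw [diffProd, diffProd, map_prod, ← Equiv.prod_comp e]
  refine Finset.prod_congr rfl fun i _ => ?_
  rw [map_prod, ← Equiv.prod_comp e]
  refine Finset.prod_congr rfl fun j _ => ?_
  have h : ∀ i, c' (e i) = c i := congrFun he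
  rw [h, h]
  split_ifs <;> simp

theorem diffProd_symm (c : ι → σ) (R : σ → σ → Prop) (γ : σ → σ → ℕ) :
    IsColorSymm c (diffProd k c R γ) := fun π hπ => rename_diffProd π hπ R γ

open Classical in
/-- The functional sending `∏ X_{c(i)}^{(κ(i))}` to the coefficient of `∏ t_i^{κ(i)}` in `F`, and
all other monomials to zero. -/
noncomputable def symFunctional (c : ι → σ) (F : MvPolynomial ι k) :
    MvPolynomial (σ × ℕ) k →ₗ[k] k :=
  (basisMonomials (σ × ℕ) k).constr k fun m =>
    if h : ∃ κ, m = slotExp c κ then coeff h.choose F else 0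

theorem symFunctional_slotMon {c : ι → σ} {F : MvPolynomial ι k} (hF : IsColorSymm c F)
    (κ : ι →₀ ℕ) : symFunctional c F (slotMon k c κ) = coeff κ F := by
  have h : ∃ κ', slotExp c κ = slotExp c κ' := ⟨κ, rfl⟩
  rw [slotMon_eq_monomial, ← congrFun (coe_basisMonomials (σ × ℕ) k), symFunctional,
    Module.Basis.constr_basis, dif_pos h]
  exact hF.coeff_eq h.choose_spec.symm

theorem symFunctional_monomial_eq_zero {c : ι → σ} (F : MvPolynomial ι k) {m : σ × ℕ →₀ ℕ}
    (hm : Finsupp.weight multiWeight m ≠ colorDeg c) :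
    symFunctional c F (monomial m 1) = 0 := by
  have h : ¬∃ κ, m = slotExp c κ := by
    rintro ⟨κ, rfl⟩
    exact hm (weight_slotExp c κ)
  rw [← congrFun (coe_basisMonomials (σ × ℕ) k), symFunctional, Module.Basis.constr_basis, dif_neg h]

/-- Two functionals agreeing on the monomials of a multidegree agree on its component. -/
theorem eq_of_eq_on_monomials {V : Type*} [AddCommGroup V] [Module k V]
    (ξ η : MvPolynomial (σ × ℕ) k →ₗ[k] V) {r : σ →₀ ℕ}
    (h : ∀ m, Finsupp.weight multiWeight m = r → ξ (monomial m 1) = η (monomial m 1))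
    {g : MvPolynomial (σ × ℕ) k} (hg : IsWeightedHomogeneous multiWeight g r) : ξ g = η g := by
  rw [g.as_sum, map_sum, map_sum]
  refine Finset.sum_congr rfl fun m hm => ?_
  have : monomial m (coeff m g) = coeff m g • monomial m 1 := by
    rw [smul_monomial, smul_eq_mul, mul_one]
  rw [this, map_smul, map_smul, h m (hg (mem_support_iff.1 hm))]

theorem symFunctional_eq_zero {c : ι → σ} (F : MvPolynomial ι k) {r : σ →₀ ℕ}
    (hr : r ≠ colorDeg c) {g : MvPolynomial (σ × ℕ) k}
    (hg : IsWeightedHomogeneous multiWeight g r) : symFunctional c F g = 0 :=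
  eq_of_eq_on_monomials (symFunctional c F) 0
    (fun m hm => symFunctional_monomial_eq_zero F (by rwa [hm])) hg

end Slots

/-! ### Merging slots -/

section Merging

open MvPolynomial

variable {k : Type*} [Field k] {σ : Type*} {ι ι' : Type*} [Fintype ι] [Fintype ι']

open Classical in
/-- The exponents on `ι` with push-forward `κ` along `ρ`. -/
noncomputable def fiberExp (ρ : ι → ι') (κ : ι' →₀ ℕ) : Finset (ι →₀ ℕ) :=
  (Finset.univ.finsuppAntidiag (∑ i, κ i)).filter fun l => l.mapDomain ρ = κ

theorem mem_fiberExp {ρ : ι → ι'} {κ : ι' →₀ ℕ} {l : ι →₀ ℕ} :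
    l ∈ fiberExp ρ κ ↔ l.mapDomain ρ = κ := by
  classical
  rw [fiberExp, Finset.mem_filter, and_iff_right_iff_imp]
  rintro rfl
  rw [Finset.mem_finsuppAntidiag]
  refine ⟨?_, Finset.subset_univ _⟩
  have := Finsupp.sum_mapDomain_index (s := l) (f := ρ) (h := fun _ n => n) (by simp) (by simp)
  rwa [Finsupp.sum_fintype _ _ (by simp), Finsupp.sum_fintype _ _ (by simp), eq_comm] at this

theorem coeff_rename_eq_sum (ρ : ι → ι') (κ : ι' →₀ ℕ) (F : MvPolynomial ι k) :
    coeff κ (rename ρ F) = ∑ l ∈ fiberExp ρ κ, coeff l F := by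
  classical
  induction F using MvPolynomial.induction_on' with
  | monomial u a =>
    simp only [rename_monomial, coeff_monomial]
    rw [Finset.sum_ite_eq]
    simp only [mem_fiberExp]
  | add p q hp hq => simp only [map_add, coeff_add, hp, hq, Finset.sum_add_distrib]

theorem mapDomain_apply_eq_sum {ι' : Type*} [DecidableEq ι'] (ρ : ι → ι') (l : ι →₀ ℕ) (i : ι') :
    l.mapDomain ρ i = ∑ q with ρ q = i, l q := by
  rw [Finsupp.mapDomain, Finsupp.sum_fintype _ _ (by simp), Finsupp.finsetSum_apply,
    Finset.sum_filter]
  exact Finset.sum_congr rfl fun q _ => Finsupp.single_apply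

theorem prod_coeff_prod_eq_sum {R : Type*} [CommRing R] [DecidableEq ι'] (ρ : ι → ι')
    (κ : ι' →₀ ℕ)
    (f : ι → PowerSeries R) :
    ∏ i, PowerSeries.coeff (κ i) (∏ q with ρ q = i, f q) =
      ∑ l ∈ fiberExp ρ κ, ∏ q, PowerSeries.coeff (l q) (f q) := by
  classical
  simp only [PowerSeries.coeff_prod]
  rw [Finset.prod_univ_sum]
  refine Finset.sum_bij' (fun p _ => Finsupp.equivFunOnFinite.symm fun q => p (ρ q) q)
    (fun l _ i => l.filter fun q => ρ q = i) ?_ ?_ ?_ ?_ ?_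
  · intro p hp
    rw [Fintype.mem_piFinset] at hp
    rw [mem_fiberExp]
    ext i
    rw [mapDomain_apply_eq_sum]
    have := (Finset.mem_finsuppAntidiag.1 (hp i)).1
    rw [← this]
    refine Finset.sum_congr rfl fun q hq => ?_
    simp only [Finset.mem_filter, Finset.mem_univ, true_and] at hq
    simp [hq]
  · intro l hl
    rw [mem_fiberExp] at hl
    rw [Fintype.mem_piFinset]
    intro i
    rw [Finset.mem_finsuppAntidiag, ← hl, mapDomain_apply_eq_sum]
    refine ⟨Finset.sum_congr rfl fun q hq => ?_, fun q hq => ?_⟩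
    · simp only [Finset.mem_filter, Finset.mem_univ, true_and] at hq
      simp [hq]
    · rw [Finsupp.support_filter] at hq
      simp only [Finset.mem_filter, Finset.mem_univ, true_and] at hq ⊢
      exact hq.2
  · intro p hp
    rw [Fintype.mem_piFinset] at hp
    ext i q
    rw [Finsupp.filter_apply]
    split_ifs with h
    · simp [h]
    · have := (Finset.mem_finsuppAntidiag.1 (hp i)).2
      by_contra h'
      have := this (Finsupp.mem_support_iff.2 fun e => h' e.symm)
      simp [h] at this
  · intro l hl
    ext q
    simp
  · intro p hp
    rw [← Finset.prod_fiberwise Finset.univ ρ]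
    refine Finset.prod_congr rfl fun i _ => Finset.prod_congr rfl fun q hq => ?_
    simp only [Finset.mem_filter, Finset.mem_univ, true_and] at hq
    simp [hq]

/-- If the polynomial `F` describes a functional on products of series with independent arguments,
then identifying variables of `F` describes the functional on products of series in which the
corresponding arguments are identified. -/
theorem apply_prod_coeff_eq_coeff_rename {R : Type*} [CommRing R] [Algebra k R] [DecidableEq ι']
    (ξ : R →ₗ[k] k) (f : ι → PowerSeries R) (F : MvPolynomial ι k)
    (hF : ∀ l : ι →₀ ℕ, ξ (∏ q, PowerSeries.coeff (l q) (f q)) = coeff l F) (ρ : ι → ι')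
    (κ : ι' →₀ ℕ) :
    ξ (∏ i, PowerSeries.coeff (κ i) (∏ q with ρ q = i, f q)) = coeff κ (rename ρ F) := by
  rw [prod_coeff_prod_eq_sum, map_sum, coeff_rename_eq_sum]
  exact Finset.sum_congr rfl fun l _ => hF l

end Merging

/-! ### Functionals annihilating the quadratic monomial relations -/

section Quadratic

open MvPolynomial

variable {k : Type*} [Field k] {σ : Type*} {ι : Type*} [Fintype ι]

/-- The ideal generated by the coefficients of `X_x(s) ∂^l X_y(s)` with `x ≠ y` and
`l < γ(x, y)`. -/
noncomputable def diagIdeal (k : Type*) [Field k] (γ : σ → σ → ℕ) :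
    Ideal (MvPolynomial (σ × ℕ) k) :=
  Ideal.span {c | ∃ x y : σ, x ≠ y ∧ ∃ l < γ x y, ∃ d : ℕ, c = quadCoeff k x y l d}

theorem coeff_current (i : σ) (j : ℕ) : PowerSeries.coeff j (current k i) = X (i, j) :=
  PowerSeries.coeff_mk _ _

theorem quadCoeff_eq_sum (x y : σ) (l d : ℕ) :
    quadCoeff k x y l d = ∑ p ∈ Finset.HasAntidiagonal.antidiagonal d,
      X (x, p.1) * ((((p.2 + 1).ascFactorial l : ℕ) : MvPolynomial (σ × ℕ) k) * X (y, p.2 + l)) := by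
  rw [quadCoeff, PowerSeries.coeff_mul]
  refine Finset.sum_congr rfl fun p _ => ?_
  rw [PowerSeries.coeff_iterate_derivative, coeff_current, coeff_current]

theorem isWeightedHomogeneous_X_mul_X {M : Type*} [AddCommMonoid M] (w : σ × ℕ → M)
    (u v : σ × ℕ) (a : ℕ) :
    IsWeightedHomogeneous w (X u * ((a : MvPolynomial (σ × ℕ) k) * X v)) (w u + w v) := by
  refine (isWeightedHomogeneous_X k w u).mul ?_
  rw [← map_natCast (C : k →+* MvPolynomial (σ × ℕ) k)]
  exact (isWeightedHomogeneous_X k w v).C_mul _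

theorem quadCoeff_multiHomogeneous (x y : σ) (l d : ℕ) :
    IsWeightedHomogeneous multiWeight (quadCoeff k x y l d)
      (Finsupp.single x 1 + Finsupp.single y 1) := by
  rw [quadCoeff_eq_sum]
  exact IsWeightedHomogeneous.sum _ _ _ fun p _ => isWeightedHomogeneous_X_mul_X _ _ _ _

theorem quadCoeff_gradHomogeneous (x y : σ) (l d : ℕ) :
    IsWeightedHomogeneous gradWeight (quadCoeff k x y l d) (d + l) := by
  rw [quadCoeff_eq_sum]
  refine IsWeightedHomogeneous.sum _ _ _ fun p hp => ?_
  have h := isWeightedHomogeneous_X_mul_X (k := k) gradWeight (x, p.1) (y, p.2 + l)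
    ((p.2 + 1).ascFactorial l)
  rwa [show gradWeight (x, p.1) + gradWeight (y, p.2 + l) = d + l by
    rw [← Finset.HasAntidiagonal.mem_antidiagonal.1 hp]; simp [gradWeight, add_assoc]] at h

/-- `F` is the generating polynomial of the values of `ξ` on the monomials
`∏ X_{c(i)}^{(κ(i))}`. -/
def IsSymbol (ξ : MvPolynomial (σ × ℕ) k →ₗ[k] k) (c : ι → σ) (F : MvPolynomial ι k) : Prop :=
  ∀ κ, ξ (slotMon k c κ) = coeff κ F

theorem IsSymbol.isColorSymm {ξ : MvPolynomial (σ × ℕ) k →ₗ[k] k} {c : ι → σ}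
    {F : MvPolynomial ι k} (h : IsSymbol ξ c F) : IsColorSymm c F := by
  intro π hπ
  ext κ
  obtain ⟨κ, rfl⟩ : ∃ κ', Finsupp.mapDomain π κ' = κ :=
    ⟨Finsupp.mapDomain π.symm κ, by
      rw [← Finsupp.mapDomain_comp, Equiv.self_comp_symm, Finsupp.mapDomain_id]⟩
  rw [coeff_rename_mapDomain _ π.injective, ← h, ← h]
  congr 1
  rw [slotMon, slotMon, ← Equiv.prod_comp π fun i => X (c i, Finsupp.mapDomain π κ i)]
  refine Finset.prod_congr rfl fun i _ => ?_
  rw [Finsupp.mapDomain_apply π.injective, show c (π i) = c i from congrFun hπ i]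

theorem coeff_iterate_pderiv {ι : Type*} (j : ι) (l : ℕ) (F : MvPolynomial ι k) (κ : ι →₀ ℕ) :
    coeff κ ((pderiv j)^[l] F) =
      ((κ j + 1).ascFactorial l : ℕ) * coeff (κ + Finsupp.single j l) F := by
  induction l generalizing κ with
  | zero => simp
  | succ l ih =>
    rw [Function.iterate_succ_apply', coeff_pderiv, ih, add_assoc, ← Finsupp.single_add,
      Finsupp.add_apply, Finsupp.single_eq_same, Nat.ascFactorial_succ, ← Nat.succ_ascFactorial,
      add_comm 1 l]
    push_cast
    grind

variable [DecidableEq ι]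

theorem IsSymbol.iterate_pderiv {ξ : MvPolynomial (σ × ℕ) k →ₗ[k] k} {c : ι → σ}
    {F : MvPolynomial ι k} (h : IsSymbol ξ c F) (j : ι) (l : ℕ) (κ : ι →₀ ℕ) :
    ξ (∏ q, PowerSeries.coeff (κ q) (Function.update (fun q => current k (c q)) j
      ((⇑(PowerSeries.derivative (MvPolynomial (σ × ℕ) k)))^[l] (current k (c j))) q)) =
    coeff κ ((pderiv j)^[l] F) := by
  rw [coeff_iterate_pderiv, ← h, ← smul_eq_mul, ← map_smul]
  congr 1
  rw [slotMon, ← Finset.mul_prod_erase _ _ (Finset.mem_univ j),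
    ← Finset.mul_prod_erase _ _ (Finset.mem_univ j), Function.update_self,
    PowerSeries.coeff_iterate_derivative, coeff_current, Finsupp.add_apply, Finsupp.single_eq_same,
    smul_eq_C_mul, map_natCast, mul_assoc]
  congr 2
  refine Finset.prod_congr rfl fun q hq => ?_
  have hq := Finset.ne_of_mem_erase hq
  rw [Function.update_of_ne hq, coeff_current, Finsupp.add_apply,
    Finsupp.single_eq_of_ne hq, add_zero]

/-- The values of a functional on the multiples of the coefficients of `X_x(s) ∂^l X_y(s)` are the
coefficients of the restriction of the `l`-th partial derivative of its symbol to a diagonal. -/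
theorem IsSymbol.apply_quadCoeff {ξ : MvPolynomial (σ × ℕ) k →ₗ[k] k} {c : ι → σ}
    {F : MvPolynomial ι k} (h : IsSymbol ξ c F) {i j : ι} (hij : i ≠ j) (l : ℕ) {κ : ι →₀ ℕ}
    (hκ : κ j = 0) :
    ξ ((∏ p ∈ (Finset.univ.erase j).erase i, X (c p, κ p)) * quadCoeff k (c i) (c j) l (κ i)) =
      coeff κ (rename (Function.update id j i) ((pderiv j)^[l] F)) := by
  rw [← apply_prod_coeff_eq_coeff_rename ξ _ _ (h.iterate_pderiv j l) (Function.update id j i) κ]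
  congr 1
  have hi : i ∈ Finset.univ.erase j := Finset.mem_erase.2 ⟨hij, Finset.mem_univ _⟩
  rw [← Finset.mul_prod_erase _ _ (Finset.mem_univ j), ← Finset.mul_prod_erase _ _ hi]
  have e₁ : (Finset.univ.filter fun q => Function.update id j i q = j) = ∅ := by
    ext q
    simp only [Function.update_apply, id, Finset.mem_filter, Finset.mem_univ, true_and,
      Finset.notMem_empty, iff_false]
    split_ifs with hq
    · exact hij
    · exact hq
  have e₂ : (Finset.univ.filter fun q => Function.update id j i q = i) = {i, j} := by
    ext q
    simp only [Function.update_apply, id, Finset.mem_filter, Finset.mem_univ, true_and,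
      Finset.mem_insert, Finset.mem_singleton]
    split_ifs with hq <;> simp [hq]
  rw [e₁, e₂, Finset.prod_empty, hκ, PowerSeries.coeff_zero_one, one_mul,
    Finset.prod_pair hij, Function.update_self, Function.update_of_ne hij, mul_comm]
  congr 1
  refine Finset.prod_congr rfl fun p hp => ?_
  have hpi := Finset.ne_of_mem_erase hp
  have hpj := Finset.ne_of_mem_erase (Finset.mem_of_mem_erase hp)
  have e₃ : (Finset.univ.filter fun q => Function.update id j i q = p) = {p} := by
    ext q
    simp only [Function.update_apply, id, Finset.mem_filter, Finset.mem_univ, true_and,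
      Finset.mem_singleton]
    split_ifs with hq
    · subst hq; simp [hpi.symm, hpj.symm]
    · rfl
  rw [e₃, Finset.prod_singleton, Function.update_of_ne hpj, coeff_current]

/-- The symbol of a functional annihilating the quadratic relations vanishes on the diagonals to
the prescribed orders. -/
theorem IsSymbol.pow_dvd [CharZero k] {γ : σ → σ → ℕ} {ξ : MvPolynomial (σ × ℕ) k →ₗ[k] k}
    {c : ι → σ} {F : MvPolynomial ι k} (h : IsSymbol ξ c F) (hξ : ∀ g ∈ diagIdeal k γ, ξ g = 0)
    {i j : ι} (hij : c i ≠ c j) : (X i - X j) ^ γ (c i) (c j) ∣ F := by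
  have hne : i ≠ j := fun e => hij (congrArg c e)
  refine pow_dvd_of_dvd_iterate_pderiv hne fun l hl => ?_
  rw [X_sub_X_dvd_iff]
  ext κ
  rw [coeff_zero]
  by_cases hκ : κ j = 0
  · rw [← h.apply_quadCoeff hne l hκ]
    exact hξ _ (Ideal.mul_mem_left _ _ (Ideal.subset_span ⟨_, _, hij, l, hl, _, rfl⟩))
  · refine coeff_rename_eq_zero _ _ _ fun u hu => absurd ?_ hκ
    rw [← hu, mapDomain_apply_eq_sum]
    refine Finset.sum_eq_zero fun q hq => ?_
    simp only [Function.update_apply, id, Finset.mem_filter, Finset.mem_univ, true_and] at hq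
    split_ifs at hq with hq'
    · exact absurd hq hne
    · exact absurd hq hq'

end Quadratic

section Annihilation

open MvPolynomial

/-- Conversely, a symmetric polynomial vanishing on the diagonals to the prescribed orders defines a
functional annihilating the quadratic relations. -/
theorem symFunctional_eq_zero_of_mem_diagIdeal {k : Type*} [Field k] {σ : Type*} {ι : Type*}
    [Fintype ι] {γ : σ → σ → ℕ} {c : ι → σ}
    {F : MvPolynomial ι k} (hF : IsColorSymm c F)
    (hdvd : ∀ i j, c i ≠ c j → (X i - X j) ^ γ (c i) (c j) ∣ F)
    {g : MvPolynomial (σ × ℕ) k} (hg : g ∈ diagIdeal k γ) : symFunctional c F g = 0 := by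
  classical
  have hsymb : IsSymbol (symFunctional c F) c F := symFunctional_slotMon hF
  suffices h : ∀ p, symFunctional c F (p * g) = 0 by simpa using h 1
  refine Submodule.span_induction ?_ (by simp)
    (fun a b _ _ ha hb p => by rw [mul_add, map_add, ha, hb, add_zero])
    (fun q a _ ha p => by rw [smul_eq_mul, ← mul_assoc, ha]) hg
  rintro _ ⟨x, y, hxy, l, hl, d, rfl⟩ p
  induction p using MvPolynomial.induction_on' with
  | add p q hp hq => rw [add_mul, map_add, hp, hq, add_zero]
  | monomial m a =>
    rw [show monomial m a = a • monomial m (1 : k) by rw [smul_monomial, smul_eq_mul, mul_one],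
      smul_mul_assoc, map_smul]
    suffices h : symFunctional c F (monomial m 1 * quadCoeff k x y l d) = 0 by rw [h, smul_zero]
    by_cases hm : Finsupp.weight multiWeight m + (Finsupp.single x 1 + Finsupp.single y 1) =
        colorDeg c
    · obtain ⟨κ, hκ⟩ := exists_slotExp (m + (Finsupp.single (x, d) 1 + Finsupp.single (y, 0) 1)) c
        (by rw [← hm]; simp [map_add, Finsupp.weight_single, multiWeight])
      have key : ∀ v : σ × ℕ, 1 ≤ slotExp c κ v → ∃ i, c i = v.1 ∧ κ i = v.2 := fun v hv => by
        rw [slotExp, colorDeg_apply] at hv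
        obtain ⟨i, hi⟩ := Finset.card_pos.1 hv
        rw [Finset.mem_filter] at hi
        exact ⟨i, congrArg Prod.fst hi.2, congrArg Prod.snd hi.2⟩
      obtain ⟨i, hi, hid⟩ := key (x, d) (by rw [← hκ]; simp; omega)
      obtain ⟨j, hj, hj0⟩ := key (y, 0) (by rw [← hκ]; simp; omega)
      have hij : i ≠ j := by rintro rfl; exact hxy (hi.symm.trans hj)
      dsimp only at hi hid hj hj0
      have hmon : monomial m (1 : k) = ∏ p ∈ (Finset.univ.erase j).erase i, X (c p, κ p) := by
        have e := slotMon_eq_monomial (k := k) c κ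
        have hi' : i ∈ Finset.univ.erase j := Finset.mem_erase.2 ⟨hij, Finset.mem_univ _⟩
        rw [← hκ, slotMon, ← Finset.mul_prod_erase _ _ (Finset.mem_univ j),
          ← Finset.mul_prod_erase _ _ hi', hi, hid, hj, hj0] at e
        have e' : monomial (m + (Finsupp.single (x, d) 1 + Finsupp.single (y, 0) 1)) (1 : k) =
            X (y, 0) * (X (x, d) * monomial m 1) := by
          simp only [X, monomial_mul, one_mul]
          congr 1
          rw [add_comm m, add_comm (Finsupp.single (x, d) 1), add_assoc]
        rw [e'] at e
        exact (mul_left_cancel₀ (X_ne_zero _) (mul_left_cancel₀ (X_ne_zero _) e)).symm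
      rw [hmon, ← hi, ← hj, ← hid, hsymb.apply_quadCoeff hij l hj0,
        (X_sub_X_dvd_iff i j _).1, coeff_zero]
      exact dvd_iterate_pderiv_of_pow_dvd hij hl (by
        have := hdvd i j (by rwa [hi, hj])
        rwa [hi, hj] at this)
    · exact symFunctional_eq_zero F hm
        ((isWeightedHomogeneous_monomial _ _ _ rfl).mul (quadCoeff_multiHomogeneous x y l d))

end Annihilation

/-! ### Vandermonde products for colored variables -/

section Vandermonde

open MvPolynomial

variable {k : Type*} [Field k] {ι : Type*} {B : Type*}

open Classical in
/-- The difference of two variables of the same color, or a sign that is antisymmetric in the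
variables if their colors differ. -/
noncomputable def vandFactor (k : Type*) [Field k] (b : ι → B) (i j : ι) : MvPolynomial ι k :=
  if b i = b j then X i - X j else if WellOrderingRel (b i) (b j) then 1 else -1

theorem vandFactor_of_eq {b : ι → B} {i j : ι} (h : b i = b j) :
    vandFactor k b i j = X i - X j := if_pos h

theorem vandFactor_antisymm (b : ι → B) (i j : ι) :
    vandFactor k b i j = -vandFactor k b j i := by
  unfold vandFactor
  by_cases h : b i = b j
  · rw [if_pos h, if_pos h.symm, neg_sub]
  · rw [if_neg h, if_neg (Ne.symm h)]
    rcases trichotomous_of WellOrderingRel (b i) (b j) with h' | h' | h'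
    · rw [if_pos h', if_neg (asymm_of WellOrderingRel h'), neg_neg]
    · exact absurd h' h
    · rw [if_neg (asymm_of WellOrderingRel h'), if_pos h']

theorem vandFactor_eq_C {b : ι → B} {i j : ι} (h : b i ≠ b j) :
    ∃ u : k, u ≠ 0 ∧ vandFactor k b i j = C u := by
  unfold vandFactor
  rw [if_neg h]
  split_ifs
  · exact ⟨1, one_ne_zero, by simp⟩
  · exact ⟨-1, neg_ne_zero.2 one_ne_zero, by simp⟩

theorem vandFactor_ne_zero (b : ι → B) {i j : ι} (h : i ≠ j) : vandFactor k b i j ≠ 0 := by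
  by_cases hb : b i = b j
  · rw [vandFactor_of_eq hb]
    exact X_sub_X_ne_zero h
  · obtain ⟨u, hu, e⟩ := vandFactor_eq_C (k := k) hb
    rw [e]
    exact (map_ne_zero_iff _ (C_injective _ _)).2 hu

variable [Fintype ι] [LinearOrder ι]

theorem prod_lt_comp_perm {R : Type*} [CommRing R] (π : Equiv.Perm ι) {f : ι → ι → R}
    (hf : ∀ i j, f i j = -f j i) :
    ∏ j, ∏ i, (if i < j then f (π i) (π j) else 1) =
      (π.sign : ℤ) * ∏ j, ∏ i, (if i < j then f i j else 1) := by
  let o := Fintype.orderIsoFinOfCardEq ι rfl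
  have h := Equiv.Perm.prod_Iio_comp_eq_sign_mul_prod (o.toEquiv.permCongr.symm π)
    (f := fun i j => f (o i) (o j)) (fun i j => hf _ _)
  have e : ∀ g : ι → ι → R, ∏ j, ∏ i, (if i < j then g i j else 1) =
      ∏ j, ∏ i ∈ Finset.Iio j, g (o i) (o j) := fun g => by
    rw [← Equiv.prod_comp o.toEquiv]
    refine Finset.prod_congr rfl fun j _ => ?_
    rw [← Equiv.prod_comp o.toEquiv, ← Finset.prod_filter]
    refine Finset.prod_congr ?_ fun _ _ => rfl
    ext i
    simp
  have hs : (o.toEquiv.permCongr.symm π).sign = π.sign := by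
    rw [← Equiv.Perm.sign_permCongr o.toEquiv, Equiv.apply_symm_apply]
  rw [e fun i j => f (π i) (π j), e, ← hs, ← h]
  refine Finset.prod_congr rfl fun j _ => Finset.prod_congr rfl fun i _ => ?_
  simp

/-- Up to sign, the product of all differences of two variables of the same color; permutations
preserving the colors multiply it by their sign. -/
noncomputable def vand (k : Type*) [Field k] (b : ι → B) : MvPolynomial ι k :=
  ∏ j, ∏ i, if i < j then vandFactor k b i j else 1

theorem vand_ne_zero (b : ι → B) : vand k b ≠ 0 :=
  Finset.prod_ne_zero_iff.2 fun j _ => Finset.prod_ne_zero_iff.2 fun i _ => by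
    split_ifs with h
    · exact vandFactor_ne_zero b h.ne
    · exact one_ne_zero

theorem rename_vand {b : ι → B} {π : Equiv.Perm ι} (hπ : b ∘ π = b) :
    rename π (vand k b) = ((π.sign : ℤ) : MvPolynomial ι k) * vand k b := by
  rw [vand, ← prod_lt_comp_perm π (vandFactor_antisymm b)]
  simp only [map_prod]
  refine Finset.prod_congr rfl fun j _ => Finset.prod_congr rfl fun i _ => ?_
  have hb : ∀ i, b (π i) = b i := congrFun hπ
  rw [apply_ite (rename π), map_one]
  congr 1
  unfold vandFactor
  rw [hb, hb]
  split_ifs <;> simp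

/-- Two families that agree factor by factor up to nonzero constants have products that agree up to
a nonzero constant. -/
theorem exists_prod_eq_C_mul {σ α : Type*} (s : Finset α) (f g : α → MvPolynomial σ k)
    (h : ∀ a ∈ s, ∃ u : k, u ≠ 0 ∧ f a = C u * g a) :
    ∃ u : k, u ≠ 0 ∧ ∏ a ∈ s, f a = C u * ∏ a ∈ s, g a := by
  classical
  induction s using Finset.induction_on with
  | empty => exact ⟨1, one_ne_zero, by simp⟩
  | insert a s ha ih =>
    obtain ⟨u, hu, e⟩ := ih fun b hb => h b (Finset.mem_insert_of_mem hb)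
    obtain ⟨v, hv, e'⟩ := h a (Finset.mem_insert_self a s)
    refine ⟨v * u, mul_ne_zero hv hu, ?_⟩
    rw [Finset.prod_insert ha, Finset.prod_insert ha, e, e', C_mul]
    ring

/-- An antisymmetric polynomial, possibly involving further variables, is divisible by the
Vandermonde product. -/
theorem vand_dvd_of_antisymm [CharZero k] {U : Type*} [Fintype U] (b : ι → B)
    (F : MvPolynomial (ι ⊕ U) k)
    (hF : ∀ π : Equiv.Perm ι, b ∘ π = b →
      rename (Sum.map π id) F = ((π.sign : ℤ) : MvPolynomial (ι ⊕ U) k) * F) :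
    rename Sum.inl (vand k b) ∣ F := by
  classical
  let R : ι ⊕ U → ι ⊕ U → Prop := fun u v => ∃ i j, u = Sum.inl j ∧ v = Sum.inl i ∧
    i < j ∧ b i = b j
  have h := prod_X_sub_X_pow_dvd R (by
    rintro _ _ ⟨i, j, rfl, rfl, hij, -⟩ ⟨i', j', e₁, e₂, hij', -⟩
    cases e₁; cases e₂
    exact lt_asymm hij hij') (fun _ _ => 1) F (by
    rintro _ _ ⟨i, j, rfl, rfl, hij, hb⟩
    rw [pow_one, X_sub_X_dvd_iff]
    have hs := hF (Equiv.swap i j) (by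
      funext p
      rw [Function.comp_apply, Equiv.swap_apply_def]
      split_ifs with h₁ h₂
      · rw [h₁, hb]
      · rw [h₂, hb]
      · rfl)
    rw [Equiv.Perm.sign_swap hij.ne] at hs
    have hr := congrArg (rename (R := k) (Function.update id (Sum.inl i : ι ⊕ U) (Sum.inl j))) hs
    rw [rename_rename, map_mul] at hr
    have hc : Function.update id (Sum.inl i : ι ⊕ U) (Sum.inl j) ∘
        Sum.map (Equiv.swap i j) (id : U → U) = Function.update id (Sum.inl i) (Sum.inl j) := by
      funext p
      rcases p with p | p
      · simp only [Function.comp_apply, Sum.map_inl, Equiv.swap_apply_def]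
        split_ifs with h₁ h₂
        · subst h₁; simp [Function.update_apply]
        · subst h₂; simp [Function.update_apply]
        · rfl
      · rfl
    rw [hc] at hr
    have h2 : (2 : MvPolynomial (ι ⊕ U) k) ≠ 0 := two_ne_zero
    have : (2 : MvPolynomial (ι ⊕ U) k) *
        rename (Function.update id (Sum.inl i : ι ⊕ U) (Sum.inl j)) F = 0 := by
      simp only [Units.val_neg, Units.val_one, Int.cast_neg, Int.cast_one, map_neg, map_one,
        neg_mul, one_mul] at hr
      rw [two_mul]
      nth_rewrite 1 [hr]
      exact neg_add_cancel _
    exact (mul_eq_zero.1 this).resolve_left h2)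
  refine dvd_trans ?_ h
  rw [vand, map_prod, Fintype.prod_sum_type]
  refine dvd_mul_of_dvd_left (Finset.prod_dvd_prod_of_dvd _ _ fun j _ => ?_) _
  rw [map_prod, Fintype.prod_sum_type]
  refine dvd_mul_of_dvd_left (Finset.prod_dvd_prod_of_dvd _ _ fun i _ => ?_) _
  by_cases hij : i < j
  · rw [if_pos hij]
    by_cases hb : b i = b j
    · rw [if_pos ⟨i, j, rfl, rfl, hij, hb⟩, vandFactor_of_eq hb, pow_one, map_sub, rename_X,
        rename_X, ← neg_sub, neg_dvd]
    · obtain ⟨u, hu, e⟩ := vandFactor_eq_C (k := k) hb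
      rw [e, rename_C]
      exact ((IsUnit.mk0 u hu).map C).dvd
  · rw [if_neg hij, map_one]
    exact one_dvd _

end Vandermonde

/-! ### Polynomials with prescribed specializations -/

section Specialization

open MvPolynomial

variable {k : Type*} [Field k] {ι : Type*} [Fintype ι] {Q B : Type*} [LinearOrder Q]

/-- A column structure on a totally ordered set of points: every point has a base and a height, and
`floor x b` is the smallest height of a point over `b` that is at least `x`. -/
structure IsColumnOrder (base : Q → B) (ht : Q → ℕ) (floor : Q → B → ℕ) : Prop where
  floor_le : ∀ x p, x ≤ p → floor x (base p) ≤ ht p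
  floor_base : ∀ x, floor x (base x) = ht x
  inj : ∀ x y, base x = base y → ht x = ht y → x = y
  floor_lt : ∀ x p, x < p → base x = base p → floor x (base p) < ht p

variable (base : Q → B) (ht : Q → ℕ) (floor : Q → B → ℕ)

/-- The exponent of `y - t_p` in the polynomial by which one divides at the slot `i`. -/
noncomputable def divExp (c : ι → Q) (i p : ι) : ℕ :=
  if c p < c i then ht (c p) else floor (c i) (base (c p))

/-- The value at `y = t_i` of the quotient of `∏ (y - u_q)` by `∏ (y - t_p)^{divExp i p}`. -/
noncomputable def quotFactor (k : Type*) [Field k] (c : ι → Q) (U : Type*) [Fintype U] (i : ι) :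
    MvPolynomial (ι ⊕ U) k :=
  Polynomial.eval (X (Sum.inl i))
    ((∏ u : U, (Polynomial.X - Polynomial.C (X (Sum.inr u) : MvPolynomial (ι ⊕ U) k))) /ₘ
      ∏ p, (Polynomial.X - Polynomial.C (X (Sum.inl p))) ^ divExp base ht floor c i p)

variable {U : Type*} [Fintype U]

theorem monic_prod_X_sub_C_pow {R : Type*} [CommRing R] (a : ι → R) (m : ι → ℕ) :
    (∏ p, (Polynomial.X - Polynomial.C (a p)) ^ m p).Monic :=
  Polynomial.monic_prod_of_monic _ _ fun _ _ => (Polynomial.monic_X_sub_C _).pow _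

theorem rename_quotFactor {τ : Type*} (c : ι → Q) (i : ι) (g : ι ⊕ U → τ) :
    rename g (quotFactor base ht floor k c U i) = Polynomial.eval (X (g (Sum.inl i)))
      ((∏ u : U, (Polynomial.X - Polynomial.C (X (g (Sum.inr u)) : MvPolynomial τ k))) /ₘ
        ∏ p, (Polynomial.X - Polynomial.C (X (g (Sum.inl p)))) ^ divExp base ht floor c i p) := by
  rw [quotFactor, ← RingHom.coe_coe (rename (R := k) g), ← Polynomial.eval₂_hom,
    ← Polynomial.eval_map, Polynomial.map_divByMonic _ (monic_prod_X_sub_C_pow _ _)]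
  simp only [Polynomial.map_prod, Polynomial.map_pow, Polynomial.map_sub, Polynomial.map_X,
    Polynomial.map_C, RingHom.coe_coe, rename_X]

variable {base ht floor}

/-- If the height of every slot of `c'` is at least the exponent in the divisor, the quotient is
exact. -/
theorem eval_quotFactor [DecidableEq ι] (c c' : ι → Q) (i : ι) (ρ : U → ι)
    (hρ : ∀ p, (Finset.univ.filter fun u => ρ u = p).card = ht (c' p))
    (h : ∀ p, divExp base ht floor c i p ≤ ht (c' p)) :
    rename (Sum.elim id ρ) (quotFactor base ht floor k c U i) =
      ∏ p, (X i - X p : MvPolynomial ι k) ^ (ht (c' p) - divExp base ht floor c i p) := by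
  have e : ∏ u : U, (Polynomial.X - Polynomial.C (X (ρ u) : MvPolynomial ι k)) =
      (∏ p, (Polynomial.X - Polynomial.C (X p)) ^ divExp base ht floor c i p) *
        ∏ p, (Polynomial.X - Polynomial.C (X p)) ^ (ht (c' p) - divExp base ht floor c i p) := by
    rw [← Finset.prod_mul_distrib, ← Finset.prod_fiberwise Finset.univ ρ]
    refine Finset.prod_congr rfl fun p _ => ?_
    rw [← pow_add, Nat.add_sub_cancel' (h p), ← hρ p, ← Finset.prod_const]
    refine Finset.prod_congr rfl fun u hu => ?_
    rw [(Finset.mem_filter.1 hu).2]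
  rw [rename_quotFactor]
  simp only [Sum.elim_inl, Sum.elim_inr, id]
  rw [e, Polynomial.mul_divByMonic_cancel_left _ (monic_prod_X_sub_C_pow _ _),
    Polynomial.eval_prod]
  simp

/-- The condition under which a coloring `c'` has a smaller multidegree than `c`: at the first point
where the multidegrees differ, `c'` has the smaller entry. -/
def ColorLT (c' c : ι → Q) : Prop :=
  ∃ y, colorDeg c' y < colorDeg c y ∧ ∀ z < y, colorDeg c' z = colorDeg c z

/-- The product of the quotients vanishes at every coloring `c' ≠ c` of multidegree at most that of
`c`: at the smallest slot `i` where `c'` and `c` differ the division is exact, and `t_i` is a root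
of the quotient. -/
theorem eval_prod_quotFactor_eq_zero (hQ : IsColumnOrder base ht floor) [DecidableEq ι]
    (c c' : ι → Q) (hb : base ∘ c' = base ∘ c) (hlt : ¬ColorLT c c') (hne : c' ≠ c) (ρ : U → ι)
    (hρ : ∀ p, (Finset.univ.filter fun u => ρ u = p).card = ht (c' p)) :
    ∏ i, rename (Sum.elim id ρ) (quotFactor base ht floor k c U i) = 0 := by
  classical
  have hb' : ∀ p, base (c' p) = base (c p) := congrFun hb
  obtain ⟨i₀, hi₀⟩ := Function.ne_iff.1 hne
  obtain ⟨i, hi, hmin⟩ := Finset.exists_min_image (Finset.univ.filter fun i => c' i ≠ c i) c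
    ⟨i₀, Finset.mem_filter.2 ⟨Finset.mem_univ _, hi₀⟩⟩
  replace hi := (Finset.mem_filter.1 hi).2
  have hbelow : ∀ p, c p < c i → c' p = c p := fun p hp => by
    by_contra h
    exact absurd (hmin p (Finset.mem_filter.2 ⟨Finset.mem_univ _, h⟩)) (not_le.2 hp)
  -- a value of `c'` below `c i` at a slot above would make the multidegree of `c'` larger
  have habove : ∀ p, c i ≤ c p → c i ≤ c' p := by
    by_contra! hcon
    obtain ⟨p₀, hp₀⟩ := hcon
    obtain ⟨p, hp, hpmin⟩ := Finset.exists_min_image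
      (Finset.univ.filter fun p => c i ≤ c p ∧ c' p < c i) c'
      ⟨p₀, Finset.mem_filter.2 ⟨Finset.mem_univ _, hp₀⟩⟩
    replace hp := (Finset.mem_filter.1 hp).2
    have hq : ∀ q, c' q < c' p → c' q = c q := fun q hq => by
      rcases lt_or_ge (c q) (c i) with h | h
      · exact hbelow q h
      · exact absurd (hpmin q (Finset.mem_filter.2 ⟨Finset.mem_univ _, h, hq.trans hp.2⟩))
          (not_le.2 hq)
    refine hlt ⟨c' p, ?_, fun z hz => ?_⟩
    · rw [colorDeg_apply, colorDeg_apply]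
      refine Finset.card_lt_card (Finset.ssubset_iff_of_subset ?_ |>.2 ⟨p, ?_, ?_⟩)
      · intro q hq
        simp only [Finset.mem_filter, Finset.mem_univ, true_and] at hq ⊢
        rw [hbelow q (hq ▸ hp.2), hq]
      · simp
      · simp only [Finset.mem_filter, Finset.mem_univ, true_and]
        exact (hp.2.trans_le hp.1).ne'
    · rw [colorDeg_apply, colorDeg_apply]
      congr 1
      ext q
      simp only [Finset.mem_filter, Finset.mem_univ, true_and]
      constructor
      · intro h
        rw [hbelow q (h ▸ hz.trans hp.2), h]
      · intro h
        rw [← hq q (h ▸ hz), h]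
  have hexp : ∀ p, divExp base ht floor c i p ≤ ht (c' p) := fun p => by
    rw [divExp]
    split_ifs with h
    · rw [hbelow p h]
    · rw [← hb' p]
      exact hQ.floor_le _ _ (habove p (not_lt.1 h))
  refine Finset.prod_eq_zero (Finset.mem_univ i) ?_
  rw [eval_quotFactor c c' i ρ hρ hexp]
  refine Finset.prod_eq_zero (Finset.mem_univ i) ?_
  rw [sub_self, zero_pow]
  have h₁ := hexp i
  have h₂ : divExp base ht floor c i i = ht (c i) := by
    rw [divExp, if_neg (lt_irrefl _), hQ.floor_base]
  rw [h₂] at h₁ ⊢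
  have h₃ : ht (c' i) ≠ ht (c i) := fun h => hi (hQ.inj _ _ (hb' i) h)
  omega

/-- At the coloring `c` itself the quotients multiply to the differences over the ordered pairs. -/
theorem eval_prod_quotFactor_self (hQ : IsColumnOrder base ht floor) [DecidableEq ι]
    (c : ι → Q) (ρ : U → ι)
    (hρ : ∀ p, (Finset.univ.filter fun u => ρ u = p).card = ht (c p)) :
    ∏ i, rename (Sum.elim id ρ) (quotFactor base ht floor k c U i) =
      diffProd k c (· < ·) fun x p => ht p - floor x (base p) := by
  rw [diffProd]
  refine Finset.prod_congr rfl fun i _ => ?_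
  rw [eval_quotFactor c c i ρ hρ]
  · refine Finset.prod_congr rfl fun p _ => ?_
    rw [divExp]
    rcases lt_trichotomy (c i) (c p) with h | h | h
    · rw [if_neg h.not_gt, if_pos h]
    · rw [if_neg (h ▸ lt_irrefl _), if_neg (h ▸ lt_irrefl _), h, hQ.floor_base, Nat.sub_self,
        pow_zero]
    · rw [if_pos h, if_neg h.not_gt, Nat.sub_self, pow_zero]
  · intro p
    rw [divExp]
    split_ifs with h
    · exact le_rfl
    · exact hQ.floor_le _ _ (not_lt.1 h)

open Classical in
/-- The exponent of `t_i - t_p`, for `c i < c p`, in the specializations at `c`. It is the height of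
`c p` above the floor of `c i`, less the one factor absorbed by the Vandermonde product of the bases
if `c i` and `c p` have the same base. -/
noncomputable def columnExp (base : Q → B) (ht : Q → ℕ) (floor : Q → B → ℕ) (x p : Q) : ℕ :=
  ht p - floor x (base p) - if base x = base p then 1 else 0

/-- Up to a nonzero constant, passing from the colors to their bases in the Vandermonde product
absorbs one factor for every pair of slots of different colors over the same base. -/
theorem vand_mul_prod_eq [LinearOrder ι] (hQ : IsColumnOrder base ht floor)
    (c : ι → Q) (hc : Monotone c) :
    ∃ u : k, u ≠ 0 ∧ vand k c * diffProd k c (· < ·) (fun x p => ht p - floor x (base p)) =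
      C u * (vand k (base ∘ c) * diffProd k c (· < ·) (columnExp base ht floor)) := by
  have e : ∀ γ : Q → Q → ℕ, diffProd k c (· < ·) γ =
      ∏ p, ∏ i, if c i < c p then (X i - X p : MvPolynomial ι k) ^ γ (c i) (c p) else 1 := by
    intro γ
    rw [diffProd, Finset.prod_comm]
    exact Finset.prod_congr rfl fun p _ => Finset.prod_congr rfl fun i _ => by congr
  rw [e, e, vand, vand]
  simp only [← Finset.prod_mul_distrib]
  refine exists_prod_eq_C_mul _ _ _ fun p _ => exists_prod_eq_C_mul _ _ _ fun i _ => ?_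
  by_cases hip : i < p
  · rw [if_pos hip, if_pos hip]
    rcases (hc hip.le).lt_or_eq with hlt | heq
    · rw [if_pos hlt, if_pos hlt]
      obtain ⟨v, hv, e₁⟩ := vandFactor_eq_C (k := k) (b := c) hlt.ne
      rw [e₁, columnExp]
      by_cases hb : base (c i) = base (c p)
      · refine ⟨v, hv, ?_⟩
        have := hQ.floor_lt _ _ hlt hb
        rw [if_pos hb, vandFactor_of_eq (b := base ∘ c) hb, ← pow_succ',
          Nat.sub_add_cancel (by omega)]
      · obtain ⟨w, hw, e₂⟩ := vandFactor_eq_C (k := k) (b := base ∘ c) hb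
        refine ⟨v * w⁻¹, mul_ne_zero hv (inv_ne_zero hw), ?_⟩
        rw [if_neg hb, e₂, Nat.sub_zero, ← mul_assoc, ← C_mul, mul_assoc, inv_mul_cancel₀ hw,
          mul_one]
    · refine ⟨1, one_ne_zero, ?_⟩
      rw [if_neg heq.not_lt, if_neg heq.not_lt, vandFactor_of_eq heq,
        vandFactor_of_eq (b := base ∘ c) (congrArg base heq), C_1, one_mul]
  · have : ¬c i < c p := not_lt.2 (hc (not_lt.1 hip))
    refine ⟨1, one_ne_zero, ?_⟩
    rw [if_neg hip, if_neg hip, if_neg this, if_neg this, C_1, one_mul, one_mul]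

open Classical in
/-- The antisymmetrization, over the permutations of the slots preserving the bases, of the product
of `f`, the Vandermonde product of the colors and the quotients. -/
noncomputable def antisymProduct [LinearOrder ι] (base : Q → B) (ht : Q → ℕ) (floor : Q → B → ℕ)
    (U : Type*) [Fintype U] (c : ι → Q) (f : MvPolynomial ι k) : MvPolynomial (ι ⊕ U) k :=
  ∑ π : Equiv.Perm ι, if (base ∘ c) ∘ π = base ∘ c then
    ((π.sign : ℤ) : MvPolynomial (ι ⊕ U) k) * rename (Sum.map π id)
      (rename Sum.inl (f * vand k c) * ∏ i, quotFactor base ht floor k c U i) else 0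

theorem rename_map_rename_inl {α β γ : Type*} (g : α → β) (h : γ → γ) (F : MvPolynomial α k) :
    rename (Sum.map g h) (rename Sum.inl F) = rename Sum.inl (rename g F) := by
  rw [rename_rename, rename_rename]
  rfl

theorem rename_antisymProduct [LinearOrder ι] (c : ι → Q) (f : MvPolynomial ι k)
    {τ : Equiv.Perm ι} (hτ : (base ∘ c) ∘ τ = base ∘ c) :
    rename (Sum.map τ id) (antisymProduct base ht floor U c f) =
      ((τ.sign : ℤ) : MvPolynomial (ι ⊕ U) k) * antisymProduct base ht floor U c f := by
  rw [antisymProduct, map_sum, Finset.mul_sum, ← Equiv.sum_comp (Equiv.mulLeft τ) fun π => _ * _]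
  refine Finset.sum_congr rfl fun π _ => ?_
  have h : (base ∘ c) ∘ ⇑(Equiv.mulLeft τ π) = base ∘ c ↔ (base ∘ c) ∘ ⇑π = base ∘ c := by
    rw [Equiv.coe_mulLeft, Equiv.Perm.coe_mul, ← Function.comp_assoc, hτ]
  by_cases hπ : (base ∘ c) ∘ ⇑π = base ∘ c
  · rw [if_pos hπ, if_pos (h.2 hπ), map_mul, map_intCast, rename_rename, Equiv.coe_mulLeft,
      Equiv.Perm.sign_mul, ← mul_assoc, Sum.map_comp_map, Equiv.Perm.coe_mul, Function.comp_id,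
      Units.val_mul, Int.cast_mul, ← mul_assoc, ← Int.cast_mul, Int.units_coe_mul_self, Int.cast_one,
      one_mul]
  · rw [if_neg hπ, if_neg (mt h.1 hπ), map_zero, mul_zero]

theorem rename_antisymProduct_right [LinearOrder ι] (c : ι → Q) (f : MvPolynomial ι k)
    (τ : Equiv.Perm U) :
    rename (Sum.map id τ) (antisymProduct base ht floor U c f) =
      antisymProduct base ht floor U c f := by
  rw [antisymProduct, map_sum]
  refine Finset.sum_congr rfl fun π _ => ?_
  rw [apply_ite (rename (Sum.map id τ)), map_zero]
  congr 1
  rw [map_mul, map_intCast, rename_rename, Sum.map_comp_map, Function.id_comp, Function.comp_id]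
  congr 1
  have : Sum.map (⇑π) (⇑τ) = Sum.map π id ∘ Sum.map id τ := by
    rw [Sum.map_comp_map, Function.id_comp, Function.comp_id]
  rw [this, ← rename_rename, map_mul, rename_map_rename_inl, rename_id_apply, map_prod]
  congr 2
  refine Finset.prod_congr rfl fun i _ => ?_
  rw [rename_quotFactor, quotFactor]
  simp only [Sum.map_inl, Sum.map_inr, id]
  rw [Equiv.prod_comp τ fun u => Polynomial.X -
    Polynomial.C (X (Sum.inr u) : MvPolynomial (ι ⊕ U) k)]

theorem eval_antisymProduct_term [LinearOrder ι] (c : ι → Q) (f : MvPolynomial ι k)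
    (π : Equiv.Perm ι) (ρ : U → ι) :
    rename (Sum.elim id ρ) (rename (Sum.map π id)
      (rename Sum.inl (f * vand k c) * ∏ i, quotFactor base ht floor k c U i)) =
    rename π ((f * vand k c) *
      ∏ i, rename (Sum.elim id (π.symm ∘ ρ)) (quotFactor base ht floor k c U i)) := by
  have h : Sum.elim id ρ ∘ Sum.map (⇑π) id = π ∘ Sum.elim id (π.symm ∘ ρ) := by
    funext p
    rcases p with p | p <;> simp
  rw [rename_rename, h, ← rename_rename, map_mul (rename (Sum.elim id _)), rename_rename,
    Sum.elim_comp_inl, rename_id_apply, map_prod]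

/-- There is a polynomial in the variables `t_i` and in further variables `u_q`, symmetric in the
`t_i` over the same base and in the `u_q`, which has a prescribed multiple of
`∏ (t_i - t_p)^{columnExp}` as its specialization `u = (t_i repeated ht (c i) times)`, and whose
specialization vanishes for all colorings `c'` of smaller multidegree. -/
theorem exists_specialization [CharZero k] [LinearOrder ι] (hQ : IsColumnOrder base ht floor)
    (c : ι → Q) (hc : Monotone c) (f : MvPolynomial ι k) (hf : IsColorSymm c f) :
    ∃ K : MvPolynomial (ι ⊕ U) k,
      (∀ π : Equiv.Perm ι, (base ∘ c) ∘ π = base ∘ c → rename (Sum.map π id) K = K) ∧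
      (∀ τ : Equiv.Perm U, rename (Sum.map id τ) K = K) ∧
      (∀ (c' : ι → Q) (ρ : U → ι), base ∘ c' = base ∘ c → ColorLT c' c →
        (∀ p, (Finset.univ.filter fun u => ρ u = p).card = ht (c' p)) →
        rename (Sum.elim id ρ) K = 0) ∧
      ∀ ρ : U → ι, (∀ p, (Finset.univ.filter fun u => ρ u = p).card = ht (c p)) →
        rename (Sum.elim id ρ) K = diffProd k c (· < ·) (columnExp base ht floor) * f := by
  classical
  -- dividing by the Vandermonde product of the bases makes the antisymmetrization symmetric
  obtain ⟨K, hK⟩ := vand_dvd_of_antisymm (base ∘ c) (antisymProduct base ht floor U c f)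
    fun π hπ => rename_antisymProduct c f hπ
  have hV : rename (Sum.inl : ι → ι ⊕ U) (vand k (base ∘ c)) ≠ 0 :=
    (map_ne_zero_iff _ (rename_injective _ Sum.inl_injective)).2 (vand_ne_zero _)
  have hVev : ∀ ρ : U → ι, rename (Sum.elim id ρ)
      (rename (Sum.inl : ι → ι ⊕ U) (vand k (base ∘ c))) = vand k (base ∘ c) := fun ρ => by
    rw [rename_rename, Sum.elim_comp_inl, rename_id_apply]
  have hK₁ : ∀ π : Equiv.Perm ι, (base ∘ c) ∘ π = base ∘ c → rename (Sum.map π id) K = K := by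
    intro π hπ
    have h := rename_antisymProduct (base := base) (ht := ht) (floor := floor) (U := U) c f hπ
    have e : rename (Sum.map π (id : U → U)) (rename (Sum.inl : ι → ι ⊕ U) (vand k (base ∘ c))) =
        ((π.sign : ℤ) : MvPolynomial (ι ⊕ U) k) * rename Sum.inl (vand k (base ∘ c)) := by
      rw [rename_map_rename_inl, rename_vand hπ, map_mul, map_intCast]
    rw [hK, map_mul, e, mul_assoc] at h
    have hs : ((π.sign : ℤ) : MvPolynomial (ι ⊕ U) k) ≠ 0 :=
      Int.cast_ne_zero.2 (Units.ne_zero _)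
    exact mul_left_cancel₀ hV (mul_left_cancel₀ hs h)
  have hK₂ : ∀ τ : Equiv.Perm U, rename (Sum.map id τ) K = K := by
    intro τ
    have h := rename_antisymProduct_right (base := base) (ht := ht) (floor := floor) c f τ
    rw [hK, map_mul, rename_map_rename_inl, rename_id_apply] at h
    exact mul_left_cancel₀ hV h
  have hfib : ∀ (c' : ι → Q) (ρ : U → ι) (π : Equiv.Perm ι),
      (∀ p, (Finset.univ.filter fun u => ρ u = p).card = ht (c' p)) →
      ∀ p, (Finset.univ.filter fun u => (π.symm ∘ ρ) u = p).card = ht ((c' ∘ π) p) := by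
    intro c' ρ π hρ p
    rw [Function.comp_apply, ← hρ]
    congr 1
    ext u
    simp [Equiv.symm_apply_eq]
  have hdeg : ∀ (c' : ι → Q) (π : Equiv.Perm ι), colorDeg (c' ∘ π) = colorDeg c' :=
    fun c' π => colorDeg_comp_equiv c' π
  have hterm : ∀ (c' : ι → Q) (ρ : U → ι) (π : Equiv.Perm ι), base ∘ c' = base ∘ c →
      (base ∘ c) ∘ π = base ∘ c → ¬ColorLT c c' → c' ∘ π ≠ c →
      (∀ p, (Finset.univ.filter fun u => ρ u = p).card = ht (c' p)) →
      ∏ i, rename (Sum.elim id (π.symm ∘ ρ)) (quotFactor base ht floor k c U i) = 0 := by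
    intro c' ρ π hb hπ hlt hne hρ
    refine eval_prod_quotFactor_eq_zero hQ c (c' ∘ π) ?_ ?_ hne _ (hfib c' ρ π hρ)
    · rw [← Function.comp_assoc, hb, hπ]
    · rwa [ColorLT, hdeg]
  obtain ⟨u, hu, huV⟩ := vand_mul_prod_eq (k := k) hQ c hc
  let n : ℕ := (Finset.univ.filter fun π : Equiv.Perm ι => c ∘ π = c).card
  have hn : n ≠ 0 := Finset.card_ne_zero.2 ⟨1, by simp⟩
  have ha : (n * u : k) ≠ 0 := mul_ne_zero (Nat.cast_ne_zero.2 hn) hu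
  refine ⟨C (n * u : k)⁻¹ * K, fun π hπ => ?_, fun τ => ?_, fun c' ρ hb hlt hρ => ?_,
    fun ρ hρ => ?_⟩
  · rw [map_mul, rename_C, hK₁ π hπ]
  · rw [map_mul, rename_C, hK₂ τ]
  · suffices h : rename (Sum.elim id ρ) K = 0 by rw [map_mul, h, mul_zero]
    refine (mul_eq_zero.1 (?_ : vand k (base ∘ c) * _ = 0)).resolve_left (vand_ne_zero _)
    rw [← hVev ρ, ← map_mul, ← hK, antisymProduct, map_sum]
    refine Finset.sum_eq_zero fun π _ => ?_
    split_ifs with hπ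
    · obtain ⟨y, hy, hz⟩ := hlt
      rw [map_mul, eval_antisymProduct_term, hterm c' ρ π hb hπ ?_ ?_ hρ, mul_zero, map_zero,
        mul_zero]
      · rintro ⟨y', hy', hz'⟩
        rcases lt_trichotomy y y' with h | h | h
        · exact hy.ne' (hz' y h)
        · subst h; exact lt_asymm hy hy'
        · exact hy'.ne' (hz y' h)
      · intro h
        rw [← h, hdeg] at hy
        exact lt_irrefl _ hy
    · exact map_zero _
  · -- only the permutations preserving the coloring `c` contribute, all of them equally
    have key : vand k (base ∘ c) * rename (Sum.elim id ρ) K = n • ((f * vand k c) *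
        diffProd k c (· < ·) fun x p => ht p - floor x (base p)) := by
      rw [← hVev ρ, ← map_mul, ← hK, antisymProduct, map_sum, ← Finset.sum_const,
        Finset.sum_filter]
      refine Finset.sum_congr rfl fun π _ => ?_
      by_cases hcπ : c ∘ π = c
      · have hπ : (base ∘ c) ∘ ⇑π = base ∘ c := by rw [Function.comp_assoc, hcπ]
        rw [if_pos hcπ, if_pos hπ, map_mul, map_intCast, eval_antisymProduct_term,
          eval_prod_quotFactor_self hQ c _ (by have := hfib c ρ π hρ; rwa [hcπ] at this),
          map_mul, map_mul, hf π hcπ, rename_vand hcπ, diffProd_symm c _ _ π hcπ]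
        have hs : ((π.sign : ℤ) : MvPolynomial ι k) * ((π.sign : ℤ) : MvPolynomial ι k) = 1 := by
          rw [← Int.cast_mul, Int.units_coe_mul_self, Int.cast_one]
        linear_combination (f * vand k c *
          diffProd k c (· < ·) fun x p => ht p - floor x (base p)) * hs
      · rw [if_neg hcπ]
        split_ifs with hπ
        · rw [map_mul, eval_antisymProduct_term, hterm c ρ π rfl hπ ?_ hcπ hρ, mul_zero, map_zero,
            mul_zero]
          rintro ⟨y, hy, -⟩
          exact lt_irrefl _ hy
        · exact map_zero _
    refine mul_left_cancel₀ (vand_ne_zero (k := k) (base ∘ c)) ?_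
    rw [map_mul, rename_C, mul_left_comm, key, mul_assoc, huV, nsmul_eq_mul,
      ← map_natCast (C : k →+* MvPolynomial ι k)]
    have e : C (n * u : k)⁻¹ * (C (n : k) * C u) = (1 : MvPolynomial ι k) := by
      rw [← C_mul, ← C_mul, inv_mul_cancel₀ ha, C_1]
    linear_combination (f * (vand k (base ∘ c) *
      diffProd k c (· < ·) (columnExp base ht floor))) * e

end Specialization

/-! ### The arc ring and its points -/

section Arcs

open MvPolynomial

variable (k : Type*) [Field k] {R : Type*} [CommRing R] [Algebra k R]

/-- The universal arc: the series `∑ r^{(j)} s^j` with coefficients in the reduced arc ring. -/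
noncomputable def arc (r : R) : PowerSeries (ReducedArcRing k R) :=
  PowerSeries.mk fun j => redArcCoeff k r j

variable (R) in
/-- The projection to the reduced arc ring from the polynomial ring in the variables
`r^{(j)}`. -/
noncomputable def arcMk : MvPolynomial (R × ℕ) k →ₐ[k] ReducedArcRing k R :=
  (Ideal.Quotient.mkₐ k (nilradical (ArcRing k R))).comp (Ideal.Quotient.mkₐ k _)

theorem map_arcMk_current (r : R) :
    PowerSeries.map (arcMk k R : MvPolynomial (R × ℕ) k →+* ReducedArcRing k R) (current k r) =
      arc k r := by
  ext j
  rw [PowerSeries.coeff_map, coeff_current, arc, PowerSeries.coeff_mk]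
  rfl

theorem aeval_arc (f : MvPolynomial R k) :
    aeval (arc k) f = arc k (aeval (R := k) (fun r : R => r) f) := by
  have h : f - X (aeval (R := k) (fun r : R => r) f) ∈
      RingHom.ker (aeval (R := k) (fun r : R => r)) := by
    rw [RingHom.mem_ker, map_sub, aeval_X, sub_self]
  have e : ∀ g : MvPolynomial R k, aeval (arc k) g =
      PowerSeries.map (arcMk k R : MvPolynomial (R × ℕ) k →+* ReducedArcRing k R)
        (aeval (fun i => current k i) g) := by
    intro g
    have : (aeval (arc k) : MvPolynomial R k →ₐ[k] _) =
        (PowerSeries.mapAlgHom (arcMk k R)).comp (aeval fun i => current k i) := by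
      refine MvPolynomial.algHom_ext fun r => ?_
      rw [aeval_X, AlgHom.comp_apply, aeval_X]
      exact (map_arcMk_current k r).symm
    rw [this]
    rfl
  rw [← sub_eq_zero, ← aeval_X (R := k) (arc k) (aeval (R := k) (fun r : R => r) f), ← map_sub, e]
  ext d
  rw [PowerSeries.coeff_map, map_zero]
  have hmem : PowerSeries.coeff d (aeval (fun i => current k i)
      (f - X (aeval (R := k) (fun r : R => r) f))) ∈ arcIdeal
        (RingHom.ker (aeval (R := k) (fun r : R => r))) :=
    Ideal.subset_span ⟨_, h, d, rfl⟩
  change Ideal.Quotient.mk (nilradical (ArcRing k R)) (Ideal.Quotient.mk _ _) = 0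
  rw [Ideal.Quotient.eq_zero_iff_mem.2 hmem, map_zero]

theorem arc_mul (r r' : R) : arc k (r * r') = arc k r * arc k r' := by
  have h := aeval_arc k (X r * X r' : MvPolynomial R k)
  rwa [map_mul, map_mul, aeval_X, aeval_X, aeval_X, aeval_X, eq_comm] at h

theorem arc_one : arc k (1 : R) = 1 := by
  have h := aeval_arc k (1 : MvPolynomial R k)
  rwa [map_one, map_one, eq_comm] at h

instance : IsReduced (ReducedArcRing k R) :=
  (Ideal.isRadical_iff_quotient_reduced _).1 (Ideal.radical_isRadical 0)

variable {k}

/-- An arc over a reduced algebra is a specialization of the universal arc. -/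
theorem exists_algHom_of_arc {B : Type*} [CommRing B] [Algebra k B] [IsReduced B]
    (φ : R →ₐ[k] PowerSeries B) :
    ∃ ψ : ReducedArcRing k R →ₐ[k] B, ∀ r j, ψ (redArcCoeff k r j) = PowerSeries.coeff j (φ r) := by
  let F : MvPolynomial (R × ℕ) k →ₐ[k] B := aeval fun v => PowerSeries.coeff v.2 (φ v.1)
  have hF : ∀ a ∈ arcIdeal (RingHom.ker (aeval (R := k) (fun r : R => r))), F a = 0 := by
    intro a ha
    refine (Ideal.span_le (I := RingHom.ker F)).2 ?_ ha
    rintro _ ⟨f, hf, d, rfl⟩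
    rw [SetLike.mem_coe, RingHom.mem_ker]
    have e : (PowerSeries.mapAlgHom F).comp (aeval fun i => current k i) =
        φ.comp (aeval (R := k) fun r : R => r) := by
      refine MvPolynomial.algHom_ext fun r => ?_
      rw [AlgHom.comp_apply, AlgHom.comp_apply, aeval_X, aeval_X]
      ext j
      rw [PowerSeries.mapAlgHom_apply, PowerSeries.coeff_map, coeff_current]
      exact aeval_X _ _
    have h := congrArg (PowerSeries.coeff d) (DFunLike.congr_fun e f)
    rw [AlgHom.comp_apply, AlgHom.comp_apply, RingHom.mem_ker.1 hf, map_zero, map_zero,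
      PowerSeries.mapAlgHom_apply, PowerSeries.coeff_map] at h
    exact h
  let G : ArcRing k R →ₐ[k] B := Ideal.Quotient.liftₐ _ F hF
  have hG : ∀ a ∈ nilradical (ArcRing k R), G a = 0 := fun a ha =>
    ((mem_nilradical.1 ha).map G).eq_zero
  refine ⟨(Ideal.Quotient.liftₐ _ G hG : ArcRing k R ⧸ nilradical (ArcRing k R) →ₐ[k] B),
    fun r j => ?_⟩
  exact aeval_X (R := k) (fun v : R × ℕ => PowerSeries.coeff v.2 (φ v.1)) (r, j)

end Arcs

/-! ### An identity for cubes of series -/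

section Cube

variable {k L : Type*} [CommRing k] [CommRing L] [Algebra k L] (D : Derivation k L L)

theorem exists_iterate_leibniz (a : L) (m : ℕ) :
    ∃ c : ℕ → L, ∀ b, D^[m] (a * b) = a * D^[m] b + ∑ j ∈ Finset.range m, c j * D^[j] b := by
  induction m with
  | zero => exact ⟨0, fun b => by simp⟩
  | succ m ih =>
    obtain ⟨c, hc⟩ := ih
    refine ⟨fun j => (if j = m then D a else 0) + (if j < m then D (c j) else 0) +
      if j = 0 then 0 else c (j - 1), fun b => ?_⟩
    rw [Function.iterate_succ_apply', hc, map_add, map_sum, D.leibniz]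
    simp only [D.leibniz, smul_eq_mul, ← Function.iterate_succ_apply' (⇑D), add_mul,
      Finset.sum_add_distrib]
    have e₁ : ∑ j ∈ Finset.range (m + 1), (if j = m then D a else 0) * D^[j] b =
        D a * D^[m] b := by
      rw [Finset.sum_range_succ, if_pos rfl, Finset.sum_eq_zero, zero_add]
      intro j hj
      rw [if_neg (Finset.mem_range.1 hj).ne, zero_mul]
    have e₂ : ∑ j ∈ Finset.range (m + 1), (if j < m then D (c j) else 0) * D^[j] b =
        ∑ j ∈ Finset.range m, D (c j) * D^[j] b := by
      rw [Finset.sum_range_succ, if_neg (lt_irrefl m), zero_mul, add_zero]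
      exact Finset.sum_congr rfl fun j hj => by rw [if_pos (Finset.mem_range.1 hj)]
    have e₃ : ∑ j ∈ Finset.range (m + 1), (if j = 0 then 0 else c (j - 1)) * D^[j] b =
        ∑ j ∈ Finset.range m, c j * D^[j + 1] b := by
      rw [Finset.sum_range_succ', if_pos rfl, zero_mul, add_zero]
      exact Finset.sum_congr rfl fun j _ => by rw [if_neg (Nat.succ_ne_zero j), Nat.add_sub_cancel]
    rw [e₁, e₂, e₃]
    have e₄ : ∑ j ∈ Finset.range m, D^[j] b * D (c j) = ∑ j ∈ Finset.range m, D (c j) * D^[j] b :=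
      Finset.sum_congr rfl fun j _ => mul_comm _ _
    rw [e₄]
    ring

/-- The alternating sum over a cube obtained from the differential operator `D^m` by taking
commutators with the quotients `p_l / q_l = p'_l / q'_l`. -/
noncomputable def cubeSum (p q p' q' : ℕ → L) (S : Finset ℕ) (m : ℕ) (h : L) : L :=
  ∑ I ∈ S.powerset, (-1) ^ I.card * ((∏ l ∈ I, p l) * ∏ l ∈ S \ I, q l) *
    D^[m] (((∏ l ∈ S \ I, p' l) * ∏ l ∈ I, q' l) * h)

/-- A commutator of a differential operator of order `m` with more than `m` functions vanishes. -/
theorem cubeSum_eq_zero (p q p' q' : ℕ → L) (S : Finset ℕ)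
    (hpq : ∀ l ∈ S, p l * q' l = q l * p' l) {m : ℕ} (hm : m < S.card) (h : L) :
    cubeSum D p q p' q' S m h = 0 := by
  induction S using Finset.induction_on generalizing m with
  | empty => simp at hm
  | insert a S ha ih =>
    replace ih := fun j (hj : j < S.card) =>
      ih (fun l hl => hpq l (Finset.mem_insert_of_mem hl)) hj
    rw [Finset.card_insert_of_notMem ha] at hm
    obtain ⟨c, hc⟩ := exists_iterate_leibniz D (p' a) m
    obtain ⟨d, hd⟩ := exists_iterate_leibniz D (q' a) m
    have key : cubeSum D p q p' q' (insert a S) m h =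
        (q a * p' a - p a * q' a) * cubeSum D p q p' q' S m h +
          ∑ j ∈ Finset.range m, (q a * c j - p a * d j) * cubeSum D p q p' q' S j h := by
      simp only [cubeSum]
      rw [Finset.sum_powerset_insert ha, ← Finset.sum_add_distrib, Finset.mul_sum]
      simp only [Finset.mul_sum]
      rw [Finset.sum_comm, ← Finset.sum_add_distrib]
      refine Finset.sum_congr rfl fun I hI => ?_
      rw [Finset.mem_powerset] at hI
      have haI : a ∉ I := fun h' => ha (hI h')
      have e₁ : insert a S \ I = insert a (S \ I) := Finset.insert_sdiff_of_notMem _ haI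
      have e₂ : insert a S \ insert a I = S \ I := by
        rw [Finset.insert_sdiff_insert, Finset.sdiff_insert_of_notMem ha]
      have ha' : a ∉ S \ I := fun h' => ha (Finset.mem_sdiff.1 h').1
      rw [e₁, e₂, Finset.prod_insert ha', Finset.prod_insert ha', Finset.prod_insert haI,
        Finset.prod_insert haI, Finset.card_insert_of_notMem haI]
      set P := ∏ l ∈ I, p l
      set Q := ∏ l ∈ S \ I, q l
      set P' := ∏ l ∈ S \ I, p' l
      set Q' := ∏ l ∈ I, q' l
      rw [show p' a * P' * Q' * h = p' a * (P' * Q' * h) by ring,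
        show P' * (q' a * Q') * h = q' a * (P' * Q' * h) by ring, hc, hd]
      have e₃ : ∑ j ∈ Finset.range m, (q a * c j - p a * d j) * ((-1) ^ I.card * (P * Q) *
          D^[j] (P' * Q' * h)) = (-1) ^ I.card * (P * Q) *
          (q a * (∑ j ∈ Finset.range m, c j * D^[j] (P' * Q' * h)) -
            p a * ∑ j ∈ Finset.range m, d j * D^[j] (P' * Q' * h)) := by
        simp only [Finset.mul_sum, ← Finset.sum_sub_distrib]
        exact Finset.sum_congr rfl fun j _ => by ring
      rw [e₃, pow_succ]
      ring
    rw [key, ← hpq a (Finset.mem_insert_self a S), sub_self, zero_mul, zero_add]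
    exact Finset.sum_eq_zero fun j hj => by
      rw [ih j (by have := Finset.mem_range.1 hj; omega), mul_zero]

variable [IsDomain L]

theorem sum_iterate_eq_zero_of_mul {α : Type*} (s : Finset α) (f b : α → L) {c : L} (hc : c ≠ 0)
    {N : ℕ} (h : ∀ m < N, ∑ i ∈ s, f i * D^[m] (c * b i) = 0) {m : ℕ} (hm : m < N) :
    ∑ i ∈ s, f i * D^[m] (b i) = 0 := by
  induction m using Nat.strong_induction_on with
  | _ m ih =>
    obtain ⟨d, hd⟩ := exists_iterate_leibniz D c m
    have e := h m hm
    simp only [hd, mul_add, Finset.sum_add_distrib, Finset.mul_sum] at e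
    rw [Finset.sum_comm (s := s)] at e
    have e₁ : ∑ j ∈ Finset.range m, ∑ i ∈ s, f i * (d j * D^[j] (b i)) = 0 :=
      Finset.sum_eq_zero fun j hj => by
        have hj := Finset.mem_range.1 hj
        have := ih j hj (hj.trans hm)
        rw [← mul_zero (d j), ← this, Finset.mul_sum]
        exact Finset.sum_congr rfl fun i _ => by ring
    rw [e₁, add_zero] at e
    have e₂ : c * ∑ i ∈ s, f i * D^[m] (b i) = 0 := by
      rw [← e, Finset.mul_sum]
      exact Finset.sum_congr rfl fun i _ => by ring
    exact (mul_eq_zero.1 e₂).resolve_left hc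

/-- The cube relations hold for every family of elements of a differential domain, indexed by the
vertices of a cube, in which the product of two vertices depends only on their sum. If one product
of opposite vertices vanishes, all do; otherwise the family is, up to a common factor, a family of
products of quotients. -/
theorem cube_relation {N : ℕ} (a : Finset ℕ → L)
    (ha : ∀ J ⊆ Finset.range (N + 1), ∀ J' ⊆ Finset.range (N + 1),
      a J * a J' = a (J ∪ J') * a (J ∩ J')) {m : ℕ} (hm : m < N) :
    ∑ I ∈ (Finset.Icc 1 N).powerset, (-1) ^ I.card * (a (insert 0 I) *
      D^[m] (a (Finset.range (N + 1) \ insert 0 I))) = 0 := by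
  have hIcc : ∀ {I}, I ⊆ Finset.Icc 1 N → I ⊆ Finset.range (N + 1) := fun h i hi => by
    have := Finset.mem_Icc.1 (h hi)
    exact Finset.mem_range.2 (by omega)
  have hins : ∀ {I}, I ⊆ Finset.range (N + 1) → insert 0 I ⊆ Finset.range (N + 1) := fun h =>
    Finset.insert_subset (Finset.mem_range.2 (Nat.succ_pos N)) h
  have hopp : ∀ J ⊆ Finset.range (N + 1),
      a J * a (Finset.range (N + 1) \ J) = a (Finset.range (N + 1)) * a ∅ := fun J hJ => by
    rw [ha J hJ _ Finset.sdiff_subset, Finset.union_sdiff_of_subset hJ, Finset.inter_sdiff_self]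
  have hcompl : ∀ I ⊆ Finset.Icc 1 N, Finset.range (N + 1) \ insert 0 I = Finset.Icc 1 N \ I := by
    intro I hI
    ext l
    simp only [Finset.mem_sdiff, Finset.mem_range, Finset.mem_insert, Finset.mem_Icc]
    have : (l < N + 1 ∧ ¬l = 0) ↔ (1 ≤ l ∧ l ≤ N) := by omega
    tauto
  by_cases h0 : a (Finset.range (N + 1)) * a ∅ = 0
  · refine Finset.sum_eq_zero fun I hI => ?_
    have := hopp (insert 0 I) (hins (hIcc (Finset.mem_powerset.1 hI)))
    rw [h0, mul_eq_zero] at this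
    rcases this with h | h
    · rw [h, zero_mul, mul_zero]
    · rw [h, iterate_map_zero, mul_zero, mul_zero]
  · have hne : a ∅ ≠ 0 := right_ne_zero_of_mul h0
    have hne0 : a {0} ≠ 0 := by
      rw [← hopp {0} (by simp)] at h0
      exact left_ne_zero_of_mul h0
    have hprod : ∀ (K : Finset ℕ), K ⊆ {0} → ∀ I ⊆ Finset.Icc 1 N,
        a (K ∪ I) * a K ^ I.card = a K * ∏ l ∈ I, a (K ∪ {l}) := by
      intro K hK I
      have hKr : K ⊆ Finset.range (N + 1) := hK.trans (by simp)
      induction I using Finset.induction_on with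
      | empty => simp
      | insert l I hl ih =>
        intro hI
        have hI' : I ⊆ Finset.Icc 1 N := (Finset.subset_insert l I).trans hI
        have hl1 := Finset.mem_Icc.1 (hI (Finset.mem_insert_self l I))
        have hx := ha (K ∪ I) (Finset.union_subset hKr (hIcc hI')) (K ∪ {l})
          (Finset.union_subset hKr
            (Finset.singleton_subset_iff.2 (Finset.mem_range.2 (by omega))))
        have e₁ : K ∪ I ∪ (K ∪ {l}) = K ∪ insert l I := by
          ext x; simp only [Finset.mem_union, Finset.mem_insert, Finset.mem_singleton]; tauto
        have e₂ : (K ∪ I) ∩ (K ∪ {l}) = K := by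
          ext x
          simp only [Finset.mem_union, Finset.mem_inter, Finset.mem_singleton]
          constructor
          · rintro ⟨h₁, h₂⟩
            rcases h₂ with h₂ | rfl
            · exact h₂
            · exact h₁.resolve_right hl
          · tauto
        rw [e₁, e₂] at hx
        rw [Finset.card_insert_of_notMem hl, Finset.prod_insert hl]
        have := ih hI'
        linear_combination a (K ∪ {l}) * this - a K ^ I.card * hx
    have hcube : ∀ j < N, ∑ I ∈ (Finset.Icc 1 N).powerset, (-1) ^ I.card * a (insert 0 I) *
        D^[j] (a ∅ ^ N * a (Finset.range (N + 1) \ insert 0 I)) = 0 := by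
      intro j hj
      refine (mul_eq_zero.1 (?_ : a {0} ^ N * _ = 0)).resolve_left (pow_ne_zero N hne0)
      have hz := cubeSum_eq_zero D (fun l => a ({0} ∪ {l})) (fun _ => a {0}) (fun l => a {l})
        (fun _ => a ∅) (Finset.Icc 1 N) (fun l hl => by
          have hl := Finset.mem_Icc.1 hl
          have hx := ha {0} (by simp) {l} (Finset.singleton_subset_iff.2
            (Finset.mem_range.2 (by omega)))
          have e : ({0} : Finset ℕ) ∩ {l} = ∅ := by
            ext x
            simp only [Finset.mem_inter, Finset.mem_singleton, Finset.notMem_empty, iff_false]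
            omega
          rw [e] at hx
          exact hx.symm) (m := j) (by simpa using hj) (a ∅)
      rw [← mul_zero (a {0}), ← hz, cubeSum, Finset.mul_sum, Finset.mul_sum]
      refine Finset.sum_congr rfl fun I hI => ?_
      rw [Finset.mem_powerset] at hI
      have hcard : (Finset.Icc 1 N \ I).card + I.card = N := by
        rw [Finset.card_sdiff_add_card_eq_card hI, Nat.card_Icc, Nat.add_sub_cancel]
      have h₁ := hprod {0} subset_rfl I hI
      have h₂ := hprod ∅ (Finset.empty_subset _) (Finset.Icc 1 N \ I) Finset.sdiff_subset
      simp only [Finset.empty_union] at h₂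
      rw [hcompl I hI, Finset.prod_const, Finset.prod_const, Finset.insert_eq]
      have e₁ : a ∅ ^ N * a (Finset.Icc 1 N \ I) =
          ((∏ l ∈ Finset.Icc 1 N \ I, a {l}) * a ∅ ^ I.card) * a ∅ := by
        nth_rewrite 1 [← hcard]
        rw [pow_add]
        linear_combination a ∅ ^ I.card * h₂
      rw [e₁]
      nth_rewrite 1 [← hcard]
      rw [pow_add]
      linear_combination ((-1) ^ I.card * a {0} ^ (Finset.Icc 1 N \ I).card *
        D^[j] (((∏ l ∈ Finset.Icc 1 N \ I, a {l}) * a ∅ ^ I.card) * a ∅)) * h₁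
    rw [← sum_iterate_eq_zero_of_mul D (Finset.Icc 1 N).powerset
      (fun I => (-1) ^ I.card * a (insert 0 I)) (fun I => a (Finset.range (N + 1) \ insert 0 I))
      (pow_ne_zero N hne) hcube hm]
    exact Finset.sum_congr rfl fun I _ => (mul_assoc _ _ _).symm

end Cube

/-! ### The cube relations -/

section CubeRelations

open MvPolynomial

variable {k : Type*} [Field k] {n : ℕ} {P : Set (Fin n → ℝ)}

theorem map_iterate_derivative {A B : Type*} [CommRing A] [CommRing B] (g : A →+* B) (m : ℕ)
    (f : PowerSeries A) :
    PowerSeries.map g ((⇑(PowerSeries.derivative A))^[m] f) =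
      (⇑(PowerSeries.derivative B))^[m] (PowerSeries.map g f) := by
  ext d
  rw [PowerSeries.coeff_map, PowerSeries.coeff_iterate_derivative,
    PowerSeries.coeff_iterate_derivative, PowerSeries.coeff_map, map_mul, map_natCast]

theorem map_toricProj_current (x : latticePoints P) :
    PowerSeries.map (toricProj k P : MvPolynomial (latticePoints P × ℕ) k →+*
      ReducedArcRing k (ToricRing k P)) (current k x) = arc k (toricY k P x) := by
  ext j
  rw [PowerSeries.coeff_map, coeff_current, arc, PowerSeries.coeff_mk]
  exact aeval_X _ _

theorem toricY_mul_eq {x y z w : latticePoints P}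
    (h : (x : Fin n → ℤ) + y = z + w) :
    toricY k P x * toricY k P y = toricY k P z * toricY k P w := by
  rw [toricY, toricY, toricY, toricY, AddMonoidAlgebra.single_mul_single,
    AddMonoidAlgebra.single_mul_single]
  congr 1
  exact Subtype.ext (Prod.ext h rfl)

theorem pointCurrent_of_mem {x : Fin n → ℤ} (h : x ∈ latticePoints P) :
    pointCurrent k P x = current k (⟨x, h⟩ : latticePoints P) := dif_pos h

variable {prec : (latticePoints P →₀ ℕ) → (latticePoints P →₀ ℕ) → Prop}
  {γ : (Fin n → ℤ) → (Fin n → ℤ) → ℕ} {e : (Fin n → ℤ) → (Fin n → ℤ) → ℕ → (Fin n → ℤ)}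

theorem IsCubeGeneratingData.sub_eq_cubeVertex (h : IsCubeGeneratingData P prec γ e)
    {x y : Fin n → ℤ} (hx : x ∈ latticePoints P) (hy : y ∈ latticePoints P) (hxy : x ≠ y)
    {J : Finset ℕ} (hJ : J ⊆ Finset.range (γ x y + 1)) :
    y - ∑ l ∈ J, e x y l = cubeVertex e x y (Finset.range (γ x y + 1) \ J) := by
  nth_rewrite 1 [← h.sum_eq x hx y hy hxy]
  rw [cubeVertex, cubeVertex, ← Finset.sum_sdiff hJ]
  abel

theorem insert_zero_subset {N : ℕ} {I : Finset ℕ} (hI : I ⊆ Finset.Icc 1 N) :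
    insert 0 I ⊆ Finset.range (N + 1) := by
  intro l hl
  rcases Finset.mem_insert.1 hl with rfl | hl
  · simp
  · have := Finset.mem_Icc.1 (hI hl)
    exact Finset.mem_range.2 (by omega)

/-- The cube relations hold in the reduced arc ring. It suffices to check this in the quotients by
prime ideals, where it is an identity for series over a domain. -/
theorem IsCubeGeneratingData.coeff_cubeRelation_mem (h : IsCubeGeneratingData P prec γ e)
    (x y : latticePoints P) (hxy : x ≠ y) {m : ℕ} (hm : m < γ x y) (d : ℕ) :
    PowerSeries.coeff d (cubeRelation k P γ e x y m) ∈ definingIdeal k P := by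
  classical
  have hxy' : (x : Fin n → ℤ) ≠ y := fun e => hxy (Subtype.ext e)
  have hmem : ∀ J ⊆ Finset.range (γ x y + 1), cubeVertex e x y J ∈ latticePoints P :=
    h.vertex_mem x x.2 y y.2 hxy'
  rw [definingIdeal, RingHom.mem_ker]
  refine IsNilpotent.eq_zero (nilpotent_iff_mem_prime.2 fun p hp => ?_)
  rw [← Ideal.Quotient.eq_zero_iff_mem]
  let A := ReducedArcRing k (ToricRing k P) ⧸ p
  let g : MvPolynomial (latticePoints P × ℕ) k →+* A :=
    (Ideal.Quotient.mk p).comp (toricProj k P : _ →+* ReducedArcRing k (ToricRing k P))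
  let a : Finset ℕ → PowerSeries A := fun J =>
    if hJ : J ⊆ Finset.range (γ x y + 1) then
      PowerSeries.map (Ideal.Quotient.mk p) (arc k (toricY k P ⟨_, hmem J hJ⟩)) else 0
  have ha : ∀ J (hJ : J ⊆ Finset.range (γ x y + 1)),
      PowerSeries.map g (pointCurrent k P (cubeVertex e x y J)) = a J := by
    intro J hJ
    rw [pointCurrent_of_mem (hmem J hJ)]
    simp only [a, g]
    rw [dif_pos hJ, PowerSeries.map_comp, RingHom.comp_apply, map_toricProj_current]
  have key := cube_relation (PowerSeries.derivative A) (N := γ x y) a (fun J hJ J' hJ' => by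
    simp only [a]
    rw [dif_pos hJ, dif_pos hJ', dif_pos (Finset.union_subset hJ hJ'),
      dif_pos (Finset.inter_subset_left.trans hJ), ← map_mul, ← map_mul, ← arc_mul, ← arc_mul,
      toricY_mul_eq]
    simp only [cubeVertex]
    rw [add_add_add_comm, ← Finset.sum_union_inter, ← add_add_add_comm]) hm
  change g (PowerSeries.coeff d _) = 0
  rw [← PowerSeries.coeff_map, cubeRelation, map_sum]
  refine (congrArg (PowerSeries.coeff d) (Eq.trans (Finset.sum_congr rfl fun I hI => ?_) key)).trans
    (map_zero _)
  have hI := insert_zero_subset (Finset.mem_powerset.1 hI)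
  rw [map_mul, map_pow, map_neg, map_one, map_mul, map_iterate_derivative,
    h.sub_eq_cubeVertex x.2 y.2 hxy' hI, ha _ Finset.sdiff_subset]
  rw [← ha _ hI]
  rfl

theorem isInitialPart_sum {σ α : Type*} {prec : (σ →₀ ℕ) → (σ →₀ ℕ) → Prop}
    (hirr : ∀ r, ¬prec r r) (s : Finset α) (f : α → MvPolynomial (σ × ℕ) k) (r : α → σ →₀ ℕ)
    (hf : ∀ i ∈ s, IsWeightedHomogeneous multiWeight (f i) (r i)) {a : α} (ha : a ∈ s)
    (h0 : f a ≠ 0) (hr : ∀ i ∈ s, i ≠ a → prec (r i) (r a)) :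
    IsInitialPart prec (∑ i ∈ s, f i) (f a) := by
  refine ⟨r a, ?_, h0, fun r' hr' => ?_⟩
  · rw [map_sum, Finset.sum_eq_single a]
    · exact (hf a ha).weightedHomogeneousComponent_same.symm
    · intro i hi hia
      refine (hf i hi).weightedHomogeneousComponent_ne _ fun e => ?_
      have := hr i hi hia
      rw [e] at this
      exact hirr _ this
    · exact fun h => absurd ha h
  · rw [map_sum] at hr'
    obtain ⟨i, hi, hi'⟩ := Finset.exists_ne_zero_of_sum_ne_zero hr'
    have e : r i = r' := by
      by_contra hne
      exact hi' ((hf i hi).weightedHomogeneousComponent_ne _ (Ne.symm hne))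
    by_cases hia : i = a
    · left; rw [← e, hia]
    · right; rw [← e]; exact hr i hi hia

theorem quadCoeff_ne_zero [CharZero k] {σ : Type*} {x y : σ} (hxy : x ≠ y) (l d : ℕ) :
    quadCoeff k x y l d ≠ 0 := by
  classical
  intro h
  have e := congrArg (eval fun v : σ × ℕ => if v = (x, 0) ∨ v = (y, d + l) then (1 : k) else 0) h
  rw [quadCoeff_eq_sum, map_sum, map_zero, Finset.sum_eq_single (0, d)] at e
  · simp [Nat.cast_eq_zero, (Nat.ascFactorial_pos d l).ne'] at e
  · rintro ⟨a, b⟩ hab hne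
    have : a ≠ 0 := by
      rintro rfl
      have := Finset.HasAntidiagonal.mem_antidiagonal.1 hab
      simp at this
      exact hne (by rw [this])
    simp [this, hxy]
  · intro h
    exact absurd (Finset.HasAntidiagonal.mem_antidiagonal.2 (zero_add d)) h

/-- The initial part of a coefficient of a cube relation: its last summand has multidegree larger
than that of all the others. -/
theorem IsCubeGeneratingData.isInitialPart_cubeRelation [CharZero k]
    (h : IsCubeGeneratingData P prec γ e) (x y : latticePoints P) (hxy : x ≠ y) (m d : ℕ) :
    IsInitialPart prec (PowerSeries.coeff d (cubeRelation k P γ e x y m))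
      ((-1) ^ γ x y * quadCoeff k y x m d) := by
  classical
  have hxy' : (x : Fin n → ℤ) ≠ y := fun e => hxy (Subtype.ext e)
  have hmem : ∀ J ⊆ Finset.range (γ x y + 1), cubeVertex e x y J ∈ latticePoints P :=
    h.vertex_mem x x.2 y y.2 hxy'
  let v : Finset ℕ → latticePoints P := fun J =>
    if hJ : J ⊆ Finset.range (γ x y + 1) then ⟨_, hmem J hJ⟩ else x
  have hv : ∀ J ⊆ Finset.range (γ x y + 1), (v J : Fin n → ℤ) = cubeVertex e x y J := fun J hJ => by
    simp only [v]
    rw [dif_pos hJ]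
  let f : Finset ℕ → MvPolynomial (latticePoints P × ℕ) k := fun I => (-1) ^ I.card *
    quadCoeff k (v (insert 0 I)) (v (Finset.range (γ x y + 1) \ insert 0 I)) m d
  have hfull : insert 0 (Finset.Icc 1 (γ x y)) = Finset.range (γ x y + 1) := by
    ext l
    simp only [Finset.mem_insert, Finset.mem_Icc, Finset.mem_range]
    omega
  have hvfull : v (insert 0 (Finset.Icc 1 (γ x y))) = y := by
    rw [hfull]
    exact Subtype.ext ((hv _ subset_rfl).trans (h.sum_eq x x.2 y y.2 hxy'))
  have hvempty : v (Finset.range (γ x y + 1) \ insert 0 (Finset.Icc 1 (γ x y))) = x := by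
    rw [hfull, Finset.sdiff_self]
    exact Subtype.ext ((hv _ (Finset.empty_subset _)).trans (by simp [cubeVertex]))
  have hfa : f (Finset.Icc 1 (γ x y)) = (-1) ^ γ x y * quadCoeff k y x m d := by
    simp only [f]
    rw [hvfull, hvempty, Nat.card_Icc, Nat.add_sub_cancel]
  have hsum : PowerSeries.coeff d (cubeRelation k P γ e x y m) =
      ∑ I ∈ (Finset.Icc 1 (γ x y)).powerset, f I := by
    rw [cubeRelation, map_sum]
    refine Finset.sum_congr rfl fun I hI => ?_
    have hI := insert_zero_subset (Finset.mem_powerset.1 hI)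
    have e₁ : pointCurrent k P (x + ∑ l ∈ insert 0 I, e x y l) = current k (v (insert 0 I)) := by
      have := hv _ hI
      rw [cubeVertex] at this
      rw [← this, pointCurrent_of_mem (v (insert 0 I)).2]
    have e₂ : pointCurrent k P (y - ∑ l ∈ insert 0 I, e x y l) =
        current k (v (Finset.range (γ x y + 1) \ insert 0 I)) := by
      rw [h.sub_eq_cubeVertex x.2 y.2 hxy' hI, ← hv _ Finset.sdiff_subset,
        pointCurrent_of_mem (v _).2]
    have e₃ : ((-1) ^ I.card : PowerSeries (MvPolynomial (latticePoints P × ℕ) k)) =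
        PowerSeries.C ((-1) ^ I.card) := by
      rw [map_pow, map_neg, map_one]
    rw [e₁, e₂, e₃, PowerSeries.coeff_C_mul]
    rfl
  rw [hsum, ← hfa]
  refine isInitialPart_sum h.order.irrefl _ f (fun I => Finsupp.single (v (insert 0 I)) 1 +
    Finsupp.single (v (Finset.range (γ x y + 1) \ insert 0 I)) 1) ?_
    (Finset.mem_powerset_self _) ?_ ?_
  · intro I _
    have e₃ : ((-1) ^ I.card : MvPolynomial (latticePoints P × ℕ) k) = C ((-1) ^ I.card) := by
      rw [map_pow, map_neg, map_one]
    simp only [f, e₃]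
    exact (quadCoeff_multiHomogeneous _ _ _ _).C_mul _
  · rw [hfa]
    exact mul_ne_zero (pow_ne_zero _ (neg_ne_zero.2 one_ne_zero)) (quadCoeff_ne_zero hxy.symm _ _)
  · intro I hI hne
    have hI' := Finset.mem_powerset.1 hI
    have hJ := insert_zero_subset hI'
    rw [hvfull, hvempty, add_comm (Finsupp.single y 1)]
    refine h.initial x y hxy (insert 0 I) ?_ ⟨0, Finset.mem_insert_self _ _⟩ _ _ (hv _ hJ) ?_
    · refine hJ.ssubset_of_ne fun e => hne ?_
      refine hI'.antisymm fun l hl => ?_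
      have hl' : l ∈ insert 0 I := by
        rw [e, ← hfull]
        exact Finset.mem_insert_of_mem hl
      refine (Finset.mem_insert.1 hl').resolve_left ?_
      have := (Finset.mem_Icc.1 hl).1
      omega
    · rw [h.sub_eq_cubeVertex x.2 y.2 hxy' hJ, hv _ Finset.sdiff_subset]

end CubeRelations

/-! ### The lifted polytope and its integer points -/

section Lift

variable {n : ℕ} {P : Set (Fin n → ℝ)} {ζ : (Fin n → ℝ) → ℝ}

/-- `ζ` is a nonnegative concave function on the lattice polytope `P`, with integer values at the
integer points. -/
structure IsLiftFunction (P : Set (Fin n → ℝ)) (ζ : (Fin n → ℝ) → ℝ) : Prop where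
  polytope : IsLatticePolytope P
  concave : ConcaveOn ℝ P ζ
  nonneg : ∀ x ∈ P, 0 ≤ ζ x
  int : ∀ x ∈ latticePoints P, ∃ c : ℤ, ζ (toReal x) = c

theorem IsLatticePolytope.finite_latticePoints (hP : IsLatticePolytope P) :
    (latticePoints P).Finite := by
  obtain ⟨S, -, rfl⟩ := hP
  have hb : Bornology.IsBounded (convexHull ℝ (toReal '' (S : Set (Fin n → ℤ)))) :=
    isBounded_convexHull.2 ((S.finite_toSet.image _).isBounded)
  obtain ⟨M, hM⟩ := hb.exists_norm_le
  refine (Set.finite_Icc (fun _ : Fin n => ⌊-M⌋) (fun _ => ⌈M⌉)).subset fun x hx => ?_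
  have h : ∀ i, |(x i : ℝ)| ≤ M := fun i => (norm_le_pi_norm (toReal x) i).trans (hM _ hx)
  refine ⟨fun i => ?_, fun i => ?_⟩
  · have h₁ := (abs_le.1 (h i)).1
    have h₂ := Int.floor_le (-M)
    exact_mod_cast h₂.trans h₁
  · have h₁ := (abs_le.1 (h i)).2
    have h₂ := Int.le_ceil M
    exact_mod_cast h₁.trans h₂

theorem IsLatticePolytope.convex (hP : IsLatticePolytope P) : Convex ℝ P := by
  obtain ⟨S, -, rfl⟩ := hP
  exact convex_convexHull ℝ _

namespace IsLiftFunction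

variable (h : IsLiftFunction P ζ)
include h

theorem zetaInt_eq {x : Fin n → ℤ} (hx : x ∈ latticePoints P) :
    (zetaInt ζ x : ℝ) = ζ (toReal x) := by
  obtain ⟨c, hc⟩ := h.int x hx
  rw [zetaInt, hc, Int.floor_intCast]

theorem zetaInt_le_zetaMax {x : Fin n → ℤ} (hx : x ∈ latticePoints P) :
    zetaInt ζ x ≤ zetaMax P ζ :=
  le_csSup (h.polytope.finite_latticePoints.image _).bddAbove ⟨x, hx, rfl⟩

theorem floorHeight_nonneg {x : Fin n → ℤ} (hx : x ∈ latticePoints P) :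
    0 ≤ floorHeight P ζ x := sub_nonneg.2 (h.zetaInt_le_zetaMax hx)

theorem floorHeight_le_zetaMax {x : Fin n → ℤ} (hx : x ∈ latticePoints P) :
    floorHeight P ζ x ≤ zetaMax P ζ := by
  have h₁ := h.nonneg _ hx
  rw [← h.zetaInt_eq hx] at h₁
  have : 0 ≤ zetaInt ζ x := by exact_mod_cast h₁
  rw [floorHeight]
  omega

theorem floorHeight_eq {x : Fin n → ℤ} (hx : x ∈ latticePoints P) :
    (floorHeight P ζ x : ℝ) = zetaMax P ζ - ζ (toReal x) := by
  rw [floorHeight, Int.cast_sub, h.zetaInt_eq hx]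

theorem zetaMax_nonneg : 0 ≤ zetaMax P ζ := by
  obtain ⟨S, ⟨x, hx⟩, hS⟩ := h.polytope
  have hx : x ∈ latticePoints P := by
    change toReal x ∈ P
    rw [hS]
    exact subset_convexHull ℝ _ ⟨x, hx, rfl⟩
  exact (h.floorHeight_nonneg hx).trans (h.floorHeight_le_zetaMax hx)

/-- The lifted polytope lies between the graph of `ζ_max - ζ` and the level `ζ_max`. -/
theorem liftPolytope_subset {z : Fin (n + 1) → ℝ} (hz : z ∈ liftPolytope P ζ) :
    (fun i : Fin n => z i.castSucc) ∈ P ∧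
      (zetaMax P ζ : ℝ) - ζ (fun i : Fin n => z i.castSucc) ≤ z (Fin.last n) ∧
      z (Fin.last n) ≤ zetaMax P ζ := by
  let E : Set (Fin (n + 1) → ℝ) := {z | (fun i : Fin n => z i.castSucc) ∈ P ∧
      (zetaMax P ζ : ℝ) - ζ (fun i : Fin n => z i.castSucc) ≤ z (Fin.last n) ∧
      z (Fin.last n) ≤ zetaMax P ζ}
  have hE : Convex ℝ E := by
    rintro z ⟨h₁, h₂, h₃⟩ w ⟨g₁, g₂, g₃⟩ a b ha hb hab
    have hc := h.concave.2 h₁ g₁ ha hb hab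
    have e : (fun i : Fin n => (a • z + b • w) i.castSucc) =
        a • (fun i : Fin n => z i.castSucc) + b • fun i : Fin n => w i.castSucc := rfl
    refine ⟨?_, ?_, ?_⟩
    · rw [e]; exact h.polytope.convex h₁ g₁ ha hb hab
    · rw [e]
      simp only [smul_eq_mul, Pi.add_apply, Pi.smul_apply] at hc ⊢
      obtain rfl : a = 1 - b := by linarith
      nlinarith [mul_le_mul_of_nonneg_left h₂ ha, mul_le_mul_of_nonneg_left g₂ hb]
    · simp only [smul_eq_mul, Pi.add_apply, Pi.smul_apply]
      obtain rfl : a = 1 - b := by linarith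
      nlinarith [mul_le_mul_of_nonneg_left h₃ ha, mul_le_mul_of_nonneg_left g₃ hb]
  refine convexHull_min ?_ hE hz
  rintro _ (⟨x, hx, rfl⟩ | ⟨x, hx, rfl⟩)
  · simp only [E, Set.mem_ofPred_eq, Fin.snoc_castSucc, Fin.snoc_last]
    exact ⟨hx, by linarith [h.nonneg x hx], le_rfl⟩
  · simp only [E, Set.mem_ofPred_eq, Fin.snoc_castSucc, Fin.snoc_last]
    refine ⟨hx, ?_, by exact_mod_cast h.floorHeight_le_zetaMax hx⟩
    rw [h.floorHeight_eq hx]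

theorem mem_latticePoints_iff {z : Fin (n + 1) → ℤ} :
    z ∈ latticePoints (liftPolytope P ζ) ↔ base z ∈ latticePoints P ∧
      floorHeight P ζ (base z) ≤ height z ∧ height z ≤ zetaMax P ζ := by
  constructor
  · intro hz
    obtain ⟨h₁, h₂, h₃⟩ := h.liftPolytope_subset hz
    have h₁ : base z ∈ latticePoints P := h₁
    have h₃ : (height z : ℝ) ≤ zetaMax P ζ := h₃
    refine ⟨h₁, ?_, by exact_mod_cast h₃⟩
    have h₂ : (zetaMax P ζ : ℝ) - ζ (toReal (base z)) ≤ (height z : ℝ) := h₂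
    rw [← h.floorHeight_eq h₁] at h₂
    exact_mod_cast h₂
  · rintro ⟨h₁, h₂, h₃⟩
    have hconv : Convex ℝ (liftPolytope P ζ) := convex_convexHull ℝ _
    have hbot : (Fin.snoc (toReal (base z)) (floorHeight P ζ (base z) : ℝ) : Fin (n + 1) → ℝ) ∈
        liftPolytope P ζ := subset_convexHull ℝ _ (Or.inr ⟨_, h₁, rfl⟩)
    have htop : (Fin.snoc (toReal (base z)) (zetaMax P ζ : ℝ) : Fin (n + 1) → ℝ) ∈
        liftPolytope P ζ := subset_convexHull ℝ _ (Or.inl ⟨_, h₁, rfl⟩)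
    have hz : toReal z = Fin.snoc (toReal (base z)) (height z : ℝ) := by
      funext i
      refine Fin.lastCases ?_ (fun i => ?_) i
      · rw [Fin.snoc_last]; rfl
      · rw [Fin.snoc_castSucc]; rfl
    have h₂' : (floorHeight P ζ (base z) : ℝ) ≤ height z := by exact_mod_cast h₂
    have h₃' : (height z : ℝ) ≤ zetaMax P ζ := by exact_mod_cast h₃
    have hseg : (height z : ℝ) ∈ segment ℝ (floorHeight P ζ (base z) : ℝ) (zetaMax P ζ) := by
      rw [segment_eq_Icc (h₂'.trans h₃')]
      exact ⟨h₂', h₃'⟩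
    obtain ⟨a, b, ha, hb, hab, hz'⟩ := hseg
    change toReal z ∈ liftPolytope P ζ
    convert hconv hbot htop ha hb hab
    rw [hz]
    funext i
    refine Fin.lastCases ?_ (fun i => ?_) i
    · simp only [Fin.snoc_last, Pi.add_apply, Pi.smul_apply]
      exact hz'.symm
    · simp only [Fin.snoc_castSucc, Pi.add_apply, Pi.smul_apply, smul_eq_mul]
      rw [← add_mul, hab, one_mul]

theorem isLatticePolytope_liftPolytope : IsLatticePolytope (liftPolytope P ζ) := by
  classical
  obtain ⟨S, hS, hPS⟩ := h.polytope
  let top : (Fin n → ℝ) → Fin (n + 1) → ℝ := fun x => Fin.snoc x (zetaMax P ζ : ℝ)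
  let T : Finset (Fin (n + 1) → ℤ) := S.image (fun x => Fin.snoc x (zetaMax P ζ)) ∪
    h.polytope.finite_latticePoints.toFinset.image (fun x => Fin.snoc x (floorHeight P ζ x))
  have hsnoc : ∀ (x : Fin n → ℤ) (a : ℤ), toReal (Fin.snoc x a : Fin (n + 1) → ℤ) =
      (Fin.snoc (toReal x) (a : ℝ) : Fin (n + 1) → ℝ) := by
    intro x a
    funext i
    refine Fin.lastCases ?_ (fun i => ?_) i
    · simp [toReal]
    · simp [toReal]
  refine ⟨T, (hS.image _).mono Finset.subset_union_left, ?_⟩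
  have hT : toReal '' (T : Set (Fin (n + 1) → ℤ)) = top '' (toReal '' (S : Set (Fin n → ℤ))) ∪
      (fun x : Fin n → ℤ => (Fin.snoc (toReal x) (floorHeight P ζ x : ℝ) : Fin (n + 1) → ℝ)) ''
        latticePoints P := by
    simp only [T, Finset.coe_union, Finset.coe_image, Set.Finite.coe_toFinset, Set.image_union,
      Set.image_image, hsnoc, top]
  have htop : top '' P ⊆ convexHull ℝ (top '' (toReal '' (S : Set (Fin n → ℤ)))) := by
    rintro _ ⟨x, hx, rfl⟩
    have hconv : Convex ℝ {x | top x ∈ convexHull ℝ (top '' (toReal '' (S : Set (Fin n → ℤ))))} := by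
      intro x hx y hy a b ha hb hab
      have := convex_convexHull ℝ (top '' (toReal '' (S : Set (Fin n → ℤ)))) hx hy ha hb hab
      have e : top (a • x + b • y) = a • top x + b • top y := by
        funext i
        refine Fin.lastCases ?_ (fun i => ?_) i
        · simp only [top, Fin.snoc_last, Pi.add_apply, Pi.smul_apply, smul_eq_mul]
          rw [← add_mul, hab, one_mul]
        · simp [top]
      rwa [Set.mem_ofPred_eq, e]
    rw [hPS] at hx
    refine convexHull_min ?_ hconv hx
    intro y hy
    exact subset_convexHull ℝ _ ⟨y, hy, rfl⟩
  rw [hT, liftPolytope]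
  refine subset_antisymm (convexHull_min (Set.union_subset ?_ ?_) (convex_convexHull ℝ _))
    (convexHull_mono (Set.union_subset_union_left _ ?_))
  · exact htop.trans (convexHull_mono Set.subset_union_left)
  · exact Set.subset_union_right.trans (subset_convexHull ℝ _)
  · refine Set.image_mono ?_
    rw [hPS]
    exact subset_convexHull ℝ _

end IsLiftFunction

end Lift

/-! ### The order on the lifted points -/

section LiftOrder

variable {n : ℕ} {P : Set (Fin n → ℝ)} {ζ : (Fin n → ℝ) → ℝ} {idx : (Fin n → ℤ) → ℕ}

theorem base_add (x y : Fin (n + 1) → ℤ) : base (x + y) = base x + base y := rfl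

theorem height_add (x y : Fin (n + 1) → ℤ) : height (x + y) = height x + height y := rfl

theorem base_neg (x : Fin (n + 1) → ℤ) : base (-x) = -base x := rfl

theorem height_neg (x : Fin (n + 1) → ℤ) : height (-x) = -height x := rfl

theorem base_snoc (x : Fin n → ℤ) (a : ℤ) : base (Fin.snoc x a : Fin (n + 1) → ℤ) = x := by
  funext i
  simp [base]

theorem height_snoc (x : Fin n → ℤ) (a : ℤ) : height (Fin.snoc x a : Fin (n + 1) → ℤ) = a := by
  simp [height]

theorem base_sum {α : Type*} (s : Finset α) (f : α → Fin (n + 1) → ℤ) :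
    base (∑ i ∈ s, f i) = ∑ i ∈ s, base (f i) := by
  funext i
  simp [base, Finset.sum_apply]

theorem height_sum {α : Type*} (s : Finset α) (f : α → Fin (n + 1) → ℤ) :
    height (∑ i ∈ s, f i) = ∑ i ∈ s, height (f i) := by
  simp [height, Finset.sum_apply]

theorem ext_base_height {x y : Fin (n + 1) → ℤ} (h₁ : base x = base y) (h₂ : height x = height y) :
    x = y := by
  funext i
  refine Fin.lastCases h₂ (fun i => ?_) i
  exact congrFun h₁ i

theorem not_liftLT_self (x : Fin (n + 1) → ℤ) : ¬liftLT idx x x := by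
  rintro (h | ⟨-, h⟩) <;> exact lt_irrefl _ h

theorem liftLT_trans {x y z : Fin (n + 1) → ℤ} (h₁ : liftLT idx x y) (h₂ : liftLT idx y z) :
    liftLT idx x z := by
  unfold liftLT at *
  omega

theorem liftLT_asymm {x y : Fin (n + 1) → ℤ} (h : liftLT idx x y) : ¬liftLT idx y x := by
  unfold liftLT at *
  omega

namespace IsLiftFunction

variable (h : IsLiftFunction P ζ) (hidx : Set.InjOn idx (latticePoints P))
include h

theorem base_mem (x : latticePoints (liftPolytope P ζ)) :
    base (x : Fin (n + 1) → ℤ) ∈ latticePoints P := (h.mem_latticePoints_iff.1 x.2).1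

theorem floorHeight_le (x : latticePoints (liftPolytope P ζ)) :
    floorHeight P ζ (base (x : Fin (n + 1) → ℤ)) ≤ height (x : Fin (n + 1) → ℤ) :=
  (h.mem_latticePoints_iff.1 x.2).2.1

theorem height_nonneg (x : latticePoints (liftPolytope P ζ)) :
    0 ≤ height (x : Fin (n + 1) → ℤ) :=
  (h.floorHeight_nonneg (h.base_mem x)).trans (h.floorHeight_le x)

/-- The integer point of `P` below an integer point of the lifted polytope. -/
def basePoint (x : latticePoints (liftPolytope P ζ)) : latticePoints P := ⟨base x, h.base_mem x⟩

omit h in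
theorem ext_basePoint (h : IsLiftFunction P ζ) {x y : latticePoints (liftPolytope P ζ)}
    (h₁ : h.basePoint x = h.basePoint y)
    (h₂ : height (x : Fin (n + 1) → ℤ) = height (y : Fin (n + 1) → ℤ)) : x = y :=
  Subtype.ext (ext_base_height (congrArg Subtype.val h₁) h₂)

theorem prVec_eq (r : latticePoints (liftPolytope P ζ) →₀ ℕ) :
    prVec P _ r = r.mapDomain h.basePoint := by
  ext v
  have e : (fun y : latticePoints (liftPolytope P ζ) => base y.1) =
      Subtype.val ∘ h.basePoint := rfl
  rw [prVec, Finsupp.subtypeDomain_apply, e, Finsupp.mapDomain_comp,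
    Finsupp.mapDomain_apply Subtype.val_injective]

include hidx in
theorem liftLT_total {x y : latticePoints (liftPolytope P ζ)} (hxy : x ≠ y) :
    liftLT idx (x : Fin (n + 1) → ℤ) y ∨ liftLT idx (y : Fin (n + 1) → ℤ) x := by
  have key : height (x : Fin (n + 1) → ℤ) = height (y : Fin (n + 1) → ℤ) →
      idx (base (x : Fin (n + 1) → ℤ)) ≠ idx (base (y : Fin (n + 1) → ℤ)) := fun h₁ h₂ =>
    hxy (Subtype.ext (ext_base_height (hidx (h.base_mem x) (h.base_mem y) h₂) h₁))
  unfold liftLT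
  omega

theorem finite_lift : Finite (latticePoints (liftPolytope P ζ)) :=
  h.isLatticePolytope_liftPolytope.finite_latticePoints

include hidx in
theorem isMonomialOrder_liftPrec {prec : (latticePoints P →₀ ℕ) → (latticePoints P →₀ ℕ) → Prop}
    (hprec : IsMonomialOrder prec) : IsMonomialOrder (liftPrec P idx prec ζ) where
  irrefl r := by
    rintro (h' | ⟨-, y, hy, -⟩)
    · exact hprec.irrefl _ h'
    · exact lt_irrefl _ hy
  trans r s t := by
    rintro (h₁ | ⟨e₁, y, hy, hy'⟩) (h₂ | ⟨e₂, z, hz, hz'⟩)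
    · exact Or.inl (hprec.trans _ _ _ h₁ h₂)
    · exact Or.inl (e₂ ▸ h₁)
    · exact Or.inl (e₁ ▸ h₂)
    · refine Or.inr ⟨e₁.trans e₂, ?_⟩
      rcases eq_or_ne y z with rfl | hyz
      · exact ⟨y, hy.trans hz, fun w hw => (hy' w hw).trans (hz' w hw)⟩
      · rcases h.liftLT_total hidx hyz with hlt | hlt
        · exact ⟨y, (hz' y hlt) ▸ hy, fun w hw => (hy' w hw).trans (hz' w (liftLT_trans hw hlt))⟩
        · exact ⟨z, (hy' z hlt).symm ▸ hz, fun w hw =>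
            (hy' w (liftLT_trans hw hlt)).trans (hz' w hw)⟩
  total r s hrs := by
    by_cases e : prVec P _ r = prVec P _ s
    · obtain ⟨y, hy⟩ := DFunLike.ne_iff.1 hrs
      have := h.finite_lift
      have wf : WellFounded fun x y : latticePoints (liftPolytope P ζ) =>
          liftLT idx (x : Fin (n + 1) → ℤ) y := by
        have : IsTrans (latticePoints (liftPolytope P ζ)) fun x y => liftLT idx x.1 y.1 :=
          ⟨fun _ _ _ => liftLT_trans⟩
        have : Std.Irrefl fun x y : latticePoints (liftPolytope P ζ) => liftLT idx x.1 y.1 :=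
          ⟨fun _ => not_liftLT_self _⟩
        exact Finite.wellFounded_of_trans_of_irrefl _
      obtain ⟨z, hz, hmin⟩ := wf.has_min {y | r y ≠ s y} ⟨y, hy⟩
      have hmin' : ∀ w : latticePoints (liftPolytope P ζ),
          liftLT idx (w : Fin (n + 1) → ℤ) z → r w = s w := fun w hw => by
        by_contra hne
        exact hmin w hne hw
      rcases lt_or_gt_of_ne (show r z ≠ s z from hz) with hlt | hlt
      · exact Or.inl (Or.inr ⟨e, z, hlt, hmin'⟩)
      · exact Or.inr (Or.inr ⟨e.symm, z, hlt, fun w hw => (hmin' w hw).symm⟩)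
    · rcases hprec.total _ _ e with h' | h'
      · exact Or.inl (Or.inl h')
      · exact Or.inr (Or.inl h')
  add_right r s t := by
    have hadd : ∀ r s, prVec P (liftPolytope P ζ) (r + s) = prVec P _ r + prVec P _ s := by
      intro r s
      rw [h.prVec_eq, h.prVec_eq, h.prVec_eq, Finsupp.mapDomain_add]
    rintro (h' | ⟨e, y, hy, hy'⟩)
    · left
      rw [hadd, hadd]
      exact hprec.add_right _ _ _ h'
    · refine Or.inr ⟨by rw [hadd, hadd, e], y, by simpa using hy, fun z hz => ?_⟩
      rw [Finsupp.add_apply, Finsupp.add_apply, hy' z hz]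

end IsLiftFunction

end LiftOrder

/-! ### The lifted cube generating data -/

section LiftData

variable {n : ℕ} {P : Set (Fin n → ℝ)} {ζ : (Fin n → ℝ) → ℝ} {idx : (Fin n → ℤ) → ℕ}
  {prec : (latticePoints P →₀ ℕ) → (latticePoints P →₀ ℕ) → Prop}
  {γ : (Fin n → ℤ) → (Fin n → ℤ) → ℕ} {e : (Fin n → ℤ) → (Fin n → ℤ) → ℕ → (Fin n → ℤ)}
  {f : (Fin n → ℤ) → (Fin n → ℤ) → ℕ → ℕ}

theorem sum_climb (f : ℕ → ℕ) (c N : ℕ) :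
    ∑ l ∈ Finset.range N, climb f c l = ∑ l ∈ Finset.range N, f l - c := by
  induction N with
  | zero => simp
  | succ N ih =>
    rw [Finset.sum_range_succ, ih, climb, Finset.sum_range_succ f N]
    omega

theorem climb_le (f : ℕ → ℕ) (c l : ℕ) : climb f c l ≤ f l := by
  rw [climb, Finset.sum_range_succ f l]
  omega

/-- If the total of the `f` exceeds `c`, then climbing falls short of `f` by at most `c` along any
set of directions. -/
theorem sum_le_add_sum_climb (f : ℕ → ℕ) (c N : ℕ) {J : Finset ℕ} (hJ : J ⊆ Finset.range N)
    (hc : c ≤ ∑ l ∈ Finset.range N, f l) : ∑ l ∈ J, f l ≤ c + ∑ l ∈ J, climb f c l := by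
  have h₁ := Finset.sum_sdiff (f := f) hJ
  have h₂ := Finset.sum_sdiff (f := climb f c) hJ
  have h₃ : ∑ l ∈ Finset.range N \ J, climb f c l ≤ ∑ l ∈ Finset.range N \ J, f l :=
    Finset.sum_le_sum fun l _ => climb_le f c l
  rw [sum_climb] at h₂
  omega

theorem IsCubeGeneratingData.cubeVertex_sdiff (hd : IsCubeGeneratingData P prec γ e)
    {u v : Fin n → ℤ} (hu : u ∈ latticePoints P) (hv : v ∈ latticePoints P) (huv : u ≠ v)
    {J : Finset ℕ} (hJ : J ⊆ Finset.range (γ u v + 1)) :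
    cubeVertex e v u (Finset.range (γ u v + 1) \ J) = cubeVertex e u v J := by
  have h₁ := hd.sum_eq u hu v hv huv
  have h₂ := Finset.sum_sdiff (f := e u v) hJ
  have h₃ : ∑ l ∈ Finset.range (γ u v + 1) \ J, e v u l =
      -∑ l ∈ Finset.range (γ u v + 1) \ J, e u v l := by
    rw [← Finset.sum_neg_distrib]
    refine Finset.sum_congr rfl fun l hl => ?_
    have := Finset.mem_range.1 (Finset.mem_sdiff.1 hl).1
    exact hd.antisymm u hu v hv huv l (by omega)
  rw [cubeVertex] at h₁ ⊢
  rw [h₃, cubeVertex]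
  nth_rewrite 1 [← h₁]
  rw [← h₂]
  abel

/-- The shape of the vectors `e_l(x, y)` of the lifted data: the first `N` of them lie over the
vectors `e_l` of the projections and have vertical components `w`, and they are followed by `m`
vertical unit vectors. -/
structure IsLiftedPath (P : Set (Fin n → ℝ)) (idx : (Fin n → ℤ) → ℕ)
    (γ : (Fin n → ℤ) → (Fin n → ℤ) → ℕ)
    (e : (Fin n → ℤ) → (Fin n → ℤ) → ℕ → (Fin n → ℤ)) (ζ : (Fin n → ℝ) → ℝ)
    (f : (Fin n → ℤ) → (Fin n → ℤ) → ℕ → ℕ) (x y : Fin (n + 1) → ℤ) (N m : ℕ) (w : ℕ → ℕ) :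
    Prop where
  lt_path : ∀ l < N, eLT P idx γ e ζ f x y l = Fin.snoc (e (base x) (base y) l) (w l : ℤ)
  le_path : ∀ l, N ≤ l → eLT P idx γ e ζ f x y l = Fin.snoc (0 : Fin n → ℤ) (1 : ℤ)
  gamma_add : gammaLT P idx γ ζ x y + 1 = N + m
  height_eq : height x + ∑ l ∈ Finset.range N, (w l : ℤ) + m = height y
  mem : ∀ J ⊆ Finset.range N, cubeVertex e (base x) (base y) J ∈ latticePoints P
  floor_le : ∀ J ⊆ Finset.range N,
    floorHeight P ζ (cubeVertex e (base x) (base y) J) ≤ height x + ∑ l ∈ J, (w l : ℤ)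
  vertex_range : cubeVertex e (base x) (base y) (Finset.range N) = base y
  base_eq : N = if base x = base y then 0 else γ (base x) (base y) + 1
  pos : N ≠ 0 → 0 < ∑ l ∈ Finset.range N, (w l : ℤ) ∨ idx (base x) < idx (base y)

namespace IsLiftFunction

variable (h : IsLiftFunction P ζ)
include h

theorem floorHeight_add_sum_eq (hf : IsAdmissible P γ e ζ f) {u v : Fin n → ℤ}
    (hu : u ∈ latticePoints P) (hv : v ∈ latticePoints P) (huv : u ≠ v)
    (hle : floorHeight P ζ v ≤ floorHeight P ζ u) :
    floorHeight P ζ v + ∑ l ∈ Finset.range (γ u v + 1), (f u v l : ℤ) = floorHeight P ζ u := by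
  have e₁ := h.floorHeight_eq hu
  have e₂ := h.floorHeight_eq hv
  have hle' : (floorHeight P ζ v : ℝ) ≤ floorHeight P ζ u := by exact_mod_cast hle
  have := hf.sum_eq u hu v hv huv (by linarith)
  have key : (floorHeight P ζ v : ℝ) + ∑ l ∈ Finset.range (γ u v + 1), (f u v l : ℝ) =
      floorHeight P ζ u := by linarith
  exact_mod_cast key

theorem floorHeight_cubeVertex_le (hd : IsCubeGeneratingData P prec γ e)
    (hf : IsAdmissible P γ e ζ f) {u v : Fin n → ℤ}
    (hu : u ∈ latticePoints P) (hv : v ∈ latticePoints P) (huv : u ≠ v)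
    (hle : floorHeight P ζ v ≤ floorHeight P ζ u) {J : Finset ℕ}
    (hJ : J ⊆ Finset.range (γ u v + 1)) :
    floorHeight P ζ (cubeVertex e u v J) + ∑ l ∈ J, (f u v l : ℤ) ≤ floorHeight P ζ u := by
  have e₁ := h.floorHeight_eq hu
  have e₂ := h.floorHeight_eq hv
  have e₃ := h.floorHeight_eq (hd.vertex_mem u hu v hv huv J hJ)
  have hle' : (floorHeight P ζ v : ℝ) ≤ floorHeight P ζ u := by exact_mod_cast hle
  have := hf.le u hu v hv huv (by linarith) J hJ
  have key : (floorHeight P ζ (cubeVertex e u v J) : ℝ) + ∑ l ∈ J, (f u v l : ℝ) ≤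
      floorHeight P ζ u := by linarith
  exact_mod_cast key

/-- All vertices of the cube of `u` and `v` have floors at most the higher of the two floors. -/
theorem floorHeight_cubeVertex_le_max (hd : IsCubeGeneratingData P prec γ e)
    (hf : IsAdmissible P γ e ζ f) {u v : Fin n → ℤ}
    (hu : u ∈ latticePoints P) (hv : v ∈ latticePoints P) (huv : u ≠ v) {J : Finset ℕ}
    (hJ : J ⊆ Finset.range (γ u v + 1)) :
    floorHeight P ζ (cubeVertex e u v J) ≤ max (floorHeight P ζ u) (floorHeight P ζ v) := by
  rcases le_total (floorHeight P ζ v) (floorHeight P ζ u) with hle | hle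
  · have h₁ := h.floorHeight_cubeVertex_le hd hf hu hv huv hle hJ
    have h₂ : 0 ≤ ∑ l ∈ J, (f u v l : ℤ) := Finset.sum_nonneg fun _ _ => by positivity
    exact le_max_of_le_left (by omega)
  · have hγ := hd.gamma_symm u hu v hv huv
    have h₁ := h.floorHeight_cubeVertex_le hd hf hv hu huv.symm hle
      (J := Finset.range (γ u v + 1) \ J) (by rw [hγ]; exact Finset.sdiff_subset)
    rw [hd.cubeVertex_sdiff hu hv huv hJ] at h₁
    have h₂ : 0 ≤ ∑ l ∈ Finset.range (γ u v + 1) \ J, (f v u l : ℤ) :=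
      Finset.sum_nonneg fun _ _ => by positivity
    exact le_max_of_le_right (by omega)

/-- The vectors of the lifted data have the shape of a lifted path. They are purely vertical if
`x` and `y` lie over the same point. If `x` is below the floor over `base y`, the heights of the
path stay put until the sum of the `f` exceeds the height of `x` above its own floor, and then climb
along. Otherwise `x` is above all floors over the cube. -/
theorem exists_isLiftedPath (hd : IsCubeGeneratingData P prec γ e) (hf : IsAdmissible P γ e ζ f)
    {x y : Fin (n + 1) → ℤ} (hx : x ∈ latticePoints (liftPolytope P ζ))
    (hy : y ∈ latticePoints (liftPolytope P ζ)) (hxy : liftLT idx x y) :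
    ∃ N m w, IsLiftedPath P idx γ e ζ f x y N m w := by
  obtain ⟨hu, hxf, hxm⟩ := h.mem_latticePoints_iff.1 hx
  obtain ⟨hv, hyf, hym⟩ := h.mem_latticePoints_iff.1 hy
  rw [liftLT] at hxy
  by_cases huv : base x = base y
  · rw [huv] at hxy hxf
    have hk : kappa P idx ζ x y = height y - height x - 1 := by
      rw [kappa, if_neg (by omega), huv, if_neg (lt_irrefl _)]
    refine ⟨0, (height y - height x).toNat, 0, ?_, ?_, ?_, ?_, ?_, ?_, ?_, ?_, ?_⟩
    · intro l hl
      omega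
    · intro l _
      rw [eLT, if_pos (Or.inl huv)]
    · rw [gammaLT, if_pos huv, hk]
      omega
    · simp only [Finset.range_zero, Finset.sum_empty]
      omega
    · intro J hJ
      rw [Finset.range_zero, Finset.subset_empty] at hJ
      simpa [hJ, cubeVertex] using hu
    · intro J hJ
      rw [Finset.range_zero, Finset.subset_empty] at hJ
      simpa [hJ, cubeVertex, huv] using hxf
    · simp [cubeVertex, huv]
    · rw [if_pos huv]
    · exact fun h0 => absurd rfl h0
  set g := γ (base x) (base y) with hg
  have hgs : γ (base y) (base x) = g := hd.gamma_symm _ hv _ hu (Ne.symm huv)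
  have hpath : ∀ m w, (∀ l < g + 1, eLT P idx γ e ζ f x y l =
        Fin.snoc (e (base x) (base y) l) ((w : ℕ → ℕ) l : ℤ)) →
      gammaLT P idx γ ζ x y = g + m →
      height x + ∑ l ∈ Finset.range (g + 1), (w l : ℤ) + m = height y →
      (∀ J ⊆ Finset.range (g + 1),
        floorHeight P ζ (cubeVertex e (base x) (base y) J) ≤ height x + ∑ l ∈ J, (w l : ℤ)) →
      (0 < ∑ l ∈ Finset.range (g + 1), (w l : ℤ) ∨ idx (base x) < idx (base y)) →
      IsLiftedPath P idx γ e ζ f x y (g + 1) m w := by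
    intro m w h₁ h₂ h₃ h₄ h₅
    refine ⟨h₁, fun l hl => ?_, by omega, h₃, ?_, h₄, ?_, by rw [if_neg huv], fun _ => h₅⟩
    · rw [eLT, if_pos (Or.inr (by omega))]
    · exact fun J hJ => hd.vertex_mem _ hu _ hv huv J hJ
    · exact hd.sum_eq _ hu _ hv huv
  by_cases hclimb : height x < floorHeight P ζ (base y)
  · have hsum := h.floorHeight_add_sum_eq hf hv hu (Ne.symm huv) (by omega)
    rw [hgs] at hsum
    have hsum' : ((∑ l ∈ Finset.range (g + 1), f (base y) (base x) l : ℕ) : ℤ) =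
        floorHeight P ζ (base y) - floorHeight P ζ (base x) := by
      push_cast
      omega
    have hw := sum_climb (f (base y) (base x))
      (height x - floorHeight P ζ (base x)).toNat (g + 1)
    have hw' : ((∑ l ∈ Finset.range (g + 1), climb (f (base y) (base x))
        (height x - floorHeight P ζ (base x)).toNat l : ℕ) : ℤ) =
        floorHeight P ζ (base y) - height x := by omega
    push_cast at hw'
    refine ⟨g + 1, (height y - floorHeight P ζ (base y)).toNat, climb (f (base y) (base x))
      (height x - floorHeight P ζ (base x)).toNat, hpath _ _ ?_ ?_ ?_ ?_ ?_⟩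
    · intro l hl
      rw [eLT, if_neg (by rw [not_or]; exact ⟨huv, by omega⟩), if_pos hclimb]
    · rw [gammaLT, if_neg huv, kappa, if_pos hclimb]
    · rw [hw']
      omega
    · intro J hJ
      have h₁ := h.floorHeight_cubeVertex_le hd hf hv hu (Ne.symm huv) (by omega)
        (J := Finset.range (g + 1) \ J) (by rw [hgs]; exact Finset.sdiff_subset)
      rw [hd.cubeVertex_sdiff hu hv huv hJ] at h₁
      have h₂ := Finset.sum_sdiff (f := fun l => (f (base y) (base x) l : ℤ)) hJ
      have h₃ := sum_le_add_sum_climb (f (base y) (base x))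
        (height x - floorHeight P ζ (base x)).toNat (g + 1) hJ (by omega)
      zify at h₃
      omega
    · rw [hw']
      omega
  · have hmax : ∀ J ⊆ Finset.range (g + 1),
        floorHeight P ζ (cubeVertex e (base x) (base y) J) ≤ height x := fun J hJ =>
      (h.floorHeight_cubeVertex_le_max hd hf hu hv huv hJ).trans (max_le hxf (by omega))
    by_cases hi : idx (base x) < idx (base y)
    · refine ⟨g + 1, (height y - height x).toNat, 0, hpath _ _ ?_ ?_ ?_ ?_ (Or.inr hi)⟩
      · intro l hl
        rw [eLT, if_neg (by rw [not_or]; exact ⟨huv, by omega⟩), if_neg hclimb,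
          if_pos (Or.inl hi)]
        rfl
      · rw [gammaLT, if_neg huv, kappa, if_neg hclimb, if_pos hi]
      · simp only [Pi.zero_apply, Nat.cast_zero, Finset.sum_const_zero]
        omega
      · intro J hJ
        simpa using hmax J hJ
    · have hw : ∑ l ∈ Finset.range (g + 1), ((if l < g then 0 else 1 : ℕ) : ℤ) = 1 := by
        rw [Finset.sum_range_succ, if_neg (lt_irrefl _), Finset.sum_eq_zero, zero_add, Nat.cast_one]
        intro l hl
        rw [if_pos (Finset.mem_range.1 hl), Nat.cast_zero]
      refine ⟨g + 1, (height y - height x - 1).toNat, fun l => if l < g then 0 else 1,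
        hpath _ _ ?_ ?_ ?_ ?_ (Or.inl (by rw [hw]; exact one_pos))⟩
      · intro l hl
        rw [eLT, if_neg (by rw [not_or]; exact ⟨huv, by omega⟩), if_neg hclimb]
        by_cases hl' : l < g
        · rw [if_pos (Or.inr hl')]
          simp [hl']
        · rw [if_neg (by rw [not_or]; exact ⟨hi, hl'⟩)]
          simp [hl']
      · rw [gammaLT, if_neg huv, kappa, if_neg hclimb, if_neg hi]
      · rw [hw]
        omega
      · intro J hJ
        have : 0 ≤ ∑ l ∈ J, ((if l < g then 0 else 1 : ℕ) : ℤ) :=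
          Finset.sum_nonneg fun _ _ => by positivity
        have := hmax J hJ
        change _ ≤ _ + ∑ l ∈ J, ((if l < g then 0 else 1 : ℕ) : ℤ)
        omega

end IsLiftFunction

namespace IsLiftedPath

variable {x y : Fin (n + 1) → ℤ} {N m : ℕ} {w : ℕ → ℕ}
  (hp : IsLiftedPath P idx γ e ζ f x y N m w)
include hp

theorem base_sum_eLT (J : Finset ℕ) : base (∑ l ∈ J, eLT P idx γ e ζ f x y l) =
    ∑ l ∈ J with l < N, e (base x) (base y) l := by
  rw [base_sum, Finset.sum_filter]
  refine Finset.sum_congr rfl fun l _ => ?_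
  by_cases hl : l < N
  · rw [hp.lt_path l hl, base_snoc, if_pos hl]
  · rw [hp.le_path l (not_lt.1 hl), base_snoc, if_neg hl]

theorem height_sum_eLT (J : Finset ℕ) : height (∑ l ∈ J, eLT P idx γ e ζ f x y l) =
    ∑ l ∈ J with l < N, (w l : ℤ) + ((J.filter fun l => ¬l < N).card : ℤ) := by
  rw [height_sum, ← Finset.sum_filter_add_sum_filter_not J (fun l => l < N)]
  congr 1
  · refine Finset.sum_congr rfl fun l hl => ?_
    rw [hp.lt_path l (Finset.mem_filter.1 hl).2, height_snoc]
  · rw [Finset.card_eq_sum_ones, Nat.cast_sum]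
    refine Finset.sum_congr rfl fun l hl => ?_
    rw [hp.le_path l (not_lt.1 (Finset.mem_filter.1 hl).2), height_snoc, Nat.cast_one]

omit hp in
theorem filter_subset_range (J : Finset ℕ) : J.filter (fun l => l < N) ⊆ Finset.range N :=
  fun _ hl => Finset.mem_range.2 (Finset.mem_filter.1 hl).2

theorem filter_not_subset {J : Finset ℕ}
    (hJ : J ⊆ Finset.range (gammaLT P idx γ ζ x y + 1)) :
    J.filter (fun l => ¬l < N) ⊆ Finset.Ico N (N + m) := fun l hl => by
  have h₁ := Finset.mem_range.1 (hJ (Finset.mem_filter.1 hl).1)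
  rw [hp.gamma_add] at h₁
  exact Finset.mem_Ico.2 ⟨not_lt.1 (Finset.mem_filter.1 hl).2, h₁⟩

theorem card_filter_not_le {J : Finset ℕ}
    (hJ : J ⊆ Finset.range (gammaLT P idx γ ζ x y + 1)) :
    (J.filter fun l => ¬l < N).card ≤ m :=
  (Finset.card_le_card (hp.filter_not_subset hJ)).trans (by rw [Nat.card_Ico]; omega)

theorem sum_eq : x + ∑ l ∈ Finset.range (gammaLT P idx γ ζ x y + 1), eLT P idx γ e ζ f x y l =
    y := by
  have hr : (Finset.range (gammaLT P idx γ ζ x y + 1)).filter (fun l => l < N) =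
      Finset.range N := by
    ext l
    have := hp.gamma_add
    simp only [Finset.mem_filter, Finset.mem_range]
    omega
  have hr' : ((Finset.range (gammaLT P idx γ ζ x y + 1)).filter (fun l => ¬l < N)) =
      Finset.Ico N (N + m) := by
    ext l
    have := hp.gamma_add
    simp only [Finset.mem_filter, Finset.mem_range, Finset.mem_Ico]
    omega
  apply ext_base_height
  · rw [base_add, hp.base_sum_eLT, hr]
    exact hp.vertex_range
  · rw [height_add, hp.height_sum_eLT, hr, hr', Nat.card_Ico, ← hp.height_eq]
    omega

theorem vertex_mem (h : IsLiftFunction P ζ) (hy : y ∈ latticePoints (liftPolytope P ζ))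
    {J : Finset ℕ} (hJ : J ⊆ Finset.range (gammaLT P idx γ ζ x y + 1)) :
    x + ∑ l ∈ J, eLT P idx γ e ζ f x y l ∈ latticePoints (liftPolytope P ζ) := by
  have hy' := (h.mem_latticePoints_iff.1 hy).2.2
  have hJ' := filter_subset_range (N := N) J
  have hle : ∑ l ∈ J with l < N, (w l : ℤ) ≤ ∑ l ∈ Finset.range N, (w l : ℤ) :=
    Finset.sum_le_sum_of_subset_of_nonneg hJ' fun _ _ _ => by positivity
  have hfl := hp.floor_le _ hJ'
  have hc := hp.card_filter_not_le hJ
  have hh := hp.height_eq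
  refine h.mem_latticePoints_iff.2 ⟨?_, ?_, ?_⟩
  · rw [base_add, hp.base_sum_eLT]
    exact hp.mem _ hJ'
  · rw [base_add, hp.base_sum_eLT, height_add, hp.height_sum_eLT]
    rw [cubeVertex] at hfl
    omega
  · rw [height_add, hp.height_sum_eLT]
    omega

/-- If the projection of the cube vertex belonging to `J` is an endpoint, then this vertex and the
opposite one are larger than `x`. -/
theorem liftLT_vertex {J : Finset ℕ} (hJ : J ⊂ Finset.range (gammaLT P idx γ ζ x y + 1))
    (hJ₀ : J.Nonempty)
    (hends : J.filter (fun l => l < N) = ∅ ∨ J.filter (fun l => l < N) = Finset.range N) :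
    liftLT idx x (x + ∑ l ∈ J, eLT P idx γ e ζ f x y l) ∧
      liftLT idx x (y - ∑ l ∈ J, eLT P idx γ e ζ f x y l) := by
  have hh := hp.height_eq
  have hc := hp.card_filter_not_le hJ.1
  have hv := hp.vertex_range
  have hb := hp.base_sum_eLT J
  have hht := hp.height_sum_eLT J
  have hpos : N ≠ 0 → 0 < ∑ l ∈ Finset.range N, (w l : ℤ) ∨ idx (base x) < idx (base y) := hp.pos
  have hnn : 0 ≤ ∑ l ∈ Finset.range N, (w l : ℤ) := Finset.sum_nonneg fun _ _ => by positivity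
  have hcard : J.card < N + m := by
    have := Finset.card_lt_card hJ
    rwa [Finset.card_range, hp.gamma_add] at this
  have hsplit := Finset.card_filter_add_card_filter_not (s := J) (fun l => l < N)
  have hJ₀' := hJ₀.card_pos
  rw [cubeVertex] at hv
  simp only [liftLT, sub_eq_add_neg, base_add, height_add, base_neg, height_neg, hb, hht]
  rcases hends with h₁ | h₁
  · rw [h₁, Finset.card_empty] at hsplit
    simp only [h₁, Finset.sum_empty, neg_zero, add_zero, zero_add]
    by_cases hN : N = 0
    · subst hN
      simp only [Finset.range_zero, Finset.sum_empty] at hh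
      omega
    · have := hpos hN
      omega
  · rw [h₁, Finset.card_range] at hsplit
    have hv' : base y + -∑ l ∈ Finset.range N, e (base x) (base y) l = base x := by
      rw [← sub_eq_add_neg, sub_eq_iff_eq_add]
      exact hv.symm
    simp only [h₁, hv, hv']
    by_cases hN : N = 0
    · subst hN
      simp only [Finset.range_zero, Finset.sum_empty] at hh ⊢
      omega
    · have := hpos hN
      omega

end IsLiftedPath

/-- Two points larger than `x`, with the same projections as `x` and `y`, form a smaller monomial
than `x` and `y`. -/
theorem liftPrec_of_lt {x y x' y' : latticePoints (liftPolytope P ζ)}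
    (hpr : prVec P _ (Finsupp.single x' 1 + Finsupp.single y' 1) =
      prVec P _ (Finsupp.single x 1 + Finsupp.single y 1))
    (hxy : liftLT idx (x : Fin (n + 1) → ℤ) y) (hx' : liftLT idx (x : Fin (n + 1) → ℤ) x')
    (hy' : liftLT idx (x : Fin (n + 1) → ℤ) y') :
    liftPrec P idx prec ζ (Finsupp.single x' 1 + Finsupp.single y' 1)
      (Finsupp.single x 1 + Finsupp.single y 1) := by
  have hne : ∀ {z w : latticePoints (liftPolytope P ζ)},
      liftLT idx (z : Fin (n + 1) → ℤ) w → w ≠ z := by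
    rintro z w hzw rfl
    exact not_liftLT_self _ hzw
  refine Or.inr ⟨hpr, x, ?_, fun z hz => ?_⟩
  · rw [Finsupp.add_apply, Finsupp.add_apply, Finsupp.single_eq_of_ne' (hne hx'),
      Finsupp.single_eq_of_ne' (hne hy'), Finsupp.single_eq_same]
    omega
  · rw [Finsupp.add_apply, Finsupp.add_apply, Finsupp.single_eq_of_ne' (hne hz),
      Finsupp.single_eq_of_ne' (hne (liftLT_trans hz hx')),
      Finsupp.single_eq_of_ne' (hne (liftLT_trans hz hy')),
      Finsupp.single_eq_of_ne' (hne (liftLT_trans hz hxy))]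

namespace IsLiftFunction

variable (h : IsLiftFunction P ζ)
include h

/-- The monomial of two opposite vertices of a lifted cube is smaller than that of its endpoints:
this is inherited from `P` unless the projections are the endpoints of the cube in `P`, and in that
case both vertices are larger than `x`. -/
theorem liftPrec_cube (hd : IsCubeGeneratingData P prec γ e) (hf : IsAdmissible P γ e ζ f)
    {x y x' y' : latticePoints (liftPolytope P ζ)} (hxy : liftLT idx (x : Fin (n + 1) → ℤ) y)
    {J : Finset ℕ} (hJ : J ⊂ Finset.range (gammaLT P idx γ ζ x y + 1)) (hJ₀ : J.Nonempty)
    (hx' : (x' : Fin (n + 1) → ℤ) = x + ∑ l ∈ J, eLT P idx γ e ζ f x y l)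
    (hy' : (y' : Fin (n + 1) → ℤ) = y - ∑ l ∈ J, eLT P idx γ e ζ f x y l) :
    liftPrec P idx prec ζ (Finsupp.single x' 1 + Finsupp.single y' 1)
      (Finsupp.single x 1 + Finsupp.single y 1) := by
  obtain ⟨N, m, w, hp⟩ := h.exists_isLiftedPath hd hf x.2 y.2 hxy
  have hbx : base (x' : Fin (n + 1) → ℤ) =
      cubeVertex e (base x) (base y) (J.filter fun l => l < N) := by
    rw [hx', base_add, hp.base_sum_eLT, cubeVertex]
  have hby : base (y' : Fin (n + 1) → ℤ) =
      base y - ∑ l ∈ J with l < N, e (base x) (base y) l := by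
    rw [hy', sub_eq_add_neg, base_add, base_neg, hp.base_sum_eLT, sub_eq_add_neg]
  have hv := hp.vertex_range
  have hpr : ∀ z w : latticePoints (liftPolytope P ζ),
      prVec P _ (Finsupp.single z 1 + Finsupp.single w 1) =
        Finsupp.single (h.basePoint z) 1 + Finsupp.single (h.basePoint w) 1 := fun z w => by
    rw [h.prVec_eq, Finsupp.mapDomain_add, Finsupp.mapDomain_single, Finsupp.mapDomain_single]
  by_cases hends : J.filter (fun l => l < N) = ∅ ∨ J.filter (fun l => l < N) = Finset.range N
  · obtain ⟨h₁, h₂⟩ := hp.liftLT_vertex hJ hJ₀ hends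
    rw [← hx'] at h₁
    rw [← hy'] at h₂
    refine liftPrec_of_lt ?_ hxy h₁ h₂
    rw [hpr, hpr]
    rcases hends with h₃ | h₃
    · have ex : h.basePoint x' = h.basePoint x := Subtype.ext <| by
        change base _ = base _
        rw [hbx, h₃, cubeVertex, Finset.sum_empty, add_zero]
      have ey : h.basePoint y' = h.basePoint y := Subtype.ext <| by
        change base _ = base _
        rw [hby, h₃, Finset.sum_empty, sub_zero]
      rw [ex, ey]
    · have ex : h.basePoint x' = h.basePoint y := Subtype.ext <| by
        change base _ = base _
        rw [hbx, h₃, hv]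
      have ey : h.basePoint y' = h.basePoint x := Subtype.ext <| by
        change base _ = base _
        rw [hby, h₃, sub_eq_iff_eq_add]
        exact hv.symm
      rw [ex, ey, add_comm]
  · rw [not_or] at hends
    have hN : N = if base (x : Fin (n + 1) → ℤ) = base (y : Fin (n + 1) → ℤ) then 0
        else γ (base x) (base y) + 1 := hp.base_eq
    have huv : base (x : Fin (n + 1) → ℤ) ≠ base (y : Fin (n + 1) → ℤ) := by
      intro huv
      rw [if_pos huv] at hN
      refine hends.1 (Finset.filter_eq_empty_iff.2 fun l _ => ?_)
      omega
    rw [if_neg huv] at hN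
    left
    rw [hpr, hpr]
    refine hd.initial (h.basePoint x) (h.basePoint y) (fun e => huv (congrArg Subtype.val e))
      (J.filter fun l => l < N) ?_ (Finset.nonempty_iff_ne_empty.2 hends.1) _ _ hbx hby
    refine Finset.ssubset_iff_subset_ne.2 ⟨?_, ?_⟩
    · change _ ⊆ Finset.range (γ (base x) (base y) + 1)
      rw [← hN]
      exact IsLiftedPath.filter_subset_range J
    · change _ ≠ Finset.range (γ (base x) (base y) + 1)
      rw [← hN]
      exact hends.2

/-- The lifted data is cube generating data; its pairs `x > y` are reduced to the pairs `x < y` by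
reversing the paths. -/
theorem isCubeGeneratingData_lift (hidx : Set.InjOn idx (latticePoints P))
    (hd : IsCubeGeneratingData P prec γ e) (hf : IsAdmissible P γ e ζ f) :
    IsCubeGeneratingData (liftPolytope P ζ) (liftPrec P idx prec ζ) (liftGamma P idx γ ζ)
      (liftE P idx γ e ζ f) where
  polytope := h.isLatticePolytope_liftPolytope
  order := h.isMonomialOrder_liftPrec hidx hd.order
  gamma_symm x hx y hy hxy := by
    rcases h.liftLT_total hidx (x := ⟨x, hx⟩) (y := ⟨y, hy⟩) (fun e => hxy (congrArg Subtype.val e))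
      with h₁ | h₁
    · rw [liftGamma, liftGamma, if_pos h₁, if_neg (liftLT_asymm h₁)]
    · rw [liftGamma, liftGamma, if_pos h₁, if_neg (liftLT_asymm h₁)]
  sum_eq x hx y hy hxy := by
    rcases h.liftLT_total hidx (x := ⟨x, hx⟩) (y := ⟨y, hy⟩) (fun e => hxy (congrArg Subtype.val e))
      with h₁ | h₁
    · obtain ⟨N, m, w, hp⟩ := h.exists_isLiftedPath hd hf hx hy h₁
      simp only [cubeVertex, liftE, liftGamma, if_pos h₁]
      exact hp.sum_eq
    · obtain ⟨N, m, w, hp⟩ := h.exists_isLiftedPath hd hf hy hx h₁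
      simp only [cubeVertex, liftE, liftGamma, if_neg (liftLT_asymm h₁), Finset.sum_neg_distrib]
      rw [← sub_eq_add_neg, sub_eq_iff_eq_add]
      exact hp.sum_eq.symm
  vertex_mem x hx y hy hxy J hJ := by
    rcases h.liftLT_total hidx (x := ⟨x, hx⟩) (y := ⟨y, hy⟩) (fun e => hxy (congrArg Subtype.val e))
      with h₁ | h₁
    · obtain ⟨N, m, w, hp⟩ := h.exists_isLiftedPath hd hf hx hy h₁
      simp only [liftGamma, if_pos h₁] at hJ
      simp only [cubeVertex, liftE, if_pos h₁]
      exact hp.vertex_mem h hy hJ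
    · obtain ⟨N, m, w, hp⟩ := h.exists_isLiftedPath hd hf hy hx h₁
      simp only [liftGamma, if_neg (liftLT_asymm h₁)] at hJ
      simp only [cubeVertex, liftE, if_neg (liftLT_asymm h₁), Finset.sum_neg_distrib]
      have hs : y + ∑ l ∈ Finset.range (gammaLT P idx γ ζ y x + 1) \ J, eLT P idx γ e ζ f y x l =
          x + -∑ l ∈ J, eLT P idx γ e ζ f y x l := by
        nth_rewrite 3 [← hp.sum_eq]
        rw [← Finset.sum_sdiff hJ]
        abel
      rw [← hs]
      exact hp.vertex_mem h hx Finset.sdiff_subset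
  initial x y hxy J hJ hJ₀ x' y' hx' hy' := by
    rcases h.liftLT_total hidx hxy with h₁ | h₁
    · simp only [liftGamma, if_pos h₁] at hJ
      simp only [cubeVertex, liftE, if_pos h₁] at hx' hy'
      exact h.liftPrec_cube hd hf h₁ hJ hJ₀ hx' hy'
    · simp only [liftGamma, if_neg (liftLT_asymm h₁)] at hJ
      simp only [cubeVertex, liftE, if_neg (liftLT_asymm h₁), Finset.sum_neg_distrib,
        sub_neg_eq_add, ← sub_eq_add_neg] at hx' hy'
      rw [add_comm (Finsupp.single x' 1), add_comm (Finsupp.single x 1)]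
      exact h.liftPrec_cube hd hf h₁ hJ hJ₀ hy' hx'
  antisymm x hx y hy hxy l _ := by
    rcases h.liftLT_total hidx (x := ⟨x, hx⟩) (y := ⟨y, hy⟩) (fun e => hxy (congrArg Subtype.val e))
      with h₁ | h₁
    · simp only [liftE, if_pos h₁, if_neg (liftLT_asymm h₁)]
    · simp only [liftE, if_pos h₁, if_neg (liftLT_asymm h₁), neg_neg]

end IsLiftFunction

end LiftData

/-! ### Separating the heights by an additional current -/

section Graded

open MvPolynomial

variable {k : Type*} [Field k] {σ : Type*}

theorem aeval_mem_of_isWeightedHomogeneous {A M : Type*} [CommRing A] [Algebra k A]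
    [AddCommMonoid M] (𝒜 : M → Submodule k A) [SetLike.GradedMonoid 𝒜] (w : σ → M) (φ : σ → A)
    (hφ : ∀ v, φ v ∈ 𝒜 (w v)) {g : MvPolynomial σ k} {m : M} (hg : IsWeightedHomogeneous w g m) :
    aeval φ g ∈ 𝒜 m := by
  rw [aeval_def, eval₂_eq]
  refine Submodule.sum_mem _ fun d hd => ?_
  rw [← Algebra.smul_def]
  refine Submodule.smul_mem _ _ ?_
  rw [← hg (mem_support_iff.1 hd), Finsupp.weight_apply, Finsupp.sum]
  exact SetLike.prod_mem_graded 𝒜 _ _ fun i _ => SetLike.pow_mem_graded _ (hφ i)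

theorem isWeightedHomogeneous_map_weight {M N : Type*} [AddCommMonoid M] [AddCommMonoid N]
    (D : M →+ N) {w : σ → M} {g : MvPolynomial σ k} {m : M} (hg : IsWeightedHomogeneous w g m) :
    IsWeightedHomogeneous (fun v => D (w v)) g (D m) := fun d hd => by
  rw [← hg hd, Finsupp.weight_apply, Finsupp.weight_apply, map_finsuppSum]
  exact Finsupp.sum_congr fun i _ => (map_nsmul D _ _).symm

/-- A linear map vanishing on all components but one only sees this component. -/
theorem apply_eq_apply_component {V : Type*} [AddCommGroup V] [Module k V]
    (L : MvPolynomial (σ × ℕ) k →ₗ[k] V) (r : σ →₀ ℕ)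
    (h : ∀ s ≠ r, ∀ q, IsWeightedHomogeneous multiWeight q s → L q = 0)
    (p : MvPolynomial (σ × ℕ) k) : L p = L (weightedHomogeneousComponent multiWeight r p) := by
  classical
  induction p using MvPolynomial.induction_on' with
  | add p q hp hq => rw [map_add, map_add, map_add, hp, hq]
  | monomial m a =>
    have hm : IsWeightedHomogeneous multiWeight (monomial m a) (Finsupp.weight multiWeight m) :=
      isWeightedHomogeneous_monomial _ _ _ rfl
    rw [weightedHomogeneousComponent_of_mem hm]
    split_ifs with e
    · rfl
    · rw [map_zero, h _ (Ne.symm e) _ hm]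

/-- Components of the image under a linear map sending homogeneous elements to homogeneous
elements come from components of the source. -/
theorem exists_component_ne_zero {τ : Type*}
    (L : MvPolynomial (σ × ℕ) k →ₗ[k] MvPolynomial (τ × ℕ) k)
    (D : (σ →₀ ℕ) → (τ →₀ ℕ))
    (hL : ∀ r g, IsWeightedHomogeneous multiWeight g r →
      IsWeightedHomogeneous multiWeight (L g) (D r))
    {g : MvPolynomial (σ × ℕ) k} {s : τ →₀ ℕ}
    (hs : weightedHomogeneousComponent multiWeight s (L g) ≠ 0) :
    ∃ r, weightedHomogeneousComponent multiWeight r g ≠ 0 ∧ D r = s := by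
  classical
  by_contra! hne
  apply hs
  rw [g.as_sum, map_sum, map_sum]
  refine Finset.sum_eq_zero fun m hm => ?_
  have hm' : IsWeightedHomogeneous multiWeight (monomial m (coeff m g))
      (Finsupp.weight multiWeight m) := isWeightedHomogeneous_monomial _ _ _ rfl
  rw [weightedHomogeneousComponent_of_mem (hL _ _ hm'), if_neg]
  refine fun e => hne _ (fun h0 => mem_support_iff.1 hm ?_) e.symm
  have := congrArg (coeff m) h0
  rwa [coeff_weightedHomogeneousComponent, if_pos rfl, coeff_zero] at this

/-- The polynomials all of whose coefficients have multidegree `s`. -/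
def coeffComponent (k : Type*) [Field k] {σ : Type*} (s : σ →₀ ℕ) :
    Submodule k (MvPolynomial ℕ (MvPolynomial (σ × ℕ) k)) where
  carrier := {p | ∀ ν, coeff ν p ∈ multiComponent k s}
  add_mem' := fun hp hq ν => by
    rw [coeff_add]
    exact Submodule.add_mem _ (hp ν) (hq ν)
  zero_mem' := fun ν => by
    rw [coeff_zero]
    exact Submodule.zero_mem _
  smul_mem' := fun a p hp ν => by
    rw [coeff_smul]
    exact Submodule.smul_mem _ _ (hp ν)

instance : SetLike.GradedMonoid (coeffComponent k (σ := σ)) where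
  one_mem ν := by
    classical
    rw [coeff_one]
    split_ifs
    · exact isWeightedHomogeneous_one k _
    · exact Submodule.zero_mem _
  mul_mem s t p q hp hq ν := by
    classical
    rw [coeff_mul]
    exact Submodule.sum_mem _ fun x _ => IsWeightedHomogeneous.mul (hp _) (hq _)

instance : SetLike.GradedMonoid (weightedHomogeneousSubmodule k (multiWeight (σ := σ))) :=
  WeightedHomogeneousSubmodule.gradedMonoid

end Graded

section Separation

open MvPolynomial

variable {k : Type*} [Field k] {Q B : Type*}

/-- The homomorphism sending `X_x(s)` to `X_{base x}(s) z(s)^{ht x}`, where `z(s)` is a series with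
independent coefficients. -/
noncomputable def liftHom (k : Type*) [Field k] (base : Q → B) (ht : Q → ℕ) :
    MvPolynomial (Q × ℕ) k →ₐ[k] MvPolynomial ℕ (MvPolynomial (B × ℕ) k) :=
  aeval fun v => PowerSeries.coeff v.2 (PowerSeries.map C (current k (base v.1)) *
    (PowerSeries.mk fun j => X j) ^ ht v.1)

/-- The homomorphism regarding the series `z(s)` as one more current, with index `none`. -/
noncomputable def mergeHom (k : Type*) [Field k] (B : Type*) :
    MvPolynomial ℕ (MvPolynomial (B × ℕ) k) →ₐ[k] MvPolynomial (Option B × ℕ) k :=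
  aevalTower (rename (Prod.map some id)) fun j => X (none, j)

variable (base : Q → B) (ht : Q → ℕ)

theorem mergeHom_eq_sum (p : MvPolynomial ℕ (MvPolynomial (B × ℕ) k)) :
    mergeHom k B p = ∑ ν ∈ p.support,
      rename (Prod.map some id) (coeff ν p) * ∏ i ∈ ν.support, X (none, i) ^ ν i :=
  eval₂_eq _ _ _

theorem mergeHom_liftHom_X (x : Q) (j : ℕ) : mergeHom k B (liftHom k base ht (X (x, j))) =
    PowerSeries.coeff j (current k (some (base x)) * current k none ^ ht x) := by
  have h₁ : PowerSeries.map (mergeHom k B : MvPolynomial ℕ (MvPolynomial (B × ℕ) k) →+*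
      MvPolynomial (Option B × ℕ) k)
      (PowerSeries.map C (current k (base x))) = current k (some (base x)) := by
    ext j : 1
    rw [PowerSeries.coeff_map, PowerSeries.coeff_map, coeff_current, coeff_current]
    change mergeHom k B (C (X (base x, j))) = _
    rw [mergeHom, aevalTower_C, rename_X]
    rfl
  have h₂ : PowerSeries.map (mergeHom k B : MvPolynomial ℕ (MvPolynomial (B × ℕ) k) →+*
      MvPolynomial (Option B × ℕ) k)
      (PowerSeries.mk fun j => X j) = current k none := by
    ext j : 1
    rw [PowerSeries.coeff_map, PowerSeries.coeff_mk, coeff_current]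
    change mergeHom k B (X j) = _
    rw [mergeHom, aevalTower_X]
  rw [← h₁, ← h₂, ← map_pow, ← map_mul, PowerSeries.coeff_map, liftHom, aeval_X]
  rfl

/-- The multidegree of the image of a polynomial of multidegree `r` after separating heights. -/
noncomputable def liftDeg (base : Q → B) (ht : Q → ℕ) : (Q →₀ ℕ) →+ (Option B →₀ ℕ) :=
  Finsupp.weight fun x => Finsupp.single (some (base x)) 1 + Finsupp.single none (ht x)

theorem liftDeg_single (x : Q) : liftDeg base ht (Finsupp.single x 1) =
    Finsupp.single (some (base x)) 1 + Finsupp.single none (ht x) := by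
  rw [liftDeg, Finsupp.weight_single, one_smul]

theorem liftDeg_some (r : Q →₀ ℕ) (b : B) : liftDeg base ht r (some b) = r.mapDomain base b := by
  classical
  rw [liftDeg, Finsupp.weight_apply, Finsupp.mapDomain, Finsupp.sum_apply, Finsupp.sum_apply]
  refine Finsupp.sum_congr fun x _ => ?_
  simp [Finsupp.single_apply]

theorem isWeightedHomogeneous_coeff_current {σ : Type*} (x : σ) (j : ℕ) :
    IsWeightedHomogeneous multiWeight (PowerSeries.coeff j (current k x)) (Finsupp.single x 1) := by
  rw [coeff_current]
  exact isWeightedHomogeneous_X k _ _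

/-- The coefficients of a product of series with coefficients in two components of a graded ring lie
in the product component. -/
theorem coeff_mul_mem_graded {A M : Type*} [CommRing A] [Algebra k A]
    [AddCommMonoid M] (𝒜 : M → Submodule k A) [SetLike.GradedMonoid 𝒜] {m m' : M}
    {f g : PowerSeries A} (hf : ∀ j, PowerSeries.coeff j f ∈ 𝒜 m)
    (hg : ∀ j, PowerSeries.coeff j g ∈ 𝒜 m') (j : ℕ) :
    PowerSeries.coeff j (f * g) ∈ 𝒜 (m + m') := by
  rw [PowerSeries.coeff_mul]
  exact Submodule.sum_mem _ fun p _ => SetLike.mul_mem_graded (hf _) (hg _)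

theorem coeff_pow_mem_graded {A M : Type*} [CommRing A] [Algebra k A]
    [AddCommMonoid M] (𝒜 : M → Submodule k A) [SetLike.GradedMonoid 𝒜] {m : M}
    {f : PowerSeries A} (hf : ∀ j, PowerSeries.coeff j f ∈ 𝒜 m) (a j : ℕ) :
    PowerSeries.coeff j (f ^ a) ∈ 𝒜 (a • m) := by
  induction a generalizing j with
  | zero =>
    rw [pow_zero, zero_smul, PowerSeries.coeff_one]
    split_ifs
    · exact SetLike.one_mem_graded 𝒜
    · exact Submodule.zero_mem _
  | succ a ih =>
    rw [pow_succ, succ_nsmul]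
    exact coeff_mul_mem_graded 𝒜 ih hf j

theorem mergeHom_liftHom_isWeightedHomogeneous {r : Q →₀ ℕ} {g : MvPolynomial (Q × ℕ) k}
    (hg : IsWeightedHomogeneous multiWeight g r) :
    IsWeightedHomogeneous multiWeight (mergeHom k B (liftHom k base ht g)) (liftDeg base ht r) := by
  have e : (mergeHom k B).comp (liftHom k base ht) =
      aeval fun v => PowerSeries.coeff v.2 (current k (some (base v.1)) * current k none ^ ht v.1) := by
    refine algHom_ext fun v => ?_
    rw [aeval_X]
    exact mergeHom_liftHom_X base ht v.1 v.2
  rw [← AlgHom.comp_apply, e]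
  refine aeval_mem_of_isWeightedHomogeneous
    (weightedHomogeneousSubmodule k (multiWeight (σ := Option B))) _ _
    (fun v => ?_) (isWeightedHomogeneous_map_weight (liftDeg base ht) hg)
  rw [multiWeight, liftDeg_single]
  have := coeff_pow_mem_graded (weightedHomogeneousSubmodule k (multiWeight (σ := Option B)))
    (isWeightedHomogeneous_coeff_current (k := k) (none : Option B)) (ht v.1)
  rw [Finsupp.smul_single, smul_eq_mul, mul_one] at this
  exact coeff_mul_mem_graded (weightedHomogeneousSubmodule k (multiWeight (σ := Option B)))
    (isWeightedHomogeneous_coeff_current (some (base v.1))) this v.2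

theorem coeff_liftHom_isWeightedHomogeneous {r : Q →₀ ℕ} {g : MvPolynomial (Q × ℕ) k}
    (hg : IsWeightedHomogeneous multiWeight g r) (ν : ℕ →₀ ℕ) :
    IsWeightedHomogeneous multiWeight (coeff ν (liftHom k base ht g)) (r.mapDomain base) := by
  refine aeval_mem_of_isWeightedHomogeneous (coeffComponent k) _ _
    (fun v => ?_) (isWeightedHomogeneous_map_weight (Finsupp.mapDomain.addMonoidHom base) hg) ν
  rw [multiWeight, Finsupp.mapDomain.addMonoidHom_apply, Finsupp.mapDomain_single,
    ← add_zero (Finsupp.single (base v.1) 1)]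
  refine coeff_mul_mem_graded (coeffComponent k) (fun j ν => ?_) (fun j => ?_) v.2
  · classical
    rw [PowerSeries.coeff_map, coeff_C]
    split_ifs
    · exact isWeightedHomogeneous_coeff_current _ _
    · exact Submodule.zero_mem _
  · rw [← smul_zero (ht v.1)]
    refine coeff_pow_mem_graded (coeffComponent k) (fun j ν => ?_) _ j
    classical
    rw [PowerSeries.coeff_mk, coeff_X]
    split_ifs
    · exact isWeightedHomogeneous_one k _
    · exact Submodule.zero_mem _

theorem rename_some_isWeightedHomogeneous {s : B →₀ ℕ} {g : MvPolynomial (B × ℕ) k}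
    (hg : IsWeightedHomogeneous multiWeight g s) :
    IsWeightedHomogeneous multiWeight (rename (Prod.map some id) g : MvPolynomial (Option B × ℕ) k)
      (s.mapDomain some) := by
  have e : rename (Prod.map some id) =
      aeval (R := k) fun v : B × ℕ => (X (some v.1, v.2) : MvPolynomial (Option B × ℕ) k) :=
    algHom_ext fun v => by rw [rename_X, aeval_X]; rfl
  rw [e]
  refine aeval_mem_of_isWeightedHomogeneous
    (weightedHomogeneousSubmodule k (multiWeight (σ := Option B))) _ _
    (fun v => ?_) (isWeightedHomogeneous_map_weight (Finsupp.mapDomain.addMonoidHom some) hg)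
  rw [multiWeight, Finsupp.mapDomain.addMonoidHom_apply, Finsupp.mapDomain_single]
  exact isWeightedHomogeneous_X k _ _

/-- Extension of the exponents `γ` by zero to the color of the additional current. -/
def optionGamma (γ : B → B → ℕ) : Option B → Option B → ℕ
  | some u, some v => γ u v
  | _, _ => 0

theorem rename_some_mem_diagIdeal {γ : B → B → ℕ} {g : MvPolynomial (B × ℕ) k}
    (hg : g ∈ diagIdeal k γ) :
    (rename (Prod.map some id) g : MvPolynomial (Option B × ℕ) k) ∈
      diagIdeal k (optionGamma γ) := by
  suffices h : diagIdeal k γ ≤ (diagIdeal k (optionGamma γ)).comap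
      (rename (Prod.map some id) : MvPolynomial (B × ℕ) k →ₐ[k] MvPolynomial (Option B × ℕ) k) from
    h hg
  refine Ideal.span_le.2 ?_
  rintro _ ⟨x, y, hxy, l, hl, d, rfl⟩
  refine Ideal.subset_span ⟨some x, some y, fun e => hxy (Option.some_injective _ e), l, hl, d, ?_⟩
  change rename _ _ = _
  simp [quadCoeff_eq_sum, map_sum, rename_X]

end Separation

/-! ### Functionals with prescribed symbols -/

section LiftedFunctional

open MvPolynomial

variable {k : Type*} [Field k] {ι : Type*} [Fintype ι] {Q B : Type*}

omit [Fintype ι] in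
/-- A product of differences does not depend, up to a nonzero constant, on the order used to select
one of the two differences of every pair. -/
theorem exists_prod_pairs_eq_C_mul [DecidableEq ι] (S T : Finset (ι × ι))
    (G : ι × ι → MvPolynomial ι k) (hG : ∀ p, ∃ u : k, u ≠ 0 ∧ G p = C u * G p.swap)
    (hS : ∀ p ∈ S, p.swap ∉ S) (hT : ∀ p ∈ T, p.swap ∉ T)
    (hST : ∀ p ∈ S, p ∈ T ∨ p.swap ∈ T) (hTS : ∀ p ∈ T, p ∈ S ∨ p.swap ∈ S) :
    ∃ u : k, u ≠ 0 ∧ ∏ p ∈ S, G p = C u * ∏ p ∈ T, G p := by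
  have hb : ∏ p ∈ S, G (if p ∈ T then p else p.swap) = ∏ p ∈ T, G p := by
    refine Finset.prod_bij' (fun p _ => if p ∈ T then p else p.swap)
      (fun p _ => if p ∈ S then p else p.swap) ?_ ?_ ?_ ?_ (fun _ _ => rfl)
    · intro p hp
      split_ifs with h
      · exact h
      · exact (hST p hp).resolve_left h
    · intro p hp
      split_ifs with h
      · exact h
      · exact (hTS p hp).resolve_left h
    · intro p hp
      split_ifs with h h'
      · rfl
      · exact absurd h' (hS p hp)
      · exact Prod.swap_swap p
    · intro p hp
      split_ifs with h h'
      · rfl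
      · exact absurd h' (hT p hp)
      · exact Prod.swap_swap p
  rw [← hb]
  refine exists_prod_eq_C_mul S _ _ fun p _ => ?_
  split_ifs
  · exact ⟨1, one_ne_zero, by rw [C_1, one_mul]⟩
  · exact hG p

open Classical in
theorem diffProd_eq_prod_filter (c : ι → Q) (R : Q → Q → Prop) (γ : Q → Q → ℕ) :
    diffProd k c R γ = ∏ p : ι × ι with R (c p.1) (c p.2),
      (X p.1 - X p.2) ^ γ (c p.1) (c p.2) := by
  rw [diffProd, Finset.prod_filter, Fintype.prod_prod_type]

/-- The product of differences with the exponents `γ` of the bases is, up to a nonzero constant, the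
same for the order of the points as for the order of the bases. -/
theorem exists_diffProd_comp_eq_C_mul [LinearOrder Q] (base : Q → B) (rank : B → ℕ)
    (γ : B → B → ℕ) (hγ : ∀ u v, u ≠ v → γ u v = γ v u)
    (c : ι → Q) (γ' : Q → Q → ℕ)
    (hγ' : ∀ x y, γ' x y = if rank (base x) = rank (base y) then 0 else γ (base x) (base y)) :
    ∃ u : k, u ≠ 0 ∧ diffProd k (base ∘ c) (fun u v => rank u < rank v) γ =
      C u * diffProd k c (· < ·) γ' := by
  classical
  let G : ι × ι → MvPolynomial ι k := fun p => (X p.1 - X p.2) ^ γ' (c p.1) (c p.2)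
  let S : Finset (ι × ι) := Finset.univ.filter fun p => rank (base (c p.1)) < rank (base (c p.2))
  let T : Finset (ι × ι) := Finset.univ.filter fun p =>
    c p.1 < c p.2 ∧ rank (base (c p.1)) ≠ rank (base (c p.2))
  have e₁ : diffProd k (base ∘ c) (fun u v => rank u < rank v) γ = ∏ p ∈ S, G p := by
    rw [diffProd_eq_prod_filter]
    refine Finset.prod_congr (by ext p; simp [S]) fun p hp => ?_
    have h : rank (base (c p.1)) < rank (base (c p.2)) := (Finset.mem_filter.1 hp).2
    simp only [G, hγ', if_neg h.ne, Function.comp_apply]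
  have e₂ : diffProd k c (· < ·) γ' = ∏ p ∈ T, G p := by
    rw [diffProd_eq_prod_filter, eq_comm]
    refine Finset.prod_subset (fun p hp => by
      simp only [T, Finset.mem_filter] at hp ⊢
      exact ⟨hp.1, hp.2.1⟩)
      fun p hp hp' => ?_
    have h : c p.1 < c p.2 := by simpa using hp
    have h' : rank (base (c p.1)) = rank (base (c p.2)) := by
      by_contra hne
      exact hp' (Finset.mem_filter.2 ⟨Finset.mem_univ _, h, hne⟩)
    change ((X p.1 : MvPolynomial ι k) - X p.2) ^ γ' (c p.1) (c p.2) = 1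
    rw [hγ', if_pos h', pow_zero]
  rw [e₁, e₂]
  refine exists_prod_pairs_eq_C_mul S T G (fun p => ?_) ?_ ?_ ?_ ?_
  · refine ⟨(-1) ^ γ' (c p.1) (c p.2), pow_ne_zero _ (neg_ne_zero.2 one_ne_zero), ?_⟩
    have h : γ' (c p.2) (c p.1) = γ' (c p.1) (c p.2) := by
      rw [hγ', hγ']
      by_cases h : rank (base (c p.1)) = rank (base (c p.2))
      · rw [if_pos h, if_pos h.symm]
      · rw [if_neg h, if_neg (Ne.symm h), hγ _ _ fun e => h (congrArg rank e)]
    simp only [G, Prod.fst_swap, Prod.snd_swap, h]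
    rw [C_pow, C_neg, C_1, ← mul_pow, neg_one_mul, neg_sub]
  · intro p hp hp'
    simp only [S, Finset.mem_filter, Finset.mem_univ, true_and, Prod.fst_swap, Prod.snd_swap]
      at hp hp'
    omega
  · intro p hp hp'
    simp only [T, Finset.mem_filter, Finset.mem_univ, true_and, Prod.fst_swap, Prod.snd_swap]
      at hp hp'
    exact lt_asymm hp.1 hp'.1
  · intro p hp
    simp only [S, T, Finset.mem_filter, Finset.mem_univ, true_and, Prod.fst_swap, Prod.snd_swap]
      at hp ⊢
    rcases lt_trichotomy (c p.1) (c p.2) with h | h | h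
    · exact Or.inl ⟨h, hp.ne⟩
    · rw [h] at hp
      exact absurd hp (lt_irrefl _)
    · exact Or.inr ⟨h, hp.ne'⟩
  · intro p hp
    simp only [S, T, Finset.mem_filter, Finset.mem_univ, true_and, Prod.fst_swap, Prod.snd_swap]
      at hp ⊢
    omega

theorem diffProd_add (c : ι → Q) (R : Q → Q → Prop) (γ γ' : Q → Q → ℕ) :
    diffProd k c R (fun x y => γ x y + γ' x y) = diffProd k c R γ * diffProd k c R γ' := by
  simp only [diffProd, ← Finset.prod_mul_distrib]
  refine Finset.prod_congr rfl fun i _ => Finset.prod_congr rfl fun j _ => ?_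
  split_ifs
  · exact pow_add _ _ _
  · exact (one_mul _).symm

theorem dvd_diffProd (c : ι → B) (rank : B → ℕ) (hrank : Function.Injective rank)
    (γ : B → B → ℕ) (hγ : ∀ u v, u ≠ v → γ u v = γ v u) {i j : ι} (hij : c i ≠ c j) :
    (X i - X j) ^ γ (c i) (c j) ∣ diffProd k c (fun u v => rank u < rank v) γ := by
  classical
  have key : ∀ i j : ι, rank (c i) < rank (c j) →
      (X i - X j) ^ γ (c i) (c j) ∣ diffProd k c (fun u v => rank u < rank v) γ := by
    intro i j h
    refine Dvd.dvd.trans ?_ (Finset.dvd_prod_of_mem _ (Finset.mem_univ i))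
    refine Dvd.dvd.trans ?_ (Finset.dvd_prod_of_mem _ (Finset.mem_univ j))
    rw [if_pos h]
  rcases lt_or_gt_of_ne fun e => hij (hrank e) with h | h
  · exact key i j h
  · have h' := key j i h
    rwa [← neg_sub (X i : MvPolynomial ι k), neg_pow, hγ _ _ hij.symm,
      (isUnit_one.neg.pow _).mul_left_dvd] at h'

theorem exists_sumCongr_of_comp_eq {U : Type*} [Fintype U] (b : ι → B)
    (π : Equiv.Perm (ι ⊕ U))
    (hπ : Sum.elim (some ∘ b) (fun _ => none) ∘ π = Sum.elim (some ∘ b) fun _ => none) :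
    ∃ (α : Equiv.Perm ι) (τ : Equiv.Perm U), b ∘ α = b ∧ ⇑π = Sum.map α τ := by
  have h : Set.MapsTo π (Set.range Sum.inl) (Set.range Sum.inl) := by
    rintro _ ⟨i, rfl⟩
    have := congrFun hπ (Sum.inl i)
    rcases hi : π (Sum.inl i) with j | u
    · exact ⟨j, rfl⟩
    · simp [hi] at this
  obtain ⟨⟨α, τ⟩, rfl⟩ := Equiv.Perm.mem_sumCongrHom_range_of_perm_mapsTo_inl h
  refine ⟨α, τ, funext fun i => ?_, rfl⟩
  have := congrFun hπ (Sum.inl i)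
  exact Option.some_injective _ this

variable {base : Q → B} {ht : Q → ℕ} {floor : Q → B → ℕ}

/-- The symbol, at a coloring `c'` with the same bases as `c`, of the functional obtained from `K` by
separating the heights: the variables of the additional current are specialized to the variables
`t_i`, each of them repeated `ht (c' i)` times. -/
theorem apply_mergeHom_liftHom_slotMon {U : Type*} [Fintype U] (c : ι → Q)
    {K : MvPolynomial (ι ⊕ U) k}
    (hK : IsColorSymm (Sum.elim (some ∘ base ∘ c) fun _ => none) K)
    (c' : ι → Q) (hc' : base ∘ c' = base ∘ c) [DecidableEq ι] (ρ : U → ι)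
    (hρ : ∀ p, (Finset.univ.filter fun u => ρ u = p).card = ht (c' p)) (κ : ι →₀ ℕ) :
    symFunctional (Sum.elim (some ∘ base ∘ c) fun _ => none) K
      (mergeHom k B (liftHom k base ht (slotMon k c' κ))) =
      coeff κ (rename (Sum.elim id ρ) K) := by
  rw [← apply_prod_coeff_eq_coeff_rename
    (symFunctional (Sum.elim (some ∘ base ∘ c) fun _ => none) K)
    (fun q => current k (Sum.elim (some ∘ base ∘ c) (fun _ => none) q)) K
    (fun l => by
      rw [← symFunctional_slotMon hK]
      simp only [coeff_current]
      rfl)]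
  congr 1
  rw [slotMon, map_prod, map_prod]
  refine Finset.prod_congr rfl fun i _ => ?_
  rw [mergeHom_liftHom_X, Finset.prod_filter, Fintype.prod_sum_type]
  change _ = PowerSeries.coeff (κ i)
    ((∏ j, if j = i then current k (some (base (c j))) else 1) *
      ∏ u, if ρ u = i then current k none else 1)
  rw [Finset.prod_ite_eq', if_pos (Finset.mem_univ i), ← Finset.prod_filter, Finset.prod_const, hρ,
    show base (c' i) = base (c i) from congrFun hc' i]

theorem colorDeg_sum_elim_eq_liftDeg (c : ι → Q) :
    colorDeg (Sum.elim (some ∘ base ∘ c) fun _ : Σ i, Fin (ht (c i)) => none) =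
      liftDeg base ht (colorDeg c) := by
  simp only [colorDeg, map_sum, liftDeg_single, Fintype.sum_sum_type, Sum.elim_inl, Sum.elim_inr,
    Function.comp_apply, Finset.sum_add_distrib]
  rw [Fintype.sum_sigma]
  simp

theorem card_filter_sigma_fst [DecidableEq ι] (a : ι → ℕ) (p : ι) :
    (Finset.univ.filter fun u : Σ i, Fin (a i) => u.1 = p).card = a p := by
  rw [← Fintype.card_subtype, Fintype.card_congr (Equiv.sigmaSubtype p), Fintype.card_fin]

/-- For a symmetric polynomial `f` there is a functional, after separating the heights, which
annihilates the quadratic relations of the bases, vanishes on smaller multidegrees with the same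
projection, and has the symbol `f` times the product of differences. -/
theorem exists_separated_functional [CharZero k] [LinearOrder Q] (hQ : IsColumnOrder base ht floor)
    (rank : B → ℕ) (hrank : Function.Injective rank) (γ : B → B → ℕ)
    (hγ : ∀ u v, u ≠ v → γ u v = γ v u) (c : ι → Q) [LinearOrder ι] (hc : Monotone c)
    {f : MvPolynomial ι k} (hf : IsColorSymm c f) (γ' : Q → Q → ℕ)
    (hγ' : ∀ x y, γ' x y = if rank (base x) = rank (base y) then 0 else γ (base x) (base y)) :
    ∃ ω : MvPolynomial (Option B × ℕ) k →ₗ[k] k,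
      (∀ s ≠ liftDeg base ht (colorDeg c), ∀ g, IsWeightedHomogeneous multiWeight g s → ω g = 0) ∧
      (∀ g ∈ diagIdeal k (optionGamma γ), ω g = 0) ∧
      (∀ c' : ι → Q, base ∘ c' = base ∘ c → ColorLT c' c → ∀ κ,
        ω (mergeHom k B (liftHom k base ht (slotMon k c' κ))) = 0) ∧
      ∀ κ, ω (mergeHom k B (liftHom k base ht (slotMon k c κ))) =
        coeff κ (diffProd k c (· < ·) (fun x y => γ' x y + columnExp base ht floor x y) * f) := by
  classical
  obtain ⟨u, hu, hΓ⟩ := exists_diffProd_comp_eq_C_mul (k := k) base rank γ hγ c γ' hγ'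
  set Γ := diffProd k (base ∘ c) (fun u v => rank u < rank v) γ with hΓ'
  obtain ⟨K, hK₁, hK₂, hK₃, hK₄⟩ := exists_specialization (U := Σ i, Fin (ht (c i))) hQ c hc f hf
  set c₂ : ι ⊕ (Σ i, Fin (ht (c i))) → Option B :=
    Sum.elim (some ∘ base ∘ c) fun _ => none with hc₂
  have hev : ∀ ρ : (Σ i, Fin (ht (c i))) → ι,
      rename (Sum.elim id ρ) (rename Sum.inl Γ * K) = Γ * rename (Sum.elim id ρ) K := by
    intro ρ
    rw [map_mul, rename_rename, Sum.elim_comp_inl, rename_id_apply]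
  have hsymm : IsColorSymm c₂ (rename Sum.inl Γ * K) := by
    intro π hπ
    obtain ⟨α, τ, hα, hπ'⟩ := exists_sumCongr_of_comp_eq (base ∘ c) π hπ
    have e : Sum.map α τ = Sum.map (id : ι → ι) τ ∘ Sum.map α id := by
      rw [Sum.map_comp_map, Function.id_comp, Function.comp_id]
    rw [hπ', map_mul]
    congr 1
    · rw [rename_rename, show Sum.map α τ ∘ Sum.inl = Sum.inl ∘ α from rfl, ← rename_rename,
        diffProd_symm _ _ _ α hα]
    · rw [e, ← rename_rename, hK₁ α hα, hK₂]
  have hdvd : ∀ i j, c₂ i ≠ c₂ j →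
      (X i - X j) ^ optionGamma γ (c₂ i) (c₂ j) ∣ rename Sum.inl Γ * K := by
    rintro (i | i) (j | j) hij
    · refine Dvd.dvd.mul_right ?_ K
      have h := dvd_diffProd (k := k) (base ∘ c) rank hrank γ hγ (i := i) (j := j)
        fun e => hij (congrArg some e)
      have := map_dvd (rename (Sum.inl : ι → ι ⊕ (Σ i, Fin (ht (c i))))) h
      rwa [map_pow, map_sub, rename_X, rename_X] at this
    · exact one_dvd _
    · exact one_dvd _
    · exact one_dvd _
  refine ⟨u⁻¹ • symFunctional c₂ (rename Sum.inl Γ * K), ?_, ?_, ?_, ?_⟩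
  · intro s hs g hg
    rw [LinearMap.smul_apply,
      symFunctional_eq_zero _ (by rwa [colorDeg_sum_elim_eq_liftDeg]) hg, smul_zero]
  · intro g hg
    rw [LinearMap.smul_apply, symFunctional_eq_zero_of_mem_diagIdeal hsymm hdvd hg, smul_zero]
  · intro c' hc' hlt κ
    rw [LinearMap.smul_apply]
    -- for a different total height the degree in the additional current does not match
    by_cases hsum : ∑ i, ht (c' i) = ∑ i, ht (c i)
    · have e : (Σ i, Fin (ht (c i))) ≃ Σ i, Fin (ht (c' i)) :=
        Fintype.equivOfCardEq (by simp [hsum])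
      have hρ : ∀ p, (Finset.univ.filter fun v => (e v).1 = p).card = ht (c' p) := by
        intro p
        rw [← card_filter_sigma_fst (fun i => ht (c' i)) p]
        exact Finset.card_bij' (fun v _ => e v) (fun v _ => e.symm v) (by simp) (by simp) (by simp)
          (by simp)
      rw [apply_mergeHom_liftHom_slotMon c hsymm c' hc' (fun v => (e v).1) hρ, hev,
        hK₃ c' _ hc' hlt hρ, mul_zero, coeff_zero, smul_zero]
    · rw [symFunctional_eq_zero (r := liftDeg base ht (colorDeg c')), smul_zero]
      · rw [colorDeg_sum_elim_eq_liftDeg]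
        intro e
        apply hsum
        have := DFunLike.congr_fun e none
        simpa [colorDeg, map_sum, liftDeg_single, Finsupp.finsetSum_apply] using this
      · refine mergeHom_liftHom_isWeightedHomogeneous base ht ?_
        rw [slotMon_eq_monomial]
        exact isWeightedHomogeneous_monomial _ _ _ (weight_slotExp c' κ)
  · intro κ
    rw [LinearMap.smul_apply, apply_mergeHom_liftHom_slotMon c hsymm c rfl Sigma.fst
      (card_filter_sigma_fst _), hev, hK₄ _ (card_filter_sigma_fst _), hΓ, diffProd_add,
      mul_assoc, coeff_C_mul, smul_eq_mul, inv_mul_cancel_left₀ hu, mul_assoc]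

end LiftedFunctional

/-! ### The toric ring of the lifted polytope -/

section LiftedToric

open MvPolynomial

variable {k : Type*} [Field k] {n : ℕ} {P : Set (Fin n → ℝ)} {ζ : (Fin n → ℝ) → ℝ}

theorem mem_coneMonoid_iff {P : Set (Fin n → ℝ)} {z : (Fin n → ℤ) × ℤ} :
    z ∈ coneMonoid P ↔ (toReal z.1, (z.2 : ℝ)) ∈ polytopeCone P := Iff.rfl

namespace IsLiftFunction

variable (h : IsLiftFunction P ζ)
include h

theorem last_nonneg {z : Fin (n + 1) → ℝ} (hz : z ∈ liftPolytope P ζ) : 0 ≤ z (Fin.last n) := by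
  have hconv : Convex ℝ {z : Fin (n + 1) → ℝ | 0 ≤ z (Fin.last n)} := by
    intro z hz w hw a b ha hb _
    exact add_nonneg (mul_nonneg ha hz) (mul_nonneg hb hw)
  refine convexHull_min ?_ hconv hz
  rintro _ (⟨x, -, rfl⟩ | ⟨x, hx, rfl⟩)
  · simpa using h.zetaMax_nonneg
  · simpa using h.floorHeight_nonneg hx

theorem mem_polytopeCone_of_lift {a : (Fin (n + 1) → ℝ) × ℝ}
    (ha : a ∈ polytopeCone (liftPolytope P ζ)) :
    ((fun i : Fin n => a.1 i.castSucc), a.2) ∈ polytopeCone P ∧ 0 ≤ a.1 (Fin.last n) := by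
  refine Submodule.span_induction (p := fun a _ =>
    ((fun i : Fin n => a.1 i.castSucc), a.2) ∈ polytopeCone P ∧ 0 ≤ a.1 (Fin.last n))
    ?_ ?_ ?_ ?_ ha
  · rintro _ ⟨z, hz, rfl⟩
    exact ⟨Submodule.subset_span ⟨_, (h.liftPolytope_subset hz).1, rfl⟩, h.last_nonneg hz⟩
  · exact ⟨Submodule.zero_mem _, le_rfl⟩
  · rintro a b - - ⟨h₁, h₂⟩ ⟨h₃, h₄⟩
    exact ⟨Submodule.add_mem _ h₁ h₃, add_nonneg h₂ h₄⟩
  · rintro c a - ⟨h₁, h₂⟩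
    exact ⟨Submodule.smul_mem _ c h₁, mul_nonneg c.2 h₂⟩

theorem base_mem_coneMonoid {z : (Fin (n + 1) → ℤ) × ℤ} (hz : z ∈ coneMonoid (liftPolytope P ζ)) :
    (base z.1, z.2) ∈ coneMonoid P :=
  mem_coneMonoid_iff.2 (h.mem_polytopeCone_of_lift (mem_coneMonoid_iff.1 hz)).1

theorem height_nonneg_of_mem_coneMonoid {z : (Fin (n + 1) → ℤ) × ℤ}
    (hz : z ∈ coneMonoid (liftPolytope P ζ)) : 0 ≤ height z.1 := by
  have h' : (0 : ℝ) ≤ height z.1 := (h.mem_polytopeCone_of_lift (mem_coneMonoid_iff.1 hz)).2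
  exact_mod_cast h'

variable (k)

/-- The arc of `R(P^ζ)` given by the universal arc of `R(P)` and an independent series substituted
for the last coordinate. -/
noncomputable def liftedArc : ToricRing k (liftPolytope P ζ) →ₐ[k]
    PowerSeries (MvPolynomial ℕ (ReducedArcRing k (ToricRing k P))) :=
  AddMonoidAlgebra.lift k _ (coneMonoid (liftPolytope P ζ))
    { toFun := fun z => PowerSeries.map C (arc k (AddMonoidAlgebra.single
        (⟨(base z.toAdd.1.1, z.toAdd.1.2), h.base_mem_coneMonoid z.toAdd.2⟩ : coneMonoid P) 1)) *
          (PowerSeries.mk fun j => X j) ^ (height z.toAdd.1.1).toNat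
      map_one' := by
        change PowerSeries.map C (arc k (1 : ToricRing k P)) * _ ^ Int.toNat 0 = _
        rw [arc_one, map_one, one_mul, Int.toNat_zero, pow_zero]
      map_mul' := fun z w => by
        have e : (height (z * w).toAdd.1.1).toNat =
            (height z.toAdd.1.1).toNat + (height w.toAdd.1.1).toNat :=
          Int.toNat_add (h.height_nonneg_of_mem_coneMonoid z.toAdd.2)
            (h.height_nonneg_of_mem_coneMonoid w.toAdd.2)
        have e' : (AddMonoidAlgebra.single (⟨(base (z * w).toAdd.1.1, (z * w).toAdd.1.2),
            h.base_mem_coneMonoid (z * w).toAdd.2⟩ : coneMonoid P) 1 : ToricRing k P) =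
            AddMonoidAlgebra.single (⟨(base z.toAdd.1.1, z.toAdd.1.2),
              h.base_mem_coneMonoid z.toAdd.2⟩ : coneMonoid P) 1 *
            AddMonoidAlgebra.single (⟨(base w.toAdd.1.1, w.toAdd.1.2),
              h.base_mem_coneMonoid w.toAdd.2⟩ : coneMonoid P) 1 := by
          rw [AddMonoidAlgebra.single_mul_single, one_mul]
          rfl
        rw [e, e', arc_mul, map_mul, pow_add]
        ring }

theorem liftedArc_toricY (x : latticePoints (liftPolytope P ζ)) :
    h.liftedArc k (toricY k _ x) = PowerSeries.map C (arc k (toricY k P (h.basePoint x))) *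
      (PowerSeries.mk fun j => X j) ^ (height (x : Fin (n + 1) → ℤ)).toNat := by
  rw [liftedArc, toricY, AddMonoidAlgebra.lift_single, one_smul]
  rfl

/-- Relations in the arc ring of the lifted polytope give relations in the arc ring of `P` after
separating the heights. -/
theorem coeff_liftHom_mem_definingIdeal {g : MvPolynomial (latticePoints (liftPolytope P ζ) × ℕ) k}
    (hg : g ∈ definingIdeal k (liftPolytope P ζ)) (ν : ℕ →₀ ℕ) :
    coeff ν (liftHom k h.basePoint (fun x => (height (x : Fin (n + 1) → ℤ)).toNat) g) ∈
      definingIdeal k P := by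
  obtain ⟨ψ, hψ⟩ := exists_algHom_of_arc (h.liftedArc k)
  have e : ψ.comp (toricProj k (liftPolytope P ζ)) = (mapAlgHom (toricProj k P)).comp
      (liftHom k h.basePoint fun x => (height (x : Fin (n + 1) → ℤ)).toNat) := by
    refine algHom_ext fun v => ?_
    have h₁ : PowerSeries.map (mapAlgHom (σ := ℕ) (toricProj k P) :
          MvPolynomial ℕ (MvPolynomial (latticePoints P × ℕ) k) →+*
            MvPolynomial ℕ (ReducedArcRing k (ToricRing k P)))
          (PowerSeries.map C (current k (h.basePoint v.1))) =
        PowerSeries.map C (arc k (toricY k P (h.basePoint v.1))) := by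
      rw [← map_toricProj_current]
      ext j : 1
      rw [PowerSeries.coeff_map, PowerSeries.coeff_map, PowerSeries.coeff_map,
        PowerSeries.coeff_map]
      exact map_C _ _
    have h₂ : PowerSeries.map (mapAlgHom (σ := ℕ) (toricProj k P) :
          MvPolynomial ℕ (MvPolynomial (latticePoints P × ℕ) k) →+*
            MvPolynomial ℕ (ReducedArcRing k (ToricRing k P)))
          (PowerSeries.mk fun j => X j) = PowerSeries.mk fun j => X j := by
      ext j : 1
      rw [PowerSeries.coeff_map, PowerSeries.coeff_mk, PowerSeries.coeff_mk]
      exact map_X _ _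
    rw [AlgHom.comp_apply, AlgHom.comp_apply, toricProj, aeval_X, hψ, liftedArc_toricY, ← h₁,
      ← h₂, ← map_pow, ← map_mul, PowerSeries.coeff_map, liftHom, aeval_X]
    rfl
  have h0 : mapAlgHom (toricProj k P)
      (liftHom k h.basePoint (fun x => (height (x : Fin (n + 1) → ℤ)).toNat) g) = 0 := by
    rw [← AlgHom.comp_apply, ← e, AlgHom.comp_apply, show toricProj k _ g = 0 from hg, map_zero]
  have := congrArg (coeff ν) h0
  rw [coeff_zero] at this
  rw [definingIdeal, RingHom.mem_ker, ← this]
  exact (coeff_map _ _ _).symm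

end IsLiftFunction

end LiftedToric

/-! ### The column order of the lifted points -/

section ColumnOrder

variable {n : ℕ} {P : Set (Fin n → ℝ)} {ζ : (Fin n → ℝ) → ℝ} {idx : (Fin n → ℤ) → ℕ}

/-- The order on the integer points of the lifted polytope. -/
noncomputable abbrev IsLiftFunction.linearOrder (h : IsLiftFunction P ζ)
    (hidx : Set.InjOn idx (latticePoints P)) : LinearOrder (latticePoints (liftPolytope P ζ)) :=
  LinearOrder.lift' (fun x => toLex (height x.1, idx (base x.1))) fun x y hxy => by
    have h₁ : height x.1 = height y.1 := congrArg (fun p => (ofLex p).1) hxy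
    have h₂ : idx (base x.1) = idx (base y.1) := congrArg (fun p => (ofLex p).2) hxy
    exact Subtype.ext (ext_base_height (hidx (h.base_mem x) (h.base_mem y) h₂) h₁)

theorem IsLiftFunction.linearOrder_lt_iff (h : IsLiftFunction P ζ)
    (hidx : Set.InjOn idx (latticePoints P)) (x y : latticePoints (liftPolytope P ζ)) :
    (h.linearOrder hidx).lt x y ↔ liftLT idx x.1 y.1 :=
  Prod.Lex.lt_iff

/-- The smallest height over `b` of a point that is not smaller than `x`. -/
noncomputable def liftFloor (P : Set (Fin n → ℝ)) (ζ : (Fin n → ℝ) → ℝ) (idx : (Fin n → ℤ) → ℕ)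
    (x : latticePoints (liftPolytope P ζ)) (b : latticePoints P) : ℕ :=
  (max (floorHeight P ζ b) (height x.1 + if idx b < idx (base x.1) then 1 else 0)).toNat

theorem IsLiftFunction.isColumnOrder (h : IsLiftFunction P ζ)
    (hidx : Set.InjOn idx (latticePoints P)) :
    @IsColumnOrder _ _ (h.linearOrder hidx) h.basePoint (fun x => (height x.1).toNat)
      (liftFloor P ζ idx) := by
  have hb : ∀ x, ((h.basePoint x : latticePoints P) : Fin n → ℤ) = base x.1 := fun _ => rfl
  refine @IsColumnOrder.mk _ _ (h.linearOrder hidx) _ _ _ (fun x p hxp => ?_) (fun x => ?_)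
    (fun x y h₁ h₂ => ?_) (fun x p hxp hbase => ?_)
  · have hp := h.floorHeight_le p
    rw [liftFloor, hb]
    rcases @eq_or_lt_of_le _ (h.linearOrder hidx).toPartialOrder x p hxp with rfl | hlt
    · rw [if_neg (lt_irrefl _)]
      omega
    · have := (h.linearOrder_lt_iff hidx x p).1 hlt
      rw [liftLT] at this
      split_ifs <;> omega
  · have hp := h.floorHeight_le x
    rw [liftFloor, hb, if_neg (lt_irrefl _)]
    omega
  · have h₃ := h.height_nonneg x
    have h₄ := h.height_nonneg y
    exact h.ext_basePoint h₁ (by omega)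
  · have hp := h.floorHeight_le x
    have h₃ := h.height_nonneg x
    have hbase : base x.1 = base p.1 := congrArg Subtype.val hbase
    have := (h.linearOrder_lt_iff hidx x p).1 hxp
    rw [liftLT, hbase] at this
    rw [hbase] at hp
    rw [liftFloor, hb, hbase, if_neg (lt_irrefl _)]
    omega

/-- The exponents supplied by the heights are the increments `ϰ` of the lifted data. -/
theorem IsLiftFunction.columnExp_eq_kappa (h : IsLiftFunction P ζ)
    (hidx : Set.InjOn idx (latticePoints P)) {x p : latticePoints (liftPolytope P ζ)}
    (hxp : liftLT idx x.1 p.1) :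
    columnExp h.basePoint (fun x => (height x.1).toNat) (liftFloor P ζ idx) x p =
      (kappa P idx ζ x.1 p.1).toNat := by
  have hx := h.floorHeight_le x
  have hp := h.floorHeight_le p
  have hx₀ := h.height_nonneg x
  have hp₀ := h.floorHeight_nonneg (h.base_mem p)
  have hb : ∀ x, ((h.basePoint x : latticePoints P) : Fin n → ℤ) = base x.1 := fun _ => rfl
  have hiff : h.basePoint x = h.basePoint p ↔ idx (base x.1) = idx (base p.1) :=
    ⟨fun e => congrArg (fun b => idx b.1) e,
      fun e => Subtype.ext (hidx (h.base_mem x) (h.base_mem p) e)⟩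
  have hfl : idx (base x.1) = idx (base p.1) →
      floorHeight P ζ (base x.1) = floorHeight P ζ (base p.1) := fun e => by
    rw [hidx (h.base_mem x) (h.base_mem p) e]
  rw [liftLT] at hxp
  simp only [columnExp, liftFloor, hb, kappa, hiff]
  split_ifs <;> omega

end ColumnOrder

/-! ### The slots of a multidegree -/

section SlotColoring

open MvPolynomial

variable {k : Type*} [Field k] {σ : Type*}

/-- The coloring of the slots of `r`. -/
def slotColor (r : σ →₀ ℕ) (u : Slots r) : σ := u.1

theorem slotMonomial_eq_slotMon (r : σ →₀ ℕ) (κ : Slots r →₀ ℕ) :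
    slotMonomial k r κ = slotMon k (slotColor r) κ := rfl

theorem slotProduct_eq_diffProd (lt : σ → σ → Prop) (γ : σ → σ → ℕ) (r : σ →₀ ℕ) :
    slotProduct k lt γ r = diffProd k (slotColor r) lt γ := rfl

theorem diffProd_congr {ι : Type*} [Fintype ι] (c : ι → σ) {R R' : σ → σ → Prop}
    {γ γ' : σ → σ → ℕ} (hR : ∀ x y, R x y ↔ R' x y) (hγ : ∀ x y, R x y → γ x y = γ' x y) :
    diffProd k c R γ = diffProd k c R' γ' := by
  rw [diffProd, diffProd]
  refine Finset.prod_congr rfl fun i _ => Finset.prod_congr rfl fun j _ => ?_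
  by_cases h : R (c i) (c j)
  · rw [if_pos h, if_pos ((hR _ _).1 h), hγ _ _ h]
  · rw [if_neg h, if_neg fun h' => h ((hR _ _).2 h')]

theorem colorDeg_slotColor (r : σ →₀ ℕ) : colorDeg (slotColor r) = r := by
  rw [colorDeg, Fintype.sum_sigma]
  simp only [slotColor, Finset.sum_const, Finset.card_univ, Fintype.card_fin, Finsupp.smul_single,
    smul_eq_mul, mul_one]
  rw [Finset.sum_coe_sort r.support (fun i => Finsupp.single i (r i))]
  exact Finsupp.sum_single r

theorem mem_Lam_iff (r : σ →₀ ℕ) (F : MvPolynomial (Slots r) k) :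
    F ∈ Lam k r ↔ IsColorSymm (slotColor r) F := by
  constructor
  · intro hF π hπ
    have h : ∀ (i : r.support) (l : Fin (r i)), ∃ l', π ⟨i, l⟩ = ⟨i, l'⟩ := by
      intro i l
      have h₁ : ((π ⟨i, l⟩).1 : σ) = i := congrFun hπ ⟨i, l⟩
      have h₂ : (π ⟨i, l⟩).1 = i := Subtype.ext h₁
      rcases hp : π ⟨i, l⟩ with ⟨j, l'⟩
      rw [hp] at h₂
      obtain rfl : j = i := h₂
      exact ⟨l', rfl⟩
    choose g hg using h
    have hinj : ∀ i, Function.Injective (g i) := fun i l l' e => by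
      have := hg i l
      rw [e, ← hg i l'] at this
      simpa using π.injective this
    have e : Equiv.sigmaCongrRight (fun i =>
        Equiv.ofBijective (g i) (Finite.injective_iff_bijective.1 (hinj i))) = π := by
      ext1 ⟨i, l⟩
      exact (hg i l).symm
    have := hF fun i => Equiv.ofBijective (g i) (Finite.injective_iff_bijective.1 (hinj i))
    rwa [e] at this
  · exact fun hF τ => hF (Equiv.sigmaCongrRight τ) rfl

/-- The slots can be ordered compatibly with any order of the colors. -/
theorem exists_linearOrder_slots [LinearOrder σ] (r : σ →₀ ℕ) :
    ∃ o : LinearOrder (Slots r), ∀ u v, o.le u v → slotColor r u ≤ slotColor r v := by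
  have hinj : Function.Injective fun u : Slots r => toLex (slotColor r u, (u.2 : ℕ)) := by
    rintro ⟨⟨i, hi⟩, l⟩ ⟨⟨j, hj⟩, l'⟩ h
    have h₁ : i = j := congrArg (fun p => (ofLex p).1) h
    have h₂ : (l : ℕ) = l' := congrArg (fun p => (ofLex p).2) h
    subst h₁
    rw [Fin.ext h₂]
  exact ⟨LinearOrder.lift' _ hinj, fun u v huv =>
    Prod.Lex.monotone_fst (toLex (slotColor r u, (u.2 : ℕ))) (toLex (slotColor r v, (v.2 : ℕ))) huv⟩

end SlotColoring

/-! ### Functionals on the associated graded space -/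

section Functional

open MvPolynomial

variable {k : Type*} [Field k] [CharZero k] {n : ℕ} {P : Set (Fin n → ℝ)} {ζ : (Fin n → ℝ) → ℝ}
  {idx : (Fin n → ℤ) → ℕ} {prec : (latticePoints P →₀ ℕ) → (latticePoints P →₀ ℕ) → Prop}
  {γ : (Fin n → ℤ) → (Fin n → ℤ) → ℕ} {e : (Fin n → ℤ) → (Fin n → ℤ) → ℕ → (Fin n → ℤ)}

omit [CharZero k] in
/-- A functional annihilating the initial ideal vanishes, in the projected multidegree of `r`, on
the coefficients of relations with no component larger than `r`. -/
theorem apply_mergeHom_eq_zero (h : IsLiftFunction P ζ)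
    (hstrict : IsStrictCubeGeneratingData k P prec γ e)
    {r : latticePoints (liftPolytope P ζ) →₀ ℕ}
    {ω : MvPolynomial (Option (latticePoints P) × ℕ) k →ₗ[k] k}
    (hω₁ : ∀ s ≠ liftDeg h.basePoint (fun x => (height x.1).toNat) r, ∀ g,
      IsWeightedHomogeneous multiWeight g s → ω g = 0)
    (hω₂ : ∀ g ∈ diagIdeal k (optionGamma fun x y : latticePoints P => γ x y), ω g = 0)
    {g : MvPolynomial (latticePoints (liftPolytope P ζ) × ℕ) k}
    (hg : g ∈ definingIdeal k (liftPolytope P ζ))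
    (hgr : ∀ r', weightedHomogeneousComponent multiWeight r' g ≠ 0 →
      r' = r ∨ liftPrec P idx prec ζ r' r) :
    ω (mergeHom k _ (liftHom k h.basePoint (fun x => (height x.1).toNat) g)) = 0 := by
  classical
  rw [mergeHom_eq_sum, map_sum]
  refine Finset.sum_eq_zero fun ν _ => ?_
  -- the contribution of one monomial `z` in the coefficients of the additional series
  set z : MvPolynomial (Option (latticePoints P) × ℕ) k :=
    ∏ i ∈ ν.support, X (none, i) ^ ν i with hz
  have hzhom : IsWeightedHomogeneous multiWeight z
      (∑ i ∈ ν.support, ν i • Finsupp.single (none : Option (latticePoints P)) 1) :=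
    IsWeightedHomogeneous.prod _ _ _ fun i _ => (isWeightedHomogeneous_X k multiWeight _).pow _
  let L : MvPolynomial (latticePoints P × ℕ) k →ₗ[k] k :=
    ω.comp ((LinearMap.mulRight k z).comp (rename (Prod.map some id)).toLinearMap)
  have hL : ∀ q, L q = ω (rename (Prod.map some id) q * z) := fun _ => rfl
  have hLs : ∀ s ≠ r.mapDomain h.basePoint, ∀ q, IsWeightedHomogeneous multiWeight q s →
      L q = 0 := by
    intro s hs q hq
    rw [hL]
    refine hω₁ _ (fun e => hs ?_) _ ((rename_some_isWeightedHomogeneous hq).mul hzhom)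
    ext b
    have := DFunLike.congr_fun e (some b)
    rw [liftDeg_some, Finsupp.add_apply, Finsupp.mapDomain_apply (Option.some_injective _),
      Finsupp.finsetSum_apply, Finset.sum_eq_zero, add_zero] at this
    · exact this
    · intro i _
      simp
  rw [← hL, apply_eq_apply_component L _ hLs]
  set p := weightedHomogeneousComponent multiWeight (r.mapDomain h.basePoint)
    (coeff ν (liftHom k h.basePoint (fun x => (height x.1).toNat) g)) with hp
  by_cases hp0 : p = 0
  · rw [hp0, map_zero]
  -- `p` is an initial part of a relation of `R(P)`, so it lies in the quadratic ideal of `P`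
  let M : MvPolynomial (latticePoints (liftPolytope P ζ) × ℕ) k →ₗ[k]
      MvPolynomial (latticePoints P × ℕ) k :=
    { toFun := fun g => coeff ν (liftHom k h.basePoint (fun x => (height x.1).toNat) g)
      map_add' := fun a b => by rw [map_add, coeff_add]
      map_smul' := fun a b => by rw [map_smul, coeff_smul]; rfl }
  have hinit : p ∈ initialIdeal prec (definingIdeal k P) := by
    refine Submodule.subset_span ⟨_, h.coeff_liftHom_mem_definingIdeal k hg ν, _, hp, hp0, ?_⟩
    intro s hs
    obtain ⟨r', hr', rfl⟩ := exists_component_ne_zero M (fun r => r.mapDomain h.basePoint)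
      (fun r g hg => coeff_liftHom_isWeightedHomogeneous _ _ hg ν) hs
    rcases hgr r' hr' with rfl | hlt | ⟨heq, -⟩
    · exact Or.inl rfl
    · rw [h.prVec_eq, h.prVec_eq] at hlt
      exact Or.inr hlt
    · rw [h.prVec_eq, h.prVec_eq] at heq
      exact Or.inl heq
  rw [← hstrict.generate] at hinit
  rw [hL]
  exact hω₂ _ (Ideal.mul_mem_right _ _ (rename_some_mem_diagIdeal hinit))

/-- Every element of the principal ideal is the symbol of a functional on the associated graded
component. -/
theorem exists_functional_of_mem_principalIdeal (h : IsLiftFunction P ζ)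
    (hidx : Set.InjOn idx (latticePoints P)) (hstrict : IsStrictCubeGeneratingData k P prec γ e)
    (r : latticePoints (liftPolytope P ζ) →₀ ℕ) {F : MvPolynomial (Slots r) k}
    (hF : F ∈ principalIdeal k (fun x y => liftLT idx x.1 y.1)
      (fun x y => liftGamma P idx γ ζ x.1 y.1) r) :
    ∃ ω : MvPolynomial (latticePoints (liftPolytope P ζ) × ℕ) k →ₗ[k] k,
      IsSymbol ω (slotColor r) F ∧
      (∀ r', liftPrec P idx prec ζ r' r → ∀ g, IsWeightedHomogeneous multiWeight g r' → ω g = 0) ∧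
      ∀ g ∈ definingIdeal k (liftPolytope P ζ),
        (∀ r', weightedHomogeneousComponent multiWeight r' g ≠ 0 →
          r' = r ∨ liftPrec P idx prec ζ r' r) → ω g = 0 := by
  classical
  obtain ⟨f, hf, rfl⟩ := hF
  have hf : IsColorSymm (slotColor r) f := (mem_Lam_iff r f).1 hf
  let hlin := h.linearOrder hidx
  obtain ⟨hord, hmono⟩ := @exists_linearOrder_slots _ hlin r
  have hγ : ∀ u v : latticePoints P, u ≠ v → γ u v = γ v u := fun u v huv =>
    hstrict.toData.gamma_symm u u.2 v v.2 fun e => huv (Subtype.ext e)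
  have hinj : Function.Injective fun u : latticePoints P => idx u := fun u v e =>
    Subtype.ext (hidx u.2 v.2 e)
  obtain ⟨ω, h₁, h₂, h₃, h₄⟩ := @exists_separated_functional k _ (Slots r) _ _ _ h.basePoint
    (fun x => (height x.1).toNat) (liftFloor P ζ idx) _ hlin (h.isColumnOrder hidx)
    (fun u => idx u) hinj (fun u v => γ u v) hγ (slotColor r) hord
    (fun u v huv => hmono u v huv) f hf
    (fun x y => if idx (h.basePoint x) = idx (h.basePoint y) then 0
      else γ (h.basePoint x) (h.basePoint y)) fun _ _ => rfl
  rw [colorDeg_slotColor] at h₁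
  have hprod : slotProduct k (fun x y => liftLT idx x.1 y.1)
      (fun x y => liftGamma P idx γ ζ x.1 y.1) r = diffProd k (slotColor r) hlin.lt
        fun x y => (if idx (h.basePoint x) = idx (h.basePoint y) then 0
          else γ (h.basePoint x) (h.basePoint y)) +
            columnExp h.basePoint (fun x => (height x.1).toNat) (liftFloor P ζ idx) x y := by
    rw [slotProduct_eq_diffProd]
    refine diffProd_congr _ (fun x y => (h.linearOrder_lt_iff hidx x y).symm) fun x y hlt => ?_
    have hiff : idx (h.basePoint x) = idx (h.basePoint y) ↔ base x.1 = base y.1 :=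
      ⟨fun e => hidx (h.base_mem _) (h.base_mem _) e, fun e => congrArg idx e⟩
    simp only [h.columnExp_eq_kappa hidx hlt, liftGamma, if_pos hlt, gammaLT, hiff]
    rfl
  let Ψ := (mergeHom k (latticePoints P)).toLinearMap.comp
    (liftHom k h.basePoint fun x => (height x.1).toNat).toLinearMap
  have hΨ : ∀ g, (ω.comp Ψ) g =
      ω (mergeHom k _ (liftHom k h.basePoint (fun x => (height x.1).toNat) g)) := fun _ => rfl
  refine ⟨ω.comp Ψ, fun κ => ?_, fun r' hr' g hg => ?_, fun g hg hgr => ?_⟩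
  · rw [hΨ, LinearMap.mulLeft_apply, hprod]
    exact h₄ κ
  · -- `ω` kills smaller multidegrees with the same projection, and all other projections
    refine eq_of_eq_on_monomials (ω.comp Ψ) 0 (fun m hm => ?_) hg
    rw [LinearMap.zero_apply, hΨ]
    by_cases hpr : r'.mapDomain h.basePoint = r.mapDomain h.basePoint
    · obtain ⟨c', hc', κ, rfl⟩ := exists_slotExp_of_mapDomain h.basePoint m
        (h.basePoint ∘ slotColor r) (by rw [hm, hpr, ← colorDeg_mapDomain, colorDeg_slotColor])
      rw [weight_slotExp] at hm
      rw [← slotMon_eq_monomial]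
      refine h₃ c' hc' ?_ κ
      rcases hr' with hr' | ⟨-, y, hy, hy'⟩
      · rw [h.prVec_eq, h.prVec_eq, hpr] at hr'
        exact absurd hr' (hstrict.toData.order.irrefl _)
      · refine ⟨y, ?_, fun z hz => ?_⟩
        · rwa [hm, colorDeg_slotColor]
        · rw [hm, colorDeg_slotColor]
          exact hy' z ((h.linearOrder_lt_iff hidx z y).1 hz)
    · refine h₁ (liftDeg h.basePoint (fun x => (height x.1).toNat) r') (fun e => hpr ?_) _ ?_
      · ext b
        have := DFunLike.congr_fun e (some b)
        rwa [liftDeg_some, liftDeg_some] at this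
      · have hmon : IsWeightedHomogeneous multiWeight (monomial m (1 : k)) r' :=
          isWeightedHomogeneous_monomial _ _ _ hm
        exact mergeHom_liftHom_isWeightedHomogeneous _ _ hmon
  · rw [hΨ]
    exact apply_mergeHom_eq_zero h hstrict h₁ h₂ hg hgr

end Functional

/-! ### From symbols to the initial ideal and the graded dual -/

section Duality

open MvPolynomial

variable {k : Type*} [Field k] {σ : Type*} {prec : (σ →₀ ℕ) → (σ →₀ ℕ) → Prop}

theorem component_weight_ne_zero {g : MvPolynomial (σ × ℕ) k} {m : σ × ℕ →₀ ℕ}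
    (hm : m ∈ g.support) :
    weightedHomogeneousComponent multiWeight (Finsupp.weight multiWeight m) g ≠ 0 := by
  classical
  intro h0
  have := congrArg (coeff m) h0
  rw [coeff_weightedHomogeneousComponent, if_pos rfl, coeff_zero] at this
  exact mem_support_iff.1 hm this

/-- A linear map vanishing below `r` only sees the component of multidegree `r` of an element
without components above `r`. -/
theorem apply_eq_apply_top_component {V : Type*} [AddCommGroup V] [Module k V]
    (ω : MvPolynomial (σ × ℕ) k →ₗ[k] V) {r : σ →₀ ℕ}
    (hω : ∀ s, prec s r → ∀ q, IsWeightedHomogeneous multiWeight q s → ω q = 0)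
    {g : MvPolynomial (σ × ℕ) k}
    (hg : ∀ s, weightedHomogeneousComponent multiWeight s g ≠ 0 → s = r ∨ prec s r) :
    ω g = ω (weightedHomogeneousComponent multiWeight r g) := by
  classical
  rw [weightedHomogeneousComponent_apply, map_sum, Finset.sum_filter]
  conv_lhs => rw [g.as_sum, map_sum]
  refine Finset.sum_congr rfl fun m hm => ?_
  split_ifs with e
  · rfl
  · exact hω _ ((hg _ (component_weight_ne_zero hm)).resolve_left e) _
      (isWeightedHomogeneous_monomial _ _ _ rfl)

section InitialIdeal

variable (hprec : IsMonomialOrder prec) {I : Ideal (MvPolynomial (σ × ℕ) k)}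
include hprec

theorem monomial_mul_mem_initialIdeal (m : σ × ℕ →₀ ℕ) {a : k} (ha : a ≠ 0)
    {g h : MvPolynomial (σ × ℕ) k} (hg : g ∈ I) (hh : IsInitialPart prec g h) :
    monomial m a * h ∈ initialIdeal prec I := by
  classical
  obtain ⟨r, rfl, hne, hmax⟩ := hh
  have hm : IsWeightedHomogeneous multiWeight (monomial m a) (Finsupp.weight multiWeight m) :=
    isWeightedHomogeneous_monomial _ _ _ rfl
  have hcomp := apply_eq_apply_component
    ((weightedHomogeneousComponent multiWeight (Finsupp.weight multiWeight m + r)).comp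
      (LinearMap.mulLeft k (monomial m a))) r (fun s hs q hq => by
        rw [LinearMap.comp_apply, LinearMap.mulLeft_apply,
          weightedHomogeneousComponent_of_mem (hm.mul hq), if_neg]
        exact fun e => hs (add_left_cancel e).symm) g
  rw [LinearMap.comp_apply, LinearMap.mulLeft_apply, LinearMap.comp_apply, LinearMap.mulLeft_apply,
    weightedHomogeneousComponent_of_mem
      (hm.mul (weightedHomogeneousComponent_isWeightedHomogeneous r g)), if_pos rfl] at hcomp
  refine Submodule.subset_span ⟨monomial m a * g, Ideal.mul_mem_left _ _ hg, _, hcomp.symm,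
    mul_ne_zero ((monomial_eq_zero (s := m)).not.2 ha) hne, fun s hs => ?_⟩
  obtain ⟨r', hr', rfl⟩ := exists_component_ne_zero (LinearMap.mulLeft k (monomial m a))
    (fun r => Finsupp.weight multiWeight m + r) (fun r g hg => hm.mul hg) hs
  rcases hmax r' hr' with rfl | hlt
  · exact Or.inl rfl
  · right
    rw [add_comm _ r', add_comm _ r]
    exact hprec.add_right _ _ _ hlt

/-- The linear span of the initial parts is an ideal. -/
theorem mul_mem_initialIdeal (p : MvPolynomial (σ × ℕ) k) {h : MvPolynomial (σ × ℕ) k}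
    (hh : h ∈ initialIdeal prec I) : p * h ∈ initialIdeal prec I := by
  induction hh using Submodule.span_induction with
  | zero => rw [mul_zero]; exact Submodule.zero_mem _
  | add a b _ _ ha hb => rw [mul_add]; exact Submodule.add_mem _ ha hb
  | smul c a _ ha => rw [mul_smul_comm]; exact Submodule.smul_mem _ _ ha
  | mem h hh =>
    obtain ⟨g, hg, hh⟩ := hh
    induction p using MvPolynomial.induction_on' with
    | add p q hp hq => rw [add_mul]; exact Submodule.add_mem _ hp hq
    | monomial m a =>
      by_cases ha : a = 0
      · rw [ha, monomial_zero, zero_mul]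
        exact Submodule.zero_mem _
      · exact monomial_mul_mem_initialIdeal hprec m ha hg hh

theorem mem_initialIdeal_of_mem_diagIdeal {γ : σ → σ → ℕ}
    (hquad : ∀ x y, x ≠ y → ∀ l < γ x y, ∀ d, quadCoeff k x y l d ∈ initialIdeal prec I)
    {g : MvPolynomial (σ × ℕ) k} (hg : g ∈ diagIdeal k γ) : g ∈ initialIdeal prec I := by
  induction hg using Submodule.span_induction with
  | zero => exact Submodule.zero_mem _
  | add a b _ _ ha hb => exact Submodule.add_mem _ ha hb
  | smul c a _ ha => exact mul_mem_initialIdeal hprec c ha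
  | mem h hh =>
    obtain ⟨x, y, hxy, l, hl, d, rfl⟩ := hh
    exact hquad x y hxy l hl d

end InitialIdeal

/-- A functional vanishing in large degrees has a symbol. -/
theorem exists_isSymbol (η : MvPolynomial (σ × ℕ) k →ₗ[k] k) (r : σ →₀ ℕ) (D : ℕ)
    (hD : ∀ d, D ≤ d → ∀ p, IsWeightedHomogeneous multiWeight p r →
      IsWeightedHomogeneous gradWeight p d → η p = 0) :
    ∃ F : MvPolynomial (Slots r) k, IsSymbol η (slotColor r) F := by
  have hfin : (Function.support fun κ => η (slotMon k (slotColor r) κ)).Finite := by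
    refine (Finsupp.finite_of_degree_lt D).subset fun κ hκ => ?_
    by_contra hlt
    refine hκ (hD _ (not_lt.1 hlt) _ ?_ ?_)
    · rw [slotMon_eq_monomial]
      exact isWeightedHomogeneous_monomial _ _ _ (by rw [weight_slotExp, colorDeg_slotColor])
    · rw [slotMon_eq_monomial]
      exact isWeightedHomogeneous_monomial _ _ _ (by
        rw [gradWeight_slotExp, Finsupp.degree_eq_sum])
  exact ⟨∑ κ ∈ hfin.toFinset, monomial κ (η (slotMon k (slotColor r) κ)), fun κ => by
    classical
    simp only [coeff_sum, coeff_monomial, Finset.sum_ite_eq', Set.Finite.mem_toFinset,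
      Function.mem_support, ne_eq, ite_not]
    split_ifs with h0
    · exact h0
    · rfl⟩

/-- The part of degree `d` of a functional on the multidegree `r` is determined by the part of
degree `d` of its symbol. -/
theorem IsSymbol.apply_eq_zero {η : MvPolynomial (σ × ℕ) k →ₗ[k] k} {r : σ →₀ ℕ}
    {F : MvPolynomial (Slots r) k} (hF : IsSymbol η (slotColor r) F) {d : ℕ}
    (hd : ∀ κ : Slots r →₀ ℕ, κ.degree = d → coeff κ F = 0) {p : MvPolynomial (σ × ℕ) k}
    (hp : IsWeightedHomogeneous multiWeight p r) (hpd : IsWeightedHomogeneous gradWeight p d) :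
    η p = 0 := by
  rw [p.as_sum, map_sum]
  refine Finset.sum_eq_zero fun m hm => ?_
  obtain ⟨κ, rfl⟩ := exists_slotExp m (slotColor r)
    (by rw [colorDeg_slotColor]; exact hp (mem_support_iff.1 hm))
  have hκ := hpd (mem_support_iff.1 hm)
  rw [gradWeight_slotExp, ← Finsupp.degree_eq_sum] at hκ
  rw [← mul_one (coeff _ p), ← smul_eq_mul, ← smul_monomial, ← slotMon_eq_monomial, map_smul, hF,
    hd κ hκ, smul_zero]

theorem IsSymbol.apply_eq {η ω : MvPolynomial (σ × ℕ) k →ₗ[k] k} {r : σ →₀ ℕ}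
    {F : MvPolynomial (Slots r) k} (hη : IsSymbol η (slotColor r) F)
    (hω : IsSymbol ω (slotColor r) F) {p : MvPolynomial (σ × ℕ) k}
    (hp : IsWeightedHomogeneous multiWeight p r) : η p = ω p := by
  refine eq_of_eq_on_monomials η ω (fun m hm => ?_) hp
  obtain ⟨κ, rfl⟩ := exists_slotExp m (slotColor r) (by rw [colorDeg_slotColor, hm])
  rw [← slotMon_eq_monomial, hη, hω]

/-- The symbol of a functional annihilating the quadratic relations lies in the principal ideal. -/
theorem IsSymbol.mem_principalIdeal [CharZero k] {lt : σ → σ → Prop}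
    (hlt : ∀ x y, lt x y → ¬lt y x) {γ : σ → σ → ℕ} {η : MvPolynomial (σ × ℕ) k →ₗ[k] k}
    (hη : ∀ g ∈ diagIdeal k γ, η g = 0) {r : σ →₀ ℕ} {F : MvPolynomial (Slots r) k}
    (hF : IsSymbol η (slotColor r) F) : F ∈ principalIdeal k lt γ r := by
  classical
  have hirr : ∀ x, ¬lt x x := fun x h => hlt x x h h
  have hdvd : slotProduct k lt γ r ∣ F := by
    have := prod_X_sub_X_pow_dvd (fun i j => lt (slotColor r i) (slotColor r j))
      (fun i j => hlt _ _) (fun i j => γ (slotColor r i) (slotColor r j)) F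
      fun i j hij => hF.pow_dvd hη fun e => hirr _ (e ▸ hij)
    rw [slotProduct_eq_diffProd, diffProd]
    convert this
  obtain ⟨f, rfl⟩ := hdvd
  refine ⟨f, (mem_Lam_iff r f).2 fun π hπ => ?_, rfl⟩
  have h₁ := hF.isColorSymm π hπ
  rw [map_mul, slotProduct_eq_diffProd, diffProd_symm _ _ _ π hπ] at h₁
  exact mul_left_cancel₀ (diffProd_ne_zero _ hirr _) h₁

theorem gradComponent_mem_diagIdeal {γ : σ → σ → ℕ} {g : MvPolynomial (σ × ℕ) k}
    (hg : g ∈ diagIdeal k γ) (d : ℕ) :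
    weightedHomogeneousComponent gradWeight d g ∈ diagIdeal k γ := by
  let := weightedGradedAlgebra k (gradWeight (σ := σ))
  refine weightedHomogeneousComponent_mem_of_mem k gradWeight
    (Ideal.homogeneous_span _ _ ?_) hg d
  rintro _ ⟨x, y, -, l, -, d, rfl⟩
  exact ⟨d + l, quadCoeff_gradHomogeneous x y l d⟩

section Main

variable [CharZero k] (hprec : IsMonomialOrder prec) {lt : σ → σ → Prop}
  (hlt : ∀ x y, lt x y → ¬lt y x) {γ : σ → σ → ℕ} {A : Type*} [CommRing A] [Algebra k A]
  (π : MvPolynomial (σ × ℕ) k →ₐ[k] A)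
  (hquad : ∀ x y, x ≠ y → ∀ l < γ x y, ∀ d,
    quadCoeff k x y l d ∈ initialIdeal prec (RingHom.ker π))
  (hfun : ∀ (r : σ →₀ ℕ) (F : MvPolynomial (Slots r) k), F ∈ principalIdeal k lt γ r →
    ∃ ω : MvPolynomial (σ × ℕ) k →ₗ[k] k, IsSymbol ω (slotColor r) F ∧
      (∀ r', prec r' r → ∀ g, IsWeightedHomogeneous multiWeight g r' → ω g = 0) ∧
      ∀ g ∈ RingHom.ker π, (∀ r', weightedHomogeneousComponent multiWeight r' g ≠ 0 →
        r' = r ∨ prec r' r) → ω g = 0)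

include hlt hfun in
/-- An initial part outside the ideal of quadratic relations would be detected by a functional
annihilating them. Its symbol lies in the principal ideal, hence is also the symbol of a functional
annihilating all relations: a contradiction. -/
theorem mem_diagIdeal_of_isInitialPart {g h : MvPolynomial (σ × ℕ) k} (hg : g ∈ RingHom.ker π)
    (hh : IsInitialPart prec g h) : h ∈ diagIdeal k γ := by
  classical
  obtain ⟨r, rfl, -, hmax⟩ := hh
  set h := weightedHomogeneousComponent multiWeight r g with hdef
  have hr : IsWeightedHomogeneous multiWeight h r :=
    weightedHomogeneousComponent_isWeightedHomogeneous r g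
  by_contra hmem
  obtain ⟨d, hd⟩ : ∃ d, weightedHomogeneousComponent gradWeight d h ∉ diagIdeal k γ := by
    by_contra! hall
    apply hmem
    rw [← sum_weightedHomogeneousComponent (w := gradWeight) h]
    rw [finsum_eq_sum _ (weightedHomogeneousComponent_finsupp h)]
    exact Ideal.sum_mem _ fun d _ => hall d
  obtain ⟨ξ, hξ, hker⟩ := Submodule.exists_le_ker_of_notMem
    (p := (diagIdeal k γ).restrictScalars k) hd
  -- restricting to one degree makes the symbol a polynomial
  let η := ξ.comp (weightedHomogeneousComponent gradWeight d)
  have hη : ∀ g ∈ diagIdeal k γ, η g = 0 := fun g hg => hker (gradComponent_mem_diagIdeal hg d)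
  obtain ⟨F, hF⟩ := exists_isSymbol η r (d + 1) fun d' hd' p _ hp => by
    change ξ (weightedHomogeneousComponent gradWeight d p) = 0
    rw [weightedHomogeneousComponent_of_mem hp, if_neg (by omega), map_zero]
  obtain ⟨ω, hω₁, hω₂, hω₃⟩ := hfun r F (hF.mem_principalIdeal hlt hη)
  have h₀ : ω g = ω h := apply_eq_apply_top_component ω hω₂ hmax
  rw [hω₃ g hg hmax, hω₁.apply_eq hF hr] at h₀
  exact hξ h₀.symm

include hprec hlt hquad hfun in
/-- If every element of the principal ideals is the symbol of a functional on the associated graded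
space, the quadratic relations generate the initial ideal. -/
theorem diagIdeal_eq_initialIdeal :
    (diagIdeal k γ).restrictScalars k = initialIdeal prec (RingHom.ker π) := by
  refine le_antisymm (fun g hg => mem_initialIdeal_of_mem_diagIdeal hprec hquad hg)
    (Submodule.span_le.2 ?_)
  rintro h ⟨g, hg, hh⟩
  exact mem_diagIdeal_of_isInitialPart hlt π hfun hg hh

omit [CharZero k] in
theorem grClass_eq_zero_iff {r : σ →₀ ℕ} (p : multiComponent k r) :
    grClass prec π r p = 0 ↔ π p.1 ∈ filtLT prec π r := by
  rw [grClass, LinearMap.comp_apply, Submodule.mkQ_apply, Submodule.Quotient.mk_eq_zero]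
  exact Iff.rfl

omit [CharZero k] in
theorem grClass_surjective (r : σ →₀ ℕ) : Function.Surjective (grClass prec π r) := by
  intro y
  obtain ⟨⟨a, ha⟩, rfl⟩ := Submodule.mkQ_surjective _ y
  have hle : filtLE prec π r ≤ (multiComponent k r).map π.toLinearMap ⊔ filtLT prec π r := by
    refine iSup₂_le fun r' hr' => ?_
    rcases hr' with rfl | hr'
    · exact le_sup_left
    · exact le_sup_of_le_right (le_iSup₂_of_le r' hr' le_rfl)
  obtain ⟨_, ⟨p, hp, rfl⟩, b, hb, hab⟩ := Submodule.mem_sup.1 (hle ha)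
  refine ⟨⟨p, hp⟩, ?_⟩
  rw [grClass, LinearMap.comp_apply, Submodule.mkQ_apply, Submodule.mkQ_apply,
    Submodule.Quotient.eq]
  change π.toLinearMap p - a ∈ filtLT prec π r
  rw [← hab, sub_add_cancel_left]
  exact Submodule.neg_mem _ hb

/-- The projection onto the component of multidegree `r`. -/
noncomputable def multiProj (k : Type*) [Field k] {σ : Type*} (r : σ →₀ ℕ) :
    MvPolynomial (σ × ℕ) k →ₗ[k] multiComponent k r :=
  (weightedHomogeneousComponent multiWeight r).codRestrict (multiComponent k r) fun g =>
    show _ ∈ multiComponent k r from weightedHomogeneousComponent_mem multiWeight g r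

/-- The functional on polynomials given by a functional on the associated graded component. -/
noncomputable def grFunctional {r : σ →₀ ℕ} (ξ : Module.Dual k (GrComponent prec π r)) :
    MvPolynomial (σ × ℕ) k →ₗ[k] k :=
  ξ.comp ((grClass prec π r).comp (multiProj k r))

omit [CharZero k] in
theorem grFunctional_apply {r : σ →₀ ℕ} (ξ : Module.Dual k (GrComponent prec π r))
    (p : multiComponent k r) : grFunctional π ξ p.1 = ξ (grClass prec π r p) := by
  classical
  rw [grFunctional, LinearMap.comp_apply, LinearMap.comp_apply]
  congr 2
  refine Subtype.ext ?_
  change weightedHomogeneousComponent multiWeight r p.1 = p.1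
  rw [weightedHomogeneousComponent_of_mem p.2, if_pos rfl]

omit [CharZero k] in
theorem grFunctional_eq_zero {r : σ →₀ ℕ} (ξ : Module.Dual k (GrComponent prec π r))
    {g : MvPolynomial (σ × ℕ) k} (hg : g ∈ initialIdeal prec (RingHom.ker π)) :
    grFunctional π ξ g = 0 := by
  classical
  suffices hle : initialIdeal prec (RingHom.ker π) ≤ LinearMap.ker (grFunctional π ξ) from hle hg
  refine Submodule.span_le.2 ?_
  rintro _ ⟨g, hg, s, rfl, -, hmax⟩
  rw [SetLike.mem_coe, LinearMap.mem_ker]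
  by_cases hs : s = r
  · subst hs
    have key := apply_eq_apply_top_component (prec := prec)
      ((Submodule.mkQ (filtLT prec π s)).comp π.toLinearMap) (fun s' hs' q hq => by
        rw [LinearMap.comp_apply, Submodule.mkQ_apply, Submodule.Quotient.mk_eq_zero]
        exact Submodule.mem_iSup_of_mem s' (Submodule.mem_iSup_of_mem hs'
          (Submodule.mem_map_of_mem hq))) hmax
    rw [LinearMap.comp_apply, LinearMap.comp_apply, show π.toLinearMap g = 0 from hg, map_zero,
      eq_comm, Submodule.mkQ_apply, Submodule.Quotient.mk_eq_zero] at key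
    rw [grFunctional_apply π ξ ⟨_, weightedHomogeneousComponent_isWeightedHomogeneous s g⟩,
      (grClass_eq_zero_iff π _).2 key, map_zero]
  · have h0 : (weightedHomogeneousComponent multiWeight r)
        (weightedHomogeneousComponent multiWeight s g) = 0 := by
      rw [weightedHomogeneousComponent_of_mem
        (weightedHomogeneousComponent_isWeightedHomogeneous s g), if_neg (Ne.symm hs)]
    rw [grFunctional, LinearMap.comp_apply, LinearMap.comp_apply,
      show multiProj k r _ = 0 from Subtype.ext h0, map_zero, map_zero]

omit [CharZero k] in
/-- A functional annihilating the relations without components above `r`, and everything below `r`,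
descends to the associated graded component. -/
theorem exists_dual_of_functional {r : σ →₀ ℕ}
    (ω : MvPolynomial (σ × ℕ) k →ₗ[k] k)
    (hω₂ : ∀ r', prec r' r → ∀ g, IsWeightedHomogeneous multiWeight g r' → ω g = 0)
    (hω₃ : ∀ g ∈ RingHom.ker π, (∀ r', weightedHomogeneousComponent multiWeight r' g ≠ 0 →
        r' = r ∨ prec r' r) → ω g = 0) :
    ∃ ξ : Module.Dual k (GrComponent prec π r),
      ∀ p : multiComponent k r, ξ (grClass prec π r p) = ω p.1 := by
  classical
  obtain ⟨s, hs⟩ := LinearMap.exists_rightInverse_of_surjective (grClass prec π r)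
    (LinearMap.range_eq_top.2 (grClass_surjective π r))
  have hker : ∀ p : multiComponent k r, grClass prec π r p = 0 → ω p.1 = 0 := by
    intro p hp
    rw [grClass_eq_zero_iff] at hp
    have hmap : filtLT prec π r =
        (⨆ r' ∈ {r' | prec r' r}, multiComponent k r').map π.toLinearMap := by
      simp only [filtLT, Submodule.map_iSup]
    rw [hmap] at hp
    obtain ⟨q, hq, hqp⟩ := hp
    have h₁ : ω q = 0 := by
      suffices hle : (⨆ r' ∈ {r' | prec r' r}, multiComponent k r') ≤ LinearMap.ker ω from hle hq
      exact iSup₂_le fun r' hr' g hg => hω₂ r' hr' g hg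
    have h₂ : ∀ s, ¬prec s r → weightedHomogeneousComponent multiWeight s q = 0 := by
      intro s hs
      suffices hle : (⨆ r' ∈ {r' | prec r' r}, multiComponent k r') ≤
          LinearMap.ker (weightedHomogeneousComponent (R := k) multiWeight s) from hle hq
      refine iSup₂_le fun r' hr' g hg => ?_
      rw [LinearMap.mem_ker, weightedHomogeneousComponent_of_mem hg, if_neg]
      rintro rfl
      exact hs hr'
    have h₃ : ω (p.1 - q) = 0 := by
      refine hω₃ _ ?_ fun s hs => ?_
      · rw [RingHom.mem_ker, map_sub, sub_eq_zero]
        exact hqp.symm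
      · by_contra! hne
        rw [map_sub, h₂ s hne.2, weightedHomogeneousComponent_of_mem p.2, if_neg hne.1,
          sub_zero] at hs
        exact hs rfl
    rwa [map_sub, h₁, sub_zero] at h₃
  refine ⟨(ω.comp (multiComponent k r).subtype).comp s, fun p => ?_⟩
  have h₁ := hker (s (grClass prec π r p) - p) (by
    rw [map_sub, ← LinearMap.comp_apply, hs, LinearMap.id_apply, sub_self])
  rw [Submodule.coe_sub, map_sub, sub_eq_zero] at h₁
  exact h₁

include hprec hlt hquad hfun in
/-- Under the same assumptions, taking symbols identifies the graded dual of a component of the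
associated graded space with the principal ideal. -/
theorem dualIsPrincipalIdeal (r : σ →₀ ℕ) : DualIsPrincipalIdeal prec π lt γ r := by
  classical
  have hsymb : ∀ ξ : gradedDual prec π r, ∃ F : MvPolynomial (Slots r) k,
      IsSymbol (grFunctional π ξ.1) (slotColor r) F := by
    rintro ⟨ξ, D, hD⟩
    refine exists_isSymbol _ r D fun d hd p hp hpd => ?_
    rw [grFunctional_apply π ξ ⟨p, hp⟩]
    exact hD d hd ⟨p, hp⟩ hpd
  choose Φ hΦ using hsymb
  have hcoeff : ∀ (ξ : gradedDual prec π r) (κ : Slots r →₀ ℕ), coeff κ (Φ ξ) =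
      (ξ : Module.Dual k (GrComponent prec π r))
        (grClass prec π r ⟨slotMonomial k r κ, slotMonomial_mem r κ⟩) := fun ξ κ => by
    rw [← hΦ ξ κ]
    exact grFunctional_apply π ξ.1 ⟨slotMonomial k r κ, slotMonomial_mem r κ⟩
  have hmem : ∀ ξ, Φ ξ ∈ principalIdeal k lt γ r := fun ξ =>
    (hΦ ξ).mem_principalIdeal hlt fun g hg =>
      grFunctional_eq_zero π ξ.1 (mem_initialIdeal_of_mem_diagIdeal hprec hquad hg)
  let Φ' : gradedDual prec π r →ₗ[k] principalIdeal k lt γ r :=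
    { toFun := fun ξ => ⟨Φ ξ, hmem ξ⟩
      map_add' := fun ξ η => Subtype.ext <| MvPolynomial.ext _ _ fun κ => by
        rw [Submodule.coe_add, coeff_add, hcoeff, hcoeff, hcoeff]
        rfl
      map_smul' := fun a ξ => Subtype.ext <| MvPolynomial.ext _ _ fun κ => by
        rw [RingHom.id_apply, Submodule.coe_smul, coeff_smul, hcoeff, hcoeff]
        rfl }
  have hinj : Function.Injective Φ' := by
    intro ξ η hξη
    refine Subtype.ext (LinearMap.ext fun y => ?_)
    obtain ⟨p, rfl⟩ := grClass_surjective π r y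
    have e : Φ ξ = Φ η := congrArg Subtype.val hξη
    have hη := hΦ η
    rw [← e] at hη
    rw [← grFunctional_apply, ← grFunctional_apply]
    exact (hΦ ξ).apply_eq hη p.2
  have hsurj : Function.Surjective Φ' := by
    rintro ⟨F, hF⟩
    obtain ⟨ω, hω₁, hω₂, hω₃⟩ := hfun r F hF
    obtain ⟨ξ, hξ⟩ := exists_dual_of_functional π ω hω₂ hω₃
    refine ⟨⟨ξ, F.totalDegree + 1, fun d hd p hp => ?_⟩, Subtype.ext <|
      MvPolynomial.ext _ _ fun κ => ?_⟩
    · rw [hξ]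
      refine hω₁.apply_eq_zero (fun κ hκ => ?_) p.2 hp
      refine coeff_eq_zero_of_totalDegree_lt ?_
      rw [← Finsupp.degree_apply]
      omega
    · change coeff κ (Φ _) = _
      rw [hcoeff, hξ, ← hω₁]
      rfl
  refine ⟨LinearEquiv.ofBijective Φ' ⟨hinj, hsurj⟩, fun ξ => ⟨hcoeff ξ, fun d => ?_⟩⟩
  change (Φ ξ).IsHomogeneous d ↔ _
  have hdeg : ∀ κ : Slots r →₀ ℕ, Finsupp.weight 1 κ = κ.degree := fun κ => by
    rw [Finsupp.degree_eq_weight_one]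
    rfl
  constructor
  · intro hd d' hne p hp
    rw [← grFunctional_apply]
    refine (hΦ ξ).apply_eq_zero (fun κ hκ => ?_) p.2 hp
    by_contra h0
    exact hne (by rw [← hκ, ← hdeg, hd h0])
  · intro hd κ hκ
    by_contra hne
    apply hκ
    rw [hcoeff]
    refine hd κ.degree (fun e => hne (by rw [hdeg, e])) _ ?_
    change IsWeightedHomogeneous gradWeight (slotMon k (slotColor r) κ) κ.degree
    rw [slotMon_eq_monomial]
    exact isWeightedHomogeneous_monomial _ _ _ (by
      rw [gradWeight_slotExp, Finsupp.degree_eq_sum])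

end Main

end Duality

end ToricArc

theorem mainTheorem1 {k : Type*} [Field k] [IsAlgClosed k] [CharZero k] {n : ℕ}
    (P : Set (Fin n → ℝ))
    -- an enumeration of the integer points of `P`, given by distinct ranks
    (idx : (Fin n → ℤ) → ℕ) (hidx : Set.InjOn idx (ToricArc.latticePoints P))
    (prec : (ToricArc.latticePoints P →₀ ℕ) → (ToricArc.latticePoints P →₀ ℕ) → Prop)
    (γ : (Fin n → ℤ) → (Fin n → ℤ) → ℕ)
    (e : (Fin n → ℤ) → (Fin n → ℤ) → ℕ → (Fin n → ℤ))
    (hstrict : ToricArc.IsStrictCubeGeneratingData k P prec γ e)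
    (ζ : (Fin n → ℝ) → ℝ) (hconcave : ConcaveOn ℝ P ζ) (hnonneg : ∀ x ∈ P, 0 ≤ ζ x)
    (hint : ∀ x ∈ ToricArc.latticePoints P, ∃ c : ℤ, ζ (ToricArc.toReal x) = c)
    (f : (Fin n → ℤ) → (Fin n → ℤ) → ℕ → ℕ) (hf : ToricArc.IsAdmissible P γ e ζ f) :
    -- the lifted data is strict cube generating data
    ToricArc.IsStrictCubeGeneratingData k (ToricArc.liftPolytope P ζ)
      (ToricArc.liftPrec P idx prec ζ) (ToricArc.liftGamma P idx γ ζ)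
      (ToricArc.liftE P idx γ e ζ f) ∧
    -- the lifted cube relations hold in the reduced arc ring, with the expected initial parts
    (∀ x y : ToricArc.latticePoints (ToricArc.liftPolytope P ζ), x ≠ y →
      ∀ m < ToricArc.liftGamma P idx γ ζ x y, ∀ d : ℕ,
        PowerSeries.coeff d (ToricArc.cubeRelation k (ToricArc.liftPolytope P ζ)
            (ToricArc.liftGamma P idx γ ζ) (ToricArc.liftE P idx γ e ζ f) x y m) ∈
          ToricArc.definingIdeal k (ToricArc.liftPolytope P ζ) ∧
        ToricArc.IsInitialPart (ToricArc.liftPrec P idx prec ζ)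
          (PowerSeries.coeff d (ToricArc.cubeRelation k (ToricArc.liftPolytope P ζ)
            (ToricArc.liftGamma P idx γ ζ) (ToricArc.liftE P idx γ e ζ f) x y m))
          ((-1) ^ ToricArc.liftGamma P idx γ ζ x y * ToricArc.quadCoeff k y x m d)) ∧
    -- the graded dual of every component of the associated graded algebra is the principal ideal
    ∀ r : ToricArc.latticePoints (ToricArc.liftPolytope P ζ) →₀ ℕ,
      ToricArc.DualIsPrincipalIdeal (ToricArc.liftPrec P idx prec ζ)
        (ToricArc.toricProj k (ToricArc.liftPolytope P ζ))
        (fun x y => ToricArc.liftLT idx x y) (fun x y => ToricArc.liftGamma P idx γ ζ x y) r := by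
  have h : ToricArc.IsLiftFunction P ζ := ⟨hstrict.toData.polytope, hconcave, hnonneg, hint⟩
  have hdata := h.isCubeGeneratingData_lift hidx hstrict.toData hf
  have hrel : ∀ x y : ToricArc.latticePoints (ToricArc.liftPolytope P ζ), x ≠ y →
      ∀ m < ToricArc.liftGamma P idx γ ζ x y, ∀ d : ℕ, _ := fun x y hxy m hm d =>
    And.intro (hdata.coeff_cubeRelation_mem (k := k) x y hxy hm d)
      (hdata.isInitialPart_cubeRelation (k := k) x y hxy m d)
  have hlt : ∀ x y : ToricArc.latticePoints (ToricArc.liftPolytope P ζ),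
      ToricArc.liftLT idx x.1 y.1 → ¬ToricArc.liftLT idx y.1 x.1 := fun _ _ =>
    ToricArc.liftLT_asymm
  have hquad : ∀ x y : ToricArc.latticePoints (ToricArc.liftPolytope P ζ), x ≠ y →
      ∀ l < ToricArc.liftGamma P idx γ ζ x.1 y.1, ∀ d, ToricArc.quadCoeff k x y l d ∈
        ToricArc.initialIdeal (ToricArc.liftPrec P idx prec ζ)
          (RingHom.ker (ToricArc.toricProj k (ToricArc.liftPolytope P ζ))) := by
    intro x y hxy l hl d
    rw [hdata.gamma_symm x x.2 y y.2 fun e => hxy (Subtype.ext e)] at hl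
    obtain ⟨h₁, h₂⟩ := hrel y x hxy.symm l hl d
    have := ToricArc.mul_mem_initialIdeal hdata.order
      ((-1) ^ ToricArc.liftGamma P idx γ ζ y x) (Submodule.subset_span ⟨_, h₁, h₂⟩)
    rwa [← mul_assoc, ← mul_pow, neg_one_mul, neg_neg, one_pow, one_mul] at this
  have hfun := fun r F hF =>
    ToricArc.exists_functional_of_mem_principalIdeal (k := k) (F := F) h hidx hstrict r hF
  exact ⟨⟨hdata, ToricArc.diagIdeal_eq_initialIdeal hdata.order hlt _ hquad hfun⟩, hrel,
    ToricArc.dualIsPrincipalIdeal hdata.order hlt _ hquad hfun⟩
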